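/- A polytope is a non-empty bounded intersection of finitely many closed half-spaces in some $\mathbb{R}^m$; it is a $d$-polytope if its affine hull has dimension $d$. Its vertices, edges and facets are its faces of dimension $0$, $1$ and $d-1$, respectively, and its graph has the vertices as nodes, two distinct vertices being adjacent when they lie on a common edge. The diameter of the graph is the maximum, over all pairs of vertices, of the minimum number of edges of a path joining them. A $d$-polytope with $n$ facets is called Hirsch-sharp if the diameter of its graph is exactly $n-d$. Lemma (Holt–Klee). Let $d\ge 0$ and $n>2d$ be integers. If there is a Hirsch-sharp $d$-polytope with $n$ facets, then there are a Hirsch-sharp $(d+1)$-polytope with $n+1$ facets, a Hirsch-sharp $(d+1)$-polytope with $n+2$ facets, and a Hirsch-sharp $(d+1)$-polytope with $n+3$ facets. -/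

import Mathlib

/-- A polyhedron: the intersection of finitely many closed half-spaces `{x | ⟪a, x⟫ ≤ b}`, `a ≠ 0`. -/
def IsPolyhedron {m : ℕ} (P : Set (EuclideanSpace ℝ (Fin m))) : Prop :=
  ∃ S : Finset (EuclideanSpace ℝ (Fin m) × ℝ),
    (∀ h ∈ S, h.1 ≠ 0) ∧ P = {x | ∀ h ∈ S, inner ℝ h.1 x ≤ h.2}

/-- A `d`-polytope: a bounded polyhedron, non-empty, whose affine hull has dimension `d`. -/
structure IsPolytopeOfDim {m : ℕ} (P : Set (EuclideanSpace ℝ (Fin m))) (d : ℕ) : Prop where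
  isPolyhedron : IsPolyhedron P
  isBounded : Bornology.IsBounded P
  nonempty : P.Nonempty
  finrank_eq : Module.finrank ℝ (vectorSpan ℝ P) = d

/-- `F` is an `i`-face of `P`: a non-empty set of maximizers over `P` of some linear functional
(that is, `P` itself or the intersection of `P` with a supporting hyperplane), whose affine hull
has dimension `i`. -/
structure IsFaceOfDim {m : ℕ} (P F : Set (EuclideanSpace ℝ (Fin m))) (i : ℕ) : Prop where
  isExposed : IsExposed ℝ P F
  nonempty : F.Nonempty
  finrank_eq : Module.finrank ℝ (vectorSpan ℝ F) = i

/-- The facets of a `d`-polytope `P`: its non-empty faces of dimension `d - 1`. -/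
def polytopeFacets {m : ℕ} (P : Set (EuclideanSpace ℝ (Fin m))) (d : ℕ) :
    Set (Set (EuclideanSpace ℝ (Fin m))) :=
  {F | ∃ i : ℕ, i + 1 = d ∧ IsFaceOfDim P F i}

/-- The vertices of `P`: the points `x` such that `{x}` is a `0`-face. -/
def polytopeVertices {m : ℕ} (P : Set (EuclideanSpace ℝ (Fin m))) :
    Set (EuclideanSpace ℝ (Fin m)) :=
  {x | IsFaceOfDim P {x} 0}

/-- The graph (`1`-skeleton) of `P`: two distinct vertices are adjacent when they lie in a common
`1`-face. -/
def polytopeGraph {m : ℕ} (P : Set (EuclideanSpace ℝ (Fin m))) :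
    SimpleGraph (polytopeVertices P) where
  Adj u v := u ≠ v ∧ ∃ F, IsFaceOfDim P F 1 ∧ (u : EuclideanSpace ℝ (Fin m)) ∈ F ∧
    (v : EuclideanSpace ℝ (Fin m)) ∈ F
  symm := ⟨fun _ _ h => ⟨h.1.symm, h.2.imp fun _ hF => ⟨hF.1, hF.2.2, hF.2.1⟩⟩⟩
  loopless := ⟨fun _ h => h.1 rfl⟩

/-- `P` is a Hirsch-sharp `d`-polytope with `n` facets: the diameter of its graph is exactly
`n - d`. The equation is written in `ℕ∞` as `diam + d = n`, so that the diameter is finite and no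
truncated subtraction occurs. -/
structure IsHirschSharp {m : ℕ} (P : Set (EuclideanSpace ℝ (Fin m))) (d n : ℕ) : Prop where
  isPolytope : IsPolytopeOfDim P d
  encard_facets : (polytopeFacets P d).encard = n
  ediam_add : (polytopeGraph P).ediam + d = n

/-! Put `k = n - d - 1`; sharpness provides two vertices not joined within `k` steps. Perturbing the
right-hand sides of the facet inequalities makes the polytope simple. Sending each new vertex back
to the old vertex it came from does not lengthen walks, so the diameter still exceeds `k`
(`IsPolytopeOfDim.exists_simpleConfig`).

Two far apart vertices of the simple polytope lie on `d` facets each, and `n > 2d` leaves a facet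
avoiding both. The wedge over that facet has one more dimension and one more facet, contains two
adjacent copies of each of the two vertices, and projects to the base without lengthening walks, so
all four pairs of copies are far apart. Cutting off one copy creates a vertex on the edge between
the two copies; it is one step farther away than both of them (`TruncAt.not_stepReach`). Doing this
at no, one or both ends gives the three facet numbers, with diameter at least the number of facets
minus the dimension (`exists_configs_of_simple`).

The diameter may now be too large. `exists_diam_eq` corrects this by a discrete intermediate value
argument. Moving one facet hyperplane across one vertex is a flip and changes the diameter by at
most one (`FDiamLE.flip`). If the value `K + 1` never occurred, a bound by `K` would persist under
such moves. But the facets can be moved one after another until the polytope is an iterated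
truncation of a simplex; its diameter is at most one plus the number of truncations, that is `K +
1`, hence at most `K`. So the original diameter would be at most `K` as well.

A polytope is handled through the cone over it: a finite family of linear functionals in one
dimension more, with vertices encoded by their tight constraints. `Gen` is general position of all
functionals, `SimpleConfig` only of those tight at points of the cone. A wedge is simple but in
general not generic, and `SimpleConfig.exists_gen` mediates. Slicing the cone returns to polytopes
(`exists_isHirschSharp`). -/

set_option linter.unusedSectionVars false

/-! ### Walks of bounded length and contraction of a set of nodes -/

/-- `StepReach R k a b`: `b` is reached from `a` by at most `k` steps along `R`. -/
def StepReach {α : Type*} (R : α → α → Prop) : ℕ → α → α → Prop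
  | 0, a, b => a = b
  | k + 1, a, b => ∃ c, (a = c ∨ R a c) ∧ StepReach R k c b

namespace StepReach

variable {α β : Type*} {R : α → α → Prop} {R' : β → β → Prop}

theorem refl (k : ℕ) (a : α) : StepReach R k a a := by
  induction k with
  | zero => rfl
  | succ k ih => exact ⟨a, Or.inl rfl, ih⟩

theorem trans {j k : ℕ} {a b c : α} (h : StepReach R j a b) (h' : StepReach R k b c) :
    StepReach R (j + k) a c := by
  induction j generalizing a with
  | zero => obtain rfl : a = b := h; simpa using h'
  | succ j ih =>
    obtain ⟨x, hx, hxb⟩ := h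
    rw [Nat.succ_add]
    exact ⟨x, hx, ih hxb⟩

theorem mono {j k : ℕ} (hjk : j ≤ k) {a b : α} (h : StepReach R j a b) : StepReach R k a b := by
  obtain ⟨i, rfl⟩ := Nat.exists_eq_add_of_le hjk
  exact h.trans (refl i b)

theorem single {a b : α} (h : a = b ∨ R a b) : StepReach R 1 a b := ⟨b, h, rfl⟩

theorem symm (hR : ∀ a b, R a b → R b a) {k : ℕ} {a b : α} (h : StepReach R k a b) :
    StepReach R k b a := by
  induction k generalizing a with
  | zero => exact Eq.symm h
  | succ k ih =>
    obtain ⟨x, hx, hxb⟩ := h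
    exact (ih hxb).trans (single (hx.imp Eq.symm (hR _ _)))

theorem map {f : α → β} (hf : ∀ a b, R a b → f a = f b ∨ R' (f a) (f b)) {k : ℕ} {a b : α}
    (h : StepReach R k a b) : StepReach R' k (f a) (f b) := by
  induction k generalizing a with
  | zero => exact congrArg f h
  | succ k ih =>
    obtain ⟨x, hx, hxb⟩ := h
    refine ⟨f x, ?_, ih hxb⟩
    rcases hx with rfl | hx
    · exact Or.inl rfl
    · exact hf _ _ hx

/-- Replacing a set of nodes `C` by a set of nodes `C'` of diameter at most `e` that has the same
outer neighbours increases distances by at most `e`. -/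
theorem contract {R R' : α → α → Prop} {W C C' : Set α} {e : ℕ} (hdisj : Disjoint W C)
    (symmR : ∀ a b, R a b → R b a) (symmR' : ∀ a b, R' a b → R' b a)
    (hR : ∀ a b, R a b → b ∈ W ∨ b ∈ C)
    (hWW : ∀ a ∈ W, ∀ b ∈ W, R a b → R' a b)
    (hWC : ∀ a ∈ W, ∀ c ∈ C, R a c → ∃ c' ∈ C', R' a c')
    (hC' : ∀ c ∈ C', ∀ c' ∈ C', StepReach R' e c c')
    {m : ℕ} {a b a' b' : α} (h : StepReach R m a b)
    (ha : (a ∈ W ∧ a' = a) ∨ (a ∈ C ∧ a' ∈ C')) (hb : (b ∈ W ∧ b' = b) ∨ (b ∈ C ∧ b' ∈ C')) :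
    StepReach R' (m + e) a' b' := by
  have hWnC : ∀ {x}, x ∈ W → x ∈ C → False := fun h1 h2 => Set.disjoint_left.1 hdisj h1 h2
  -- Either the walk avoids `C` and survives unchanged, or both of its ends reach `C'` within `m`
  -- steps in total; in the second case crossing `C'` costs at most `e` more.
  have key : ∀ m a a', StepReach R m a b → ((a ∈ W ∧ a' = a) ∨ (a ∈ C ∧ a' ∈ C')) →
      (a' ∈ W ∧ b' ∈ W ∧ a = a' ∧ b = b' ∧ StepReach R' m a' b') ∨
      ∃ i j, i + j ≤ m ∧ (∃ c ∈ C', StepReach R' i a' c) ∧ (∃ c ∈ C', StepReach R' j b' c) := by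
    intro m
    induction m with
    | zero =>
      intro a a' hab ha
      obtain rfl : a = b := hab
      rcases ha with ⟨ha, rfl⟩ | ⟨ha, ha'⟩
      · rcases hb with ⟨hb, rfl⟩ | ⟨hb, -⟩
        · exact Or.inl ⟨ha, ha, rfl, rfl, refl _ _⟩
        · exact (hWnC ha hb).elim
      · rcases hb with ⟨hb, -⟩ | ⟨-, hb'⟩
        · exact (hWnC hb ha).elim
        · exact Or.inr ⟨0, 0, le_rfl, ⟨a', ha', refl _ _⟩, b', hb', refl _ _⟩
    | succ m ih =>
      rintro a a' ⟨c, hac, hcb⟩ ha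
      rcases hac with rfl | hac
      · rcases ih a a' hcb ha with ⟨h1, h2, h3, h4, h5⟩ | ⟨i, j, h1, h2, h3⟩
        · exact Or.inl ⟨h1, h2, h3, h4, h5.mono (Nat.le_succ m)⟩
        · exact Or.inr ⟨i, j, by omega, h2, h3⟩
      · rcases hR _ _ hac with hc | hc
        · rcases ih c c hcb (Or.inl ⟨hc, rfl⟩) with ⟨h1, h2, -, h4, h5⟩ |
            ⟨i, j, h1, ⟨x, hx, hcx⟩, h3⟩
          · rcases ha with ⟨ha, rfl⟩ | ⟨ha, ha'⟩
            · exact Or.inl ⟨ha, h2, rfl, h4, c, Or.inr (hWW _ ha _ hc hac), h5⟩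
            · obtain ⟨c', hc', hcc'⟩ := hWC c hc a ha (symmR _ _ hac)
              exact Or.inr ⟨0, m + 1, by omega, ⟨a', ha', refl _ _⟩, c', hc',
                (symm symmR' h5).trans (single (Or.inr hcc'))⟩
          · rcases ha with ⟨ha, rfl⟩ | ⟨ha, ha'⟩
            · exact Or.inr ⟨i + 1, j, by omega, ⟨x, hx, c, Or.inr (hWW _ ha _ hc hac), hcx⟩, h3⟩
            · exact Or.inr ⟨0, j, by omega, ⟨a', ha', refl _ _⟩, h3⟩
        · obtain ⟨c', hc', hac'⟩ : ∃ c' ∈ C', StepReach R' 1 a' c' := by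
            rcases ha with ⟨ha, rfl⟩ | ⟨ha, ha'⟩
            · obtain ⟨c', hc', h'⟩ := hWC _ ha c hc hac
              exact ⟨c', hc', single (Or.inr h')⟩
            · exact ⟨a', ha', refl _ _⟩
          rcases ih c c' hcb (Or.inr ⟨hc, hc'⟩) with ⟨h1, -, rfl, -, -⟩ | ⟨i, j, h1, -, h3⟩
          · exact (hWnC h1 hc).elim
          · by_cases hi : i = 0
            · subst hi
              by_cases hj : j = m + 1
              · omega
              · exact Or.inr ⟨1, j, by omega, ⟨c', hc', hac'⟩, h3⟩
            · exact Or.inr ⟨i, j, by omega, ⟨c', hc', hac'.mono (by omega)⟩, h3⟩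
  rcases key m a a' h ha with ⟨-, -, -, -, h5⟩ | ⟨i, j, hij, ⟨c, hc, hac⟩, c', hc', hbc⟩
  · exact h5.mono (Nat.le_add_right m e)
  · exact ((hac.trans (hC' c hc c' hc')).trans (symm symmR' hbc)).mono (by omega)

end StepReach

/-! ### Set families as graphs of simple polytopes, and flips -/

section Families

variable {ι : Type*} [DecidableEq ι]

/-- Two vertices, given as sets of tight constraints, are adjacent when each has exactly one
constraint that the other does not have. -/
def FAdj (I J : Finset ι) : Prop := (I \ J).card = 1 ∧ (J \ I).card = 1

/-- The adjacency relation on a family of sets. -/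
def VRel (V : Set (Finset ι)) (I J : Finset ι) : Prop := I ∈ V ∧ J ∈ V ∧ FAdj I J

/-- The graph of the family `V` has diameter at most `k`. -/
def FDiamLE (V : Set (Finset ι)) (k : ℕ) : Prop :=
  ∀ I ∈ V, ∀ J ∈ V, StepReach (VRel V) k I J

/-- No edge of the family has three end points. -/
def AtMostTwo (V : Set (Finset ι)) : Prop :=
  ∀ (F : Finset ι) (a b c : ι), a ∉ F → b ∉ F → c ∉ F → a ≠ b → a ≠ c → b ≠ c →
    insert a F ∈ V → insert b F ∈ V → insert c F ∈ V → False

theorem FAdj.symm {I J : Finset ι} (h : FAdj I J) : FAdj J I := ⟨h.2, h.1⟩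

theorem VRel.symm (V : Set (Finset ι)) (I J : Finset ι) (h : VRel V I J) : VRel V J I :=
  ⟨h.2.1, h.1, h.2.2.symm⟩

theorem FDiamLE.mono {V : Set (Finset ι)} {j k : ℕ} (hjk : j ≤ k) (h : FDiamLE V j) :
    FDiamLE V k := fun I hI J hJ => (h I hI J hJ).mono hjk

theorem fAdj_insert {F : Finset ι} {a b : ι} (ha : a ∉ F) (hb : b ∉ F) (hab : a ≠ b) :
    FAdj (insert a F) (insert b F) := by
  have h1 : insert a F \ insert b F = {a} := by ext x; simp; grind
  have h2 : insert b F \ insert a F = {b} := by ext x; simp; grind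
  simp [FAdj, h1, h2]

theorem FAdj.exists_eq {I J : Finset ι} (h : FAdj I J) :
    ∃ (F : Finset ι) (a b : ι), a ∉ F ∧ b ∉ F ∧ a ≠ b ∧ I = insert a F ∧ J = insert b F := by
  obtain ⟨a, ha⟩ := Finset.card_eq_one.1 h.1
  obtain ⟨b, hb⟩ := Finset.card_eq_one.1 h.2
  have ha' : ∀ x, (x ∈ I ∧ x ∉ J) ↔ x = a := fun x => by
    rw [← Finset.mem_sdiff, ha, Finset.mem_singleton]
  have hb' : ∀ x, (x ∈ J ∧ x ∉ I) ↔ x = b := fun x => by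
    rw [← Finset.mem_sdiff, hb, Finset.mem_singleton]
  have haI := (ha' a).2 rfl
  have hbJ := (hb' b).2 rfl
  refine ⟨I ∩ J, a, b, by grind, by grind, fun h => haI.2 (h ▸ hbJ.1), ?_, ?_⟩
  · ext x; simp; grind
  · ext x; simp; grind

theorem fAdj_erase {T : Finset ι} {a b : ι} (ha : a ∈ T) (hb : b ∈ T) (hab : a ≠ b) :
    FAdj (T.erase a) (T.erase b) := by
  have h1 : T.erase a \ T.erase b = {b} := by ext x; simp; grind
  have h2 : T.erase b \ T.erase a = {a} := by ext x; simp; grind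
  simp [FAdj, h1, h2]

/-- A neighbour `I ⊄ T` of `T.erase j` is also a neighbour of some other `T.erase m`. -/
theorem FAdj.exists_erase {T I : Finset ι} {j : ι} (hj : j ∈ T) (hI : ¬ I ⊆ T)
    (h : FAdj I (T.erase j)) :
    ∃ m ∈ T, m ≠ j ∧ FAdj I (T.erase m) ∧ ∃ x, x ∉ T ∧ I = insert x ((T.erase j).erase m) := by
  obtain ⟨F, a, b, ha, hb, hab, rfl, h2⟩ := h.exists_eq
  have hF : F = (T.erase j).erase b := by rw [h2, Finset.erase_insert hb]
  have hbT : b ∈ T.erase j := by rw [h2]; exact Finset.mem_insert_self _ _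
  have haT : a ∉ T := by
    intro haT
    apply hI
    rw [hF]
    intro x hx
    simp at hx
    grind
  refine ⟨b, (Finset.mem_erase.1 hbT).2, (Finset.mem_erase.1 hbT).1, ?_, a, haT, by rw [hF]⟩
  have : T.erase b = insert j F := by
    rw [hF]; ext x; simp; grind
  rw [this]
  have : j ∉ F := by rw [hF]; simp
  exact fAdj_insert ha this (by rintro rfl; exact haT hj)

/-- The effect of a flip on distances: `V` and `V'` agree except on subsets of the set `T`, which
belong to exactly one of the two. -/
theorem StepReach.flip {V V' : Set (Finset ι)} {T : Finset ι} {e : ℕ}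
    (hcard : ∀ I ∈ V, I.card + 1 = T.card) (hcard' : ∀ I ∈ V', I.card + 1 = T.card)
    (hout : ∀ I, ¬ I ⊆ T → (I ∈ V ↔ I ∈ V'))
    (hpart : ∀ j ∈ T, (T.erase j ∈ V ↔ T.erase j ∉ V'))
    (htwo : AtMostTwo V)
    (he : 1 ≤ e ∨ ∃ I, ∀ J ∈ V', J ⊆ T → J = I)
    {m : ℕ} {I J I' J' : Finset ι} (h : StepReach (VRel V) m I J)
    (hI : (I = I' ∧ I ∈ V ∧ ¬ I ⊆ T) ∨ (I ∈ V ∧ I' ∈ V' ∧ I ⊆ T ∧ I' ⊆ T))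
    (hJ : (J = J' ∧ J ∈ V ∧ ¬ J ⊆ T) ∨ (J ∈ V ∧ J' ∈ V' ∧ J ⊆ T ∧ J' ⊆ T)) :
    StepReach (VRel V') (m + e) I' J' := by
  have sub : ∀ {K}, K.card + 1 = T.card → K ⊆ T → ∃ j ∈ T, K = T.erase j := by
    intro K hK hKT
    have : (T \ K).card = 1 := by
      have := Finset.card_sdiff_add_card_eq_card hKT
      omega
    obtain ⟨j, hj⟩ := Finset.card_eq_one.1 this
    have hj' : ∀ x, (x ∈ T ∧ x ∉ K) ↔ x = j := fun x => by
      rw [← Finset.mem_sdiff, hj, Finset.mem_singleton]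
    exact ⟨j, ((hj' j).2 rfl).1, by ext x; simp; grind⟩
  refine StepReach.contract (R := VRel V) (R' := VRel V') (W := {K | K ∈ V ∧ ¬ K ⊆ T})
    (C := {K | K ∈ V ∧ K ⊆ T}) (C' := {K | K ∈ V' ∧ K ⊆ T}) (e := e) ?_ (VRel.symm V)
    (VRel.symm V') ?_ ?_ ?_ ?_ h ?_ ?_
  · exact Set.disjoint_left.2 fun K h1 h2 => h1.2 h2.2
  · intro a b hab
    by_cases hb : b ⊆ T
    · exact Or.inr ⟨hab.2.1, hb⟩
    · exact Or.inl ⟨hab.2.1, hb⟩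
  · intro a ha b hb hab
    exact ⟨(hout a ha.2).1 ha.1, (hout b hb.2).1 hb.1, hab.2.2⟩
  · intro a ha c hc hac
    obtain ⟨j, hj, rfl⟩ := sub (hcard c hc.1) hc.2
    obtain ⟨x, hxT, hmj, hadj, y, hy, hay⟩ := hac.2.2.exists_erase hj ha.2
    -- The edge `(T.erase j).erase x` already has the ends `T.erase j` and `a` in `V`. A third end
    -- is impossible, so `T.erase x` is not in `V` and therefore lies in `V'`.
    refine ⟨T.erase x, ⟨?_, Finset.erase_subset _ _⟩, (hout a ha.2).1 ha.1, ?_, hadj⟩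
    all_goals
      by_contra hx
      have hx' : T.erase x ∈ V := (hpart x hxT).2 hx
      refine htwo ((T.erase j).erase x) x j y (by simp) (by simp) (fun h => hy ?_) hmj ?_ ?_ ?_ ?_
        (hay ▸ ha.1)
      · simp at h; exact h.2.2
      · rintro rfl; exact hy hxT
      · rintro rfl; exact hy hj
      · rw [Finset.insert_erase (Finset.mem_erase.2 ⟨hmj, hxT⟩)]; exact hc.1
      · rw [Finset.erase_right_comm, Finset.insert_erase (Finset.mem_erase.2 ⟨hmj.symm, hj⟩)]
        exact hx'
  · intro c hc c' hc'
    -- The vertices of `V'` inside `T` are pairwise adjacent, so one step suffices; if there is only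
    -- one of them, none is needed.
    rcases he with he | ⟨K, hK⟩
    · refine StepReach.mono he (StepReach.single ?_)
      obtain ⟨j, hj, rfl⟩ := sub (hcard' c hc.1) hc.2
      obtain ⟨j', hj', rfl⟩ := sub (hcard' c' hc'.1) hc'.2
      by_cases hjj : j = j'
      · exact Or.inl (by rw [hjj])
      · exact Or.inr ⟨hc.1, hc'.1, fAdj_erase hj hj' hjj⟩
    · rw [hK c hc.1 hc.2, hK c' hc'.1 hc'.2]
      exact StepReach.refl _ _
  · rcases hI with ⟨rfl, h1, h2⟩ | ⟨h1, h2, h3, h4⟩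
    · exact Or.inl ⟨⟨h1, h2⟩, rfl⟩
    · exact Or.inr ⟨⟨h1, h3⟩, h2, h4⟩
  · rcases hJ with ⟨rfl, h1, h2⟩ | ⟨h1, h2, h3, h4⟩
    · exact Or.inl ⟨⟨h1, h2⟩, rfl⟩
    · exact Or.inr ⟨⟨h1, h3⟩, h2, h4⟩

/-- `hne` supplies one vertex of `V` inside `T` that stands in for every vertex of `V'` inside `T`;
walks between representatives are then transported by `StepReach.flip`. -/
theorem FDiamLE.flip {V V' : Set (Finset ι)} {T : Finset ι} {e : ℕ}
    (hcard : ∀ I ∈ V, I.card + 1 = T.card) (hcard' : ∀ I ∈ V', I.card + 1 = T.card)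
    (hout : ∀ I, ¬ I ⊆ T → (I ∈ V ↔ I ∈ V'))
    (hpart : ∀ j ∈ T, (T.erase j ∈ V ↔ T.erase j ∉ V'))
    (htwo : AtMostTwo V) (hne : ∃ j ∈ T, T.erase j ∈ V)
    (he : 1 ≤ e ∨ ∃ I, ∀ J ∈ V', J ⊆ T → J = I)
    {m : ℕ} (h : FDiamLE V m) : FDiamLE V' (m + e) := by
  obtain ⟨j, hj, hjV⟩ := hne
  have rep : ∀ I' ∈ V', ∃ I ∈ V, (I = I' ∧ I ∈ V ∧ ¬ I ⊆ T) ∨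
      (I ∈ V ∧ I' ∈ V' ∧ I ⊆ T ∧ I' ⊆ T) := by
    intro I' hI'
    by_cases hT : I' ⊆ T
    · exact ⟨_, hjV, Or.inr ⟨hjV, hI', Finset.erase_subset _ _, hT⟩⟩
    · exact ⟨I', (hout _ hT).2 hI', Or.inl ⟨rfl, (hout _ hT).2 hI', hT⟩⟩
  intro I' hI' J' hJ'
  obtain ⟨I, hI, hII⟩ := rep I' hI'
  obtain ⟨J, hJ, hJJ⟩ := rep J' hJ'
  exact StepReach.flip hcard hcard' hout hpart htwo he (h I hI J hJ) hII hJJ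

end Families

/-! ### Vertices and edges of cones given by linear functionals -/

section Configurations

open Module

variable {ι : Type*} {E : Type*} [NormedAddCommGroup E] [NormedSpace ℝ E]

/-- `y` spans the ray of the cone `⋂ l ∈ S, {A l ≥ 0}` whose tight constraints are those in `I`. -/
def Wit (A : ι → E →L[ℝ] ℝ) (S I : Finset ι) (y : E) : Prop :=
  (∀ i ∈ I, A i y = 0) ∧ ∀ l ∈ S, l ∉ I → 0 < A l y

/-- The (simple) vertices of the configuration of linear functionals `A l`, `l ∈ S`: the sets of
tight constraints of the extreme rays of the cone `⋂ l ∈ S, {A l ≥ 0}`. -/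
def vtxSet (A : ι → E →L[ℝ] ℝ) (S : Finset ι) : Set (Finset ι) :=
  {I | I ⊆ S ∧ I.card + 1 = finrank ℝ E ∧ ∃ y, Wit A S I y}

/-- General position: as many functionals as the dimension have no common zero but `0`. -/
def Gen (A : ι → E →L[ℝ] ℝ) (S : Finset ι) : Prop :=
  ∀ T ⊆ S, T.card = finrank ℝ E → ∀ y, (∀ i ∈ T, A i y = 0) → y = 0

/-- Every constraint `A l ≥ 0` defines a facet. -/
def Irred (A : ι → E →L[ℝ] ℝ) (S : Finset ι) : Prop :=
  ∀ l ∈ S, ∃ z, A l z = 0 ∧ ∀ m ∈ S, m ≠ l → 0 < A m z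

variable {A : ι → E →L[ℝ] ℝ} {S : Finset ι}

theorem Gen.subset {S' : Finset ι} (hS : S' ⊆ S) (h : Gen A S) : Gen A S' :=
  fun T hT => h T (hT.trans hS)

theorem Wit.subset {S' I : Finset ι} {y : E} (hS : S' ⊆ S) (h : Wit A S I y) : Wit A S' I y :=
  ⟨h.1, fun l hl => h.2 l (hS hl)⟩

theorem vtxSet_subset {S' I : Finset ι} (hS : S' ⊆ S) (hI : I ⊆ S') (h : I ∈ vtxSet A S) :
    I ∈ vtxSet A S' := by
  obtain ⟨-, h1, y, hy⟩ := h
  exact ⟨hI, h1, y, hy.subset hS⟩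

theorem Wit.nonneg {I : Finset ι} {y : E} (h : Wit A S I y) {l : ι} (hl : l ∈ S) : 0 ≤ A l y := by
  by_cases hI : l ∈ I
  · exact (h.1 l hI).ge
  · exact (h.2 l hl hI).le

/-- The constant is the largest ratio `-(A l w) / A l y` over `l ∉ J`, the least multiple of `y`
that brings `w` into the cone; a maximizing constraint becomes tight. -/
theorem exists_push {J : Finset ι} {y w : E} (hne : ∃ l ∈ S, l ∉ J) (hy : Wit A S J y)
    (hw : ∀ l ∈ J, A l w = 0) :
    ∃ c : ℝ, (∃ l ∈ S, l ∉ J ∧ A l (w + c • y) = 0) ∧ (∀ l ∈ S, 0 ≤ A l (w + c • y)) ∧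
      ∀ l ∈ J, A l (w + c • y) = 0 := by
  classical
  obtain ⟨l₀, hl₀, hl₀J⟩ := hne
  obtain ⟨l, hl, hmax⟩ := (S.filter (· ∉ J)).exists_max_image (fun l => -(A l w) / A l y)
    ⟨l₀, Finset.mem_filter.2 ⟨hl₀, hl₀J⟩⟩
  rw [Finset.mem_filter] at hl
  have hJ : ∀ m ∈ J, A m (w + (-(A l w) / A l y) • y) = 0 := fun m hm => by
    simp [hw m hm, hy.1 m hm]
  refine ⟨-(A l w) / A l y, ⟨l, hl.1, hl.2, ?_⟩, fun m hm => ?_, hJ⟩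
  · have := (hy.2 l hl.1 hl.2).ne'
    simp; field_simp; ring
  · by_cases hmJ : m ∈ J
    · exact (hJ m hmJ).ge
    · have h1 := hmax m (Finset.mem_filter.2 ⟨hm, hmJ⟩)
      have h2 := hy.2 m hm hmJ
      rw [div_le_iff₀ h2] at h1
      simp only [map_add, map_smul, smul_eq_mul]
      linarith

variable [FiniteDimensional ℝ E]

theorem exists_ker {J : Finset ι} (h : J.card < finrank ℝ E) :
    ∃ y : E, y ≠ 0 ∧ ∀ i ∈ J, A i y = 0 := by
  let f : E →ₗ[ℝ] (J → ℝ) := LinearMap.pi fun i => (A i).toLinearMap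
  have : f.ker ≠ ⊥ := LinearMap.ker_ne_bot_of_finrank_lt (by simpa using h)
  obtain ⟨y, hy, hy0⟩ := (Submodule.ne_bot_iff _).1 this
  refine ⟨y, hy0, fun i hi => ?_⟩
  exact congrFun (LinearMap.mem_ker.1 hy) ⟨i, hi⟩

omit [FiniteDimensional ℝ E] in
theorem vtxSet_exists_notMem {I : Finset ι} (hS : finrank ℝ E ≤ S.card) (hI : I ∈ vtxSet A S) :
    ∃ l ∈ S, l ∉ I := by
  have := hI.2.1
  exact Finset.exists_mem_notMem_of_card_lt_card (by omega)

variable [DecidableEq ι]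

omit [FiniteDimensional ℝ E] in
-- The constraints in `I` cut out a line. Cross-multiplying by the values at `l` makes the
-- difference vanish at `l` too, and general position kills it.
theorem Gen.proportional (hA : Gen A S) {I : Finset ι} (hI : I ⊆ S)
    (hc : I.card + 1 = finrank ℝ E) {l : ι} (hl : l ∈ S) (hlI : l ∉ I) {y y' : E}
    (hy : ∀ i ∈ I, A i y = 0) (hy' : ∀ i ∈ I, A i y' = 0) : A l y' • y = A l y • y' := by
  rw [← sub_eq_zero]
  refine hA (insert l I) (Finset.insert_subset hl hI)
    (by rw [Finset.card_insert_of_notMem hlI, hc]) _ fun i hi => ?_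
  rcases Finset.mem_insert.1 hi with rfl | hi
  · simp [mul_comm]
  · simp [hy i hi, hy' i hi]

omit [FiniteDimensional ℝ E] in
-- Witnesses of one vertex are positive multiples of each other, so the sign of a functional at a
-- vertex does not depend on the witness.
theorem Wit.pos_of_pos (hS : finrank ℝ E ≤ S.card) (hA : Gen A S) {I : Finset ι}
    (hI : I ∈ vtxSet A S) {y y' : E} (hy : Wit A S I y) (hy' : Wit A S I y') {φ : E →L[ℝ] ℝ}
    (h : 0 < φ y) : 0 < φ y' := by
  obtain ⟨l, hl, hlI⟩ := vtxSet_exists_notMem hS hI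
  have h1 := congrArg φ (hA.proportional hI.1 hI.2.1 hl hlI hy.1 hy'.1)
  simp only [map_smul, smul_eq_mul] at h1
  have h2 := hy.2 l hl hlI
  have h3 := hy'.2 l hl hlI
  have h4 : 0 < A l y * φ y' := h1 ▸ mul_pos h3 h
  exact (mul_pos_iff_of_pos_left h2).1 h4

/-- Starting from a point `y` of the cone with `a y < 0` there is a vertex with the same property
that is tight wherever `y` is. -/
theorem exists_vertex (hS : finrank ℝ E ≤ S.card)
    (hA : ∀ y : E, y ≠ 0 → (∀ l ∈ S, 0 ≤ A l y) →
      (S.filter (fun l => A l y = 0)).card + 1 ≤ finrank ℝ E)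
    {a : E →L[ℝ] ℝ} {y : E} (hy : ∀ l ∈ S, 0 ≤ A l y) (ha : a y < 0) :
    ∃ I ∈ vtxSet A S, S.filter (fun l => A l y = 0) ⊆ I ∧ ∃ z, Wit A S I z ∧ a z < 0 := by
  have key : ∀ (n : ℕ) (y : E), (∀ l ∈ S, 0 ≤ A l y) → a y < 0 →
      finrank ℝ E ≤ (S.filter (fun l => A l y = 0)).card + 1 + n →
      ∃ I ∈ vtxSet A S, S.filter (fun l => A l y = 0) ⊆ I ∧ ∃ z, Wit A S I z ∧ a z < 0 := by
    intro n
    induction n with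
    | zero =>
      intro y hy ha hc
      have hW : Wit A S (S.filter (fun l => A l y = 0)) y := by
        refine ⟨fun i hi => (Finset.mem_filter.1 hi).2, fun l hl hlI => ?_⟩
        exact (hy l hl).lt_of_ne fun h => hlI (Finset.mem_filter.2 ⟨hl, h.symm⟩)
      refine ⟨_, ⟨Finset.filter_subset _ _, ?_, y, hW⟩, subset_rfl, y, hW, ha⟩
      have := hA y (by rintro rfl; simp at ha) hy
      omega
    | succ n ih =>
      intro y hy ha hc
      by_cases hlt : finrank ℝ E ≤ (S.filter (fun l => A l y = 0)).card + 1 + n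
      · exact ih y hy ha hlt
      set J := S.filter (fun l => A l y = 0) with hJ
      have hW : Wit A S J y := by
        refine ⟨fun i hi => (Finset.mem_filter.1 hi).2, fun l hl hlI => ?_⟩
        exact (hy l hl).lt_of_ne fun h => hlI (Finset.mem_filter.2 ⟨hl, h.symm⟩)
      have hne : ∃ l ∈ S, l ∉ J := Finset.exists_mem_notMem_of_card_lt_card (by omega)
      obtain ⟨l₀, hl₀, hl₀J⟩ := hne
      -- Imposing `A l₀ w = 0` as well forces the multiples `c₁`, `c₂` of `y` below to be
      -- non-negative.
      obtain ⟨w, hw0, hw⟩ := exists_ker (A := A) (J := insert l₀ J)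
        (by rw [Finset.card_insert_of_notMem hl₀J]; omega)
      have hwJ : ∀ l ∈ J, A l w = 0 := fun l hl => hw l (Finset.mem_insert_of_mem hl)
      have hwl : A l₀ w = 0 := hw l₀ (Finset.mem_insert_self _ _)
      have hpos := hW.2 l₀ hl₀ hl₀J
      have step : ∀ v : E, (∀ l ∈ S, 0 ≤ A l v) → (∀ l ∈ J, A l v = 0) →
          (∃ l ∈ S, l ∉ J ∧ A l v = 0) → a v < 0 →
          ∃ I ∈ vtxSet A S, J ⊆ I ∧ ∃ z, Wit A S I z ∧ a z < 0 := by
        intro v h1 h2 h3 h4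
        obtain ⟨l, hl, hlJ, hlv⟩ := h3
        have hsub : insert l J ⊆ S.filter (fun l => A l v = 0) := by
          intro x hx
          rcases Finset.mem_insert.1 hx with rfl | hx
          · exact Finset.mem_filter.2 ⟨hl, hlv⟩
          · exact Finset.mem_filter.2 ⟨(Finset.mem_filter.1 hx).1, h2 x hx⟩
        have hcard := Finset.card_le_card hsub
        rw [Finset.card_insert_of_notMem hlJ] at hcard
        obtain ⟨I, hI, hJI, hz⟩ := ih v h1 h4 (by omega)
        exact ⟨I, hI, ((Finset.subset_insert _ _).trans hsub).trans hJI, hz⟩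
      obtain ⟨c₁, h1, h2, h3⟩ := exists_push ⟨l₀, hl₀, hl₀J⟩ hW hwJ
      obtain ⟨c₂, h1', h2', h3'⟩ := exists_push (w := -w) ⟨l₀, hl₀, hl₀J⟩ hW
        (fun l hl => by simp [hwJ l hl])
      by_cases ha1 : a (w + c₁ • y) < 0
      · exact step _ h2 h3 h1 ha1
      by_cases ha2 : a (-w + c₂ • y) < 0
      · exact step _ h2' h3' h1' ha2
      -- The two pushed points add up to `(c₁ + c₂) • y`, where `a` would be negative unless both
      -- coefficients vanish. Then `w` and `-w` lie in the cone, and every constraint is tight at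
      -- `w`, too many for `hA`.
      exfalso
      have e1 := h2 l₀ hl₀
      have e2 := h2' l₀ hl₀
      simp only [map_add, map_smul, map_neg, smul_eq_mul, hwl, neg_zero, zero_add] at e1 e2 ha1 ha2
      have hc1 : 0 ≤ c₁ := nonneg_of_mul_nonneg_left e1 hpos
      have hc2 : 0 ≤ c₂ := nonneg_of_mul_nonneg_left e2 hpos
      have hc1' : c₁ = 0 := by nlinarith
      have hc2' : c₂ = 0 := by nlinarith
      subst hc1' hc2'
      have : S.filter (fun l => A l w = 0) = S := by
        refine Finset.filter_true_of_mem fun l hl => ?_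
        have a1 := h2 l hl
        have a2 := h2' l hl
        simp at a1 a2
        linarith
      have h5 := hA w hw0 (fun l hl => by simpa using h2 l hl)
      rw [this] at h5
      omega
  exact key (finrank ℝ E) y hy ha (by omega)

omit [FiniteDimensional ℝ E] in
theorem Gen.card_tight (hA : Gen A S) {y : E} (hy : y ≠ 0) :
    (S.filter (fun l => A l y = 0)).card + 1 ≤ finrank ℝ E := by
  by_contra h
  obtain ⟨T, hT, hc⟩ := Finset.exists_subset_card_eq
    (show finrank ℝ E ≤ (S.filter (fun l => A l y = 0)).card by omega)
  exact hy (hA T (hT.trans (Finset.filter_subset _ _)) hc y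
    fun i hi => (Finset.mem_filter.1 (hT hi)).2)

omit [FiniteDimensional ℝ E] in
/-- In general position the set of constraints that vanish at `z ≠ 0` and contain `K` is `K` as
soon as `K` has the cardinality of a vertex. -/
theorem Gen.wit_of_nonneg (hA : Gen A S) {K : Finset ι} (hK : K ⊆ S)
    (hc : K.card + 1 = finrank ℝ E) {z : E} (hz : z ≠ 0) (hKz : ∀ i ∈ K, A i z = 0)
    (hnn : ∀ l ∈ S, 0 ≤ A l z) : Wit A S K z := by
  refine ⟨hKz, fun l hl hlK => (hnn l hl).lt_of_ne fun h => hz ?_⟩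
  refine hA (insert l K) (Finset.insert_subset hl hK)
    (by rw [Finset.card_insert_of_notMem hlK, hc]) z fun i hi => ?_
  rcases Finset.mem_insert.1 hi with rfl | hi
  · exact h.symm
  · exact hKz i hi

omit [FiniteDimensional ℝ E] in
-- Three witnesses on one edge lie in the plane cut out by `F`. The coefficients in `hz` make the
-- difference vanish at `a` and `b`, so `y3` is a positive combination of `y1` and `y2`, where `A c`
-- is positive; but `A c y3 = 0`.
theorem Gen.atMostTwo (hA : Gen A S) : AtMostTwo (vtxSet A S) := by
  intro F a b c ha hb hc hab hac hbc h1 h2 h3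
  obtain ⟨s1, c1, y1, w1⟩ := h1
  obtain ⟨s2, c2, y2, w2⟩ := h2
  obtain ⟨s3, c3, y3, w3⟩ := h3
  have mem : ∀ {x : ι} {G : Finset ι}, insert x G ⊆ S → x ∈ S :=
    fun h => h (Finset.mem_insert_self _ _)
  have e1 : A a y1 = 0 := w1.1 a (Finset.mem_insert_self _ _)
  have e2 : A b y2 = 0 := w2.1 b (Finset.mem_insert_self _ _)
  have e3 : A c y3 = 0 := w3.1 c (Finset.mem_insert_self _ _)
  have p12 : 0 < A a y2 := w2.2 a (mem s1) (by simp [hab, ha])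
  have p13 : 0 < A a y3 := w3.2 a (mem s1) (by simp [hac, ha])
  have p21 : 0 < A b y1 := w1.2 b (mem s2) (by simp [hab.symm, hb])
  have p23 : 0 < A b y3 := w3.2 b (mem s2) (by simp [hbc, hb])
  have p31 : 0 < A c y1 := w1.2 c (mem s3) (by simp [hac.symm, hc])
  have p32 : 0 < A c y2 := w2.2 c (mem s3) (by simp [hbc.symm, hc])
  have hz : y3 - (A b y3 / A b y1) • y1 - (A a y3 / A a y2) • y2 = 0 := by
    refine hA (insert a (insert b F)) (Finset.insert_subset (mem s1) s2)
      (by rw [Finset.card_insert_of_notMem (by simp [hab, ha]), c2]) _ fun i hi => ?_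
    rcases Finset.mem_insert.1 hi with rfl | hi
    · simp [e1]; field_simp; simp
    · rcases Finset.mem_insert.1 hi with rfl | hi
      · simp [e2]; field_simp; simp
      · simp [w1.1 i (Finset.mem_insert_of_mem hi), w2.1 i (Finset.mem_insert_of_mem hi),
          w3.1 i (Finset.mem_insert_of_mem hi)]
  have := congrArg (A c) hz
  simp [e3] at this
  have q1 := mul_pos (div_pos p23 p21) p31
  have q2 := mul_pos (div_pos p13 p12) p32
  linarith

/-- In general position every edge of a vertex has another end point. -/
theorem Gen.exists_neighbor (hA : Gen A S) (hS : finrank ℝ E ≤ S.card) {I : Finset ι}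
    (hI : I ∈ vtxSet A S) {j : ι} (hj : j ∈ I) :
    ∃ l ∈ S, l ∉ I ∧ insert l (I.erase j) ∈ vtxSet A S := by
  obtain ⟨l₀, hl₀, hl₀I⟩ := vtxSet_exists_notMem hS hI
  obtain ⟨hIS, hc, y, hy⟩ := hI
  have hjT : j ∈ insert l₀ I := Finset.mem_insert_of_mem hj
  have hcT : (insert l₀ I).card = finrank ℝ E := by
    rw [Finset.card_insert_of_notMem hl₀I, hc]
  obtain ⟨w, hw0, hw⟩ := exists_ker (A := A) (J := (insert l₀ I).erase j)
    (by have := Finset.card_erase_add_one hjT; omega)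
  have hwj : A j w ≠ 0 := fun h => hw0 <| hA _ (Finset.insert_subset hl₀ hIS) hcT w fun i hi => by
    by_cases hij : i = j
    · rw [hij, h]
    · exact hw i (Finset.mem_erase.2 ⟨hij, hi⟩)
  obtain ⟨w', hw'j, hw'⟩ : ∃ w', 0 < A j w' ∧ ∀ i ∈ I.erase j, A i w' = 0 := by
    have hwI : ∀ i ∈ I.erase j, A i w = 0 := fun i hi =>
      hw i (Finset.erase_subset_erase j (Finset.subset_insert _ _) hi)
    rcases hwj.lt_or_gt with h | h
    · exact ⟨-w, by simpa using h, fun i hi => by simp [hwI i hi]⟩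
    · exact ⟨w, h, hwI⟩
  -- With `j` dropped, `y` is strictly positive off `I.erase j` and can be pushed along. The dropped
  -- constraint takes care of itself: `A j y = 0`, so the push leaves `A j w' > 0` unchanged.
  have hyj : Wit A (S.erase j) (I.erase j) y :=
    ⟨fun i hi => hy.1 i (Finset.mem_of_mem_erase hi), fun l hl hlI =>
      hy.2 l (Finset.mem_of_mem_erase hl) fun h =>
        hlI (Finset.mem_erase.2 ⟨Finset.ne_of_mem_erase hl, h⟩)⟩
  obtain ⟨c, ⟨l, hl, hlI, hlz⟩, hnn, hI0⟩ := exists_push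
    ⟨l₀, Finset.mem_erase.2 ⟨by rintro rfl; exact hl₀I hj, hl₀⟩,
      fun h => hl₀I (Finset.mem_of_mem_erase h)⟩ hyj hw'
  have hjz : 0 < A j (w' + c • y) := by simpa [hy.1 j hj] using hw'j
  have hlI' : l ∉ I := fun h => hlI (Finset.mem_erase.2 ⟨Finset.ne_of_mem_erase hl, h⟩)
  have hlS := Finset.mem_of_mem_erase hl
  have hcK : (insert l (I.erase j)).card + 1 = finrank ℝ E := by
    rw [Finset.card_insert_of_notMem hlI, Finset.card_erase_add_one hj, hc]
  have hKS : insert l (I.erase j) ⊆ S :=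
    Finset.insert_subset hlS ((Finset.erase_subset _ _).trans hIS)
  refine ⟨l, hlS, hlI', hKS, hcK, w' + c • y, hA.wit_of_nonneg hKS hcK ?_ ?_ ?_⟩
  · intro h; rw [h] at hjz; simp at hjz
  · intro i hi
    rcases Finset.mem_insert.1 hi with rfl | hi
    · exact hlz
    · exact hI0 i hi
  · intro m hm
    by_cases hmj : m = j
    · rw [hmj]; exact hjz.le
    · exact hnn m (Finset.mem_erase.2 ⟨hmj, hm⟩)

omit [FiniteDimensional ℝ E] in
/-- A configuration containing a simplex of vertices has a redundant constraint. -/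
theorem Irred.not_simplex (hI : Irred A S) (hA : Gen A S) {T : Finset ι} (hTS : T ⊆ S)
    (hT : T.card = finrank ℝ E) (hS : finrank ℝ E < S.card)
    (hpos : 0 < finrank ℝ E)
    (h : ∀ j ∈ T, T.erase j ∈ vtxSet A S) : False := by
  obtain ⟨l, hl, hlT⟩ := Finset.exists_mem_notMem_of_card_lt_card (hT ▸ hS)
  obtain ⟨z, hz, hzpos⟩ := hI l hl
  choose! y hy using fun j hj => (h j hj).2.2
  have hyj : ∀ j ∈ T, 0 < A j (y j) := fun j hj => (hy j hj).2 j (hTS hj) (by simp)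
  -- The `y j` are dual to `T` up to positive factors, so `z` is their positive combination; yet `A
  -- l` is positive at each `y j` and zero at `z`.
  have hsum : z - ∑ j ∈ T, (A j z / A j (y j)) • y j = 0 := by
    refine hA T hTS hT _ fun i hi => ?_
    rw [map_sub, map_sum, Finset.sum_eq_single i]
    · have := (hyj i hi).ne'
      simp; field_simp; simp
    · intro j hj hji
      simp [(hy j hj).1 i (Finset.mem_erase.2 ⟨hji.symm, hi⟩)]
    · exact fun h => absurd hi h
  have := congrArg (A l) hsum
  rw [map_sub, hz, map_sum, zero_sub, map_zero, neg_eq_zero] at this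
  have hTne : T.Nonempty := Finset.card_pos.1 (hT ▸ hpos)
  refine (Finset.sum_pos (fun j hj => ?_) hTne).ne' this
  rw [map_smul, smul_eq_mul]
  exact mul_pos (div_pos (hzpos j (hTS hj) (by rintro rfl; exact hlT hj)) (hyj j hj))
    ((hy j hj).2 l hl fun h => hlT (Finset.mem_of_mem_erase h))

end Configurations

/-! ### Combinatorics of a hyperplane cut -/

section CutFamilies

variable {ι : Type*} [DecidableEq ι]

/-- The vertices of a simple polytope with vertices `V` after cutting off the vertices that do not
satisfy `p` by a new constraint `i`. -/
def cutFam (V : Set (Finset ι)) (p : Finset ι → Prop) (i : ι) : Set (Finset ι) :=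
  {K | (K ∈ V ∧ p K) ∨ ∃ (F : Finset ι) (a b : ι), a ∉ F ∧ b ∉ F ∧ a ≠ b ∧ insert a F ∈ V ∧
    insert b F ∈ V ∧ p (insert a F) ∧ ¬ p (insert b F) ∧ K = insert i F}

variable {V : Set (Finset ι)} {p p' : Finset ι → Prop} {i : ι}

theorem cutFam_congr (h : ∀ I ∈ V, (p I ↔ p' I)) : cutFam V p i = cutFam V p' i := by
  ext K
  constructor
  · rintro (⟨hK, hp⟩ | ⟨F, a, b, h1, h2, h3, h4, h5, h6, h7, h8⟩)
    · exact Or.inl ⟨hK, (h K hK).1 hp⟩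
    · exact Or.inr ⟨F, a, b, h1, h2, h3, h4, h5, (h _ h4).1 h6, mt (h _ h5).2 h7, h8⟩
  · rintro (⟨hK, hp⟩ | ⟨F, a, b, h1, h2, h3, h4, h5, h6, h7, h8⟩)
    · exact Or.inl ⟨hK, (h K hK).2 hp⟩
    · exact Or.inr ⟨F, a, b, h1, h2, h3, h4, h5, (h _ h4).2 h6, mt (h _ h5).1 h7, h8⟩

theorem cutFam_true : cutFam V (fun _ => True) i = V := by
  ext K
  constructor
  · rintro (⟨hK, -⟩ | ⟨F, a, b, -, -, -, -, -, -, h, -⟩)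
    · exact hK
    · exact absurd trivial h
  · exact fun h => Or.inl ⟨h, trivial⟩

variable {J₀ : Finset ι}

/-- Only `J₀` changes sides, and a new vertex on an edge at `J₀` is contained in `insert i J₀`. -/
theorem mem_cutFam_of_not_subset (h : ∀ I ∈ V, I ≠ J₀ → (p I ↔ p' I)) {K : Finset ι}
    (hK : ¬ K ⊆ insert i J₀) : K ∈ cutFam V p i → K ∈ cutFam V p' i := by
  rintro (⟨hKV, hp⟩ | ⟨F, a, b, h1, h2, h3, h4, h5, h6, h7, h8⟩)
  · exact Or.inl ⟨hKV, (h K hKV (by rintro rfl; exact hK (Finset.subset_insert _ _))).1 hp⟩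
  · have hF : ∀ x, insert x F ≠ J₀ := by
      rintro x rfl
      exact hK (h8 ▸ Finset.insert_subset_insert _ (Finset.subset_insert _ _))
    exact Or.inr ⟨F, a, b, h1, h2, h3, h4, h5, (h _ h4 (hF a)).1 h6, mt (h _ h5 (hF b)).2 h7, h8⟩

/-- By `htwo` the edge `J₀.erase j` has no ends besides `J₀` and `insert l (J₀.erase j)`, so it
carries a new vertex exactly when `p` separates these two. -/
theorem insert_erase_mem_cutFam (hi : ∀ I ∈ V, i ∉ I) (htwo : AtMostTwo V) (hJ₀ : J₀ ∈ V)
    {j l : ι} (hj : j ∈ J₀) (hl : l ∉ J₀) (hK : insert l (J₀.erase j) ∈ V) :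
    insert i (J₀.erase j) ∈ cutFam V p i ↔
      ((p J₀ ∧ ¬ p (insert l (J₀.erase j))) ∨ (¬ p J₀ ∧ p (insert l (J₀.erase j)))) := by
  have hJ : insert j (J₀.erase j) = J₀ := Finset.insert_erase hj
  have hlF : l ∉ J₀.erase j := fun h => hl (Finset.mem_of_mem_erase h)
  have hjF : j ∉ J₀.erase j := by simp
  have hjl : j ≠ l := by rintro rfl; exact hl hj
  constructor
  · rintro (⟨h, -⟩ | ⟨F, a, b, h1, h2, h3, h4, h5, h6, h7, h8⟩)
    · exact absurd (Finset.mem_insert_self _ _) (hi _ h)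
    · have e1 : i ∉ F := fun h => hi _ h4 (Finset.mem_insert_of_mem h)
      have e2 : i ∉ J₀.erase j := fun h => hi _ hJ₀ (Finset.mem_of_mem_erase h)
      have hF : F = J₀.erase j := by
        rw [← Finset.erase_insert e1, ← h8, Finset.erase_insert e2]
      subst hF
      have hx : ∀ x, x ∉ J₀.erase j → insert x (J₀.erase j) ∈ V → x = j ∨ x = l := by
        intro x hx hxV
        by_contra hne
        push Not at hne
        exact htwo _ x j l hx hjF hlF hne.1 hne.2 hjl hxV (hJ.symm ▸ hJ₀) hK
      rcases hx a h1 h4 with rfl | rfl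
      · rcases hx b h2 h5 with rfl | rfl
        · exact absurd rfl h3
        · exact Or.inl ⟨hJ ▸ h6, h7⟩
      · rcases hx b h2 h5 with rfl | rfl
        · exact Or.inr ⟨hJ ▸ h7, h6⟩
        · exact absurd rfl h3
  · rintro (⟨h1, h2⟩ | ⟨h1, h2⟩)
    · exact Or.inr ⟨_, j, l, hjF, hlF, hjl, hJ.symm ▸ hJ₀, hK, hJ.symm ▸ h1, h2, rfl⟩
    · exact Or.inr ⟨_, l, j, hlF, hjF, hjl.symm, hK, hJ.symm ▸ hJ₀, h2, hJ.symm ▸ h1, rfl⟩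

/-- When the new constraint passes over the vertex `J₀`, the subsets of `insert i J₀` that are
vertices are exchanged with those that are not. -/
theorem erase_mem_cutFam_iff (hi : ∀ I ∈ V, i ∉ I) (htwo : AtMostTwo V)
    (hnb : ∀ I ∈ V, ∀ j ∈ I, ∃ l, l ∉ I ∧ insert l (I.erase j) ∈ V) (hJ₀ : J₀ ∈ V)
    (h : ∀ I ∈ V, I ≠ J₀ → (p I ↔ p' I)) (h₀ : p J₀ ↔ ¬ p' J₀) {j : ι}
    (hj : j ∈ insert i J₀) :
    (insert i J₀).erase j ∈ cutFam V p i ↔ (insert i J₀).erase j ∉ cutFam V p' i := by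
  by_cases hij : j = i
  · subst hij
    rw [Finset.erase_insert (hi _ hJ₀)]
    have : ∀ q : Finset ι → Prop, J₀ ∈ cutFam V q j ↔ q J₀ := by
      intro q
      constructor
      · rintro (⟨-, h⟩ | ⟨F, a, b, h1, h2, h3, h4, h5, h6, h7, h8⟩)
        · exact h
        · exact absurd (h8 ▸ Finset.mem_insert_self _ _) (hi _ hJ₀)
      · exact fun h => Or.inl ⟨hJ₀, h⟩
    rw [this, this, h₀]
  · have hjJ : j ∈ J₀ := (Finset.mem_insert.1 hj).resolve_left hij
    rw [Finset.erase_insert_of_ne (Ne.symm hij)]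
    obtain ⟨l, hl, hK⟩ := hnb _ hJ₀ j hjJ
    rw [insert_erase_mem_cutFam hi htwo hJ₀ hjJ hl hK,
      insert_erase_mem_cutFam hi htwo hJ₀ hjJ hl hK]
    have : insert l (J₀.erase j) ≠ J₀ := fun h => hl (h ▸ Finset.mem_insert_self _ _)
    rw [h _ hK this]
    tauto

end CutFamilies

/-! ### Hyperplane cuts of cones and truncation of one vertex -/

section Cuts

open Module

variable {ι : Type*} {E : Type*} [NormedAddCommGroup E] [NormedSpace ℝ E]
  [FiniteDimensional ℝ E] [DecidableEq ι] {A : ι → E →L[ℝ] ℝ} {S : Finset ι} {i : ι}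

/-- The new hyperplane crosses the edge `F` at `y`. A direction within the edge on which `A i` is
positive is pushed along `y` to an end of the edge, and `A i y = 0` preserves the sign. -/
theorem exists_edge_ends (hi : i ∉ S) (hA : Gen A (insert i S)) (hS : finrank ℝ E ≤ S.card)
    {F : Finset ι} (hFS : F ⊆ S) (hF : F.card + 2 = finrank ℝ E) {y : E}
    (hy : Wit A S F y) (hyi : A i y = 0) :
    ∃ l ∈ S, l ∉ F ∧ insert l F ∈ vtxSet A S ∧ ∃ z, Wit A S (insert l F) z ∧ 0 < A i z := by
  have hAS := hA.subset (Finset.subset_insert i S)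
  obtain ⟨l₀, hl₀, hl₀F⟩ := Finset.exists_mem_notMem_of_card_lt_card
    (show F.card < S.card by omega)
  have hil : i ≠ l₀ := by rintro rfl; exact hi hl₀
  have hiF : i ∉ F := fun h => hi (hFS h)
  have hcard : (insert l₀ F).card + 1 = finrank ℝ E := by
    rw [Finset.card_insert_of_notMem hl₀F]; omega
  obtain ⟨w, hw0, hw⟩ := exists_ker (A := A) (J := insert l₀ F) (by omega)
  have hwi : A i w ≠ 0 := fun h => hw0 <| hA (insert i (insert l₀ F))
    (Finset.insert_subset_insert _ (Finset.insert_subset hl₀ hFS))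
    (by rw [Finset.card_insert_of_notMem (by simp [hil, hiF]), hcard]) w fun m hm => by
      rcases Finset.mem_insert.1 hm with rfl | hm
      · exact h
      · exact hw m hm
  obtain ⟨v, hvi, hv⟩ : ∃ v, 0 < A i v ∧ ∀ m ∈ F, A m v = 0 := by
    rcases hwi.lt_or_gt with h | h
    · exact ⟨-w, by simpa using h, fun m hm => by simp [hw m (Finset.mem_insert_of_mem hm)]⟩
    · exact ⟨w, h, fun m hm => hw m (Finset.mem_insert_of_mem hm)⟩
  obtain ⟨c, ⟨l, hl, hlF, hlz⟩, hnn, hF0⟩ := exists_push ⟨l₀, hl₀, hl₀F⟩ hy hv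
  have hiz : 0 < A i (v + c • y) := by simpa [hyi] using hvi
  have hcl : (insert l F).card + 1 = finrank ℝ E := by
    rw [Finset.card_insert_of_notMem hlF]; omega
  have hls : insert l F ⊆ S := Finset.insert_subset hl hFS
  have hW : Wit A S (insert l F) (v + c • y) := by
    refine hAS.wit_of_nonneg hls hcl (fun h => ?_) (fun m hm => ?_) hnn
    · rw [h] at hiz; simp at hiz
    · rcases Finset.mem_insert.1 hm with rfl | hm
      · exact hlz
      · exact hF0 m hm
  exact ⟨l, hl, hlF, ⟨hls, hcl, _, hW⟩, _, hW, hiz⟩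

/-- The vertices of a cut of a polytope by a hyperplane in general position. -/
theorem vtxSet_insert (hi : i ∉ S) (hA : Gen A (insert i S)) (hS : finrank ℝ E ≤ S.card) :
    vtxSet A (insert i S) =
      cutFam (vtxSet A S) (fun I => ∃ y, Wit A S I y ∧ 0 < A i y) i := by
  have hAS := hA.subset (Finset.subset_insert i S)
  ext K
  constructor
  · rintro ⟨hKS, hc, y, hy⟩
    by_cases hiK : i ∈ K
    · right
      have hFS : K.erase i ⊆ S := fun x hx => by
        have := hKS (Finset.mem_of_mem_erase hx)
        exact (Finset.mem_insert.1 this).resolve_left (Finset.ne_of_mem_erase hx)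
      have hF : (K.erase i).card + 2 = finrank ℝ E := by
        have := Finset.card_erase_add_one hiK; omega
      have hyF : Wit A S (K.erase i) y := by
        refine ⟨fun m hm => hy.1 m (Finset.mem_of_mem_erase hm), fun l hl hlF => ?_⟩
        refine hy.2 l (Finset.mem_insert_of_mem hl) fun h => hlF (Finset.mem_erase.2 ⟨?_, h⟩)
        rintro rfl; exact hi hl
      obtain ⟨a, -, haF, haV, z, hz, hzi⟩ :=
        exists_edge_ends hi hA hS hFS hF hyF (hy.1 i hiK)
      -- Reversing the sign of `A i` affects neither the configuration on `S` nor general position,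
      -- and gives the end of the edge on the other side.
      let A' : ι → E →L[ℝ] ℝ := fun l => if l = i then -A i else A l
      have hA'S : ∀ l ∈ S, A' l = A l := fun l hl => if_neg (by rintro rfl; exact hi hl)
      have hA'i : A' i = -A i := if_pos rfl
      have hA' : Gen A' (insert i S) := by
        intro T hT hTc x hx
        refine hA T hT hTc x fun m hm => ?_
        rcases Finset.mem_insert.1 (hT hm) with rfl | hmS
        · simpa [hA'i] using hx m hm
        · simpa [hA'S m hmS] using hx m hm
      have hWit : ∀ {I x}, I ⊆ S → (Wit A' S I x ↔ Wit A S I x) := by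
        intro I x hI
        constructor
        · exact fun h => ⟨fun m hm => by rw [← hA'S m (hI hm)]; exact h.1 m hm,
            fun l hl hlI => by rw [← hA'S l hl]; exact h.2 l hl hlI⟩
        · exact fun h => ⟨fun m hm => by rw [hA'S m (hI hm)]; exact h.1 m hm,
            fun l hl hlI => by rw [hA'S l hl]; exact h.2 l hl hlI⟩
      obtain ⟨b, -, hbF, ⟨hbS, hbc, x, hx⟩, z', hz', hzi'⟩ :=
        exists_edge_ends hi hA' hS hFS hF ((hWit hFS).2 hyF) (by simp [hA'i, hy.1 i hiK])
      rw [hWit hbS] at hz' hx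
      have hbV : insert b (K.erase i) ∈ vtxSet A S := ⟨hbS, hbc, x, hx⟩
      rw [hA'i] at hzi'
      have hnp : ¬ ∃ y, Wit A S (insert b (K.erase i)) y ∧ 0 < A i y := by
        rintro ⟨y', hy', hpos⟩
        have := hy'.pos_of_pos hS hAS hbV hz' hpos
        simp at hzi'
        linarith
      refine ⟨K.erase i, a, b, haF, hbF, ?_, haV, hbV, ⟨z, hz, hzi⟩, hnp,
        (Finset.insert_erase hiK).symm⟩
      rintro rfl
      exact hnp ⟨z, hz, hzi⟩
    · left
      have hKS' : K ⊆ S := fun x hx =>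
        (Finset.mem_insert.1 (hKS hx)).resolve_left (by rintro rfl; exact hiK hx)
      have hyS := hy.subset (Finset.subset_insert i S)
      exact ⟨⟨hKS', hc, y, hyS⟩, y, hyS, hy.2 i (Finset.mem_insert_self _ _) hiK⟩
  · rintro (⟨⟨hKS, hc, -⟩, y, hy, hyi⟩ | ⟨F, a, b, ha, hb, hab, haV, hbV, ⟨y, hy, hyi⟩, hnp, rfl⟩)
    · refine ⟨hKS.trans (Finset.subset_insert _ _), hc, y, hy.1, fun l hl hlK => ?_⟩
      rcases Finset.mem_insert.1 hl with rfl | hl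
      · exact hyi
      · exact hy.2 l hl hlK
    · obtain ⟨hbS, hbc, z, hz⟩ := hbV
      have haS := haV.1 (Finset.mem_insert_self _ _)
      have hbS' := hbS (Finset.mem_insert_self _ _)
      have hiF : i ∉ F := fun h => hi (hbS (Finset.mem_insert_of_mem h))
      have hib : i ∉ insert b F := fun h => hi (hbS h)
      have haz : 0 < A a z := hz.2 a haS (by simp [hab, ha])
      have hby : 0 < A b y := hy.2 b hbS' (by simp [hab.symm, hb])
      have hzi : A i z < 0 := by
        refine lt_of_le_of_ne (not_lt.1 fun h => hnp ⟨z, hz, h⟩) fun h => ?_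
        have : z = 0 := hA (insert i (insert b F)) (Finset.insert_subset_insert _ hbS)
          (by rw [Finset.card_insert_of_notMem hib, hbc]) z fun m hm => by
            rcases Finset.mem_insert.1 hm with rfl | hm
            · exact h
            · exact hz.1 m hm
        rw [this] at haz; simp at haz
      -- The new witness is the positive combination of the witnesses at the two ends at which `A i`
      -- vanishes.
      refine ⟨Finset.insert_subset_insert _ fun x hx => hbS (Finset.mem_insert_of_mem hx), ?_,
        (-(A i z)) • y + (A i y) • z, fun m hm => ?_, fun l hl hlF => ?_⟩
      · rw [Finset.card_insert_of_notMem hiF]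
        rw [Finset.card_insert_of_notMem hb] at hbc
        exact hbc
      · rcases Finset.mem_insert.1 hm with rfl | hm
        · simp; ring
        · simp [hy.1 m (Finset.mem_insert_of_mem hm), hz.1 m (Finset.mem_insert_of_mem hm)]
      · have hli : l ≠ i := by rintro rfl; exact hlF (Finset.mem_insert_self _ _)
        have hlS := (Finset.mem_insert.1 hl).resolve_left hli
        have h1 := hy.nonneg hlS
        have h2 := hz.nonneg hlS
        have h3 : 0 < A l y ∨ 0 < A l z := by
          by_cases hla : l = a
          · exact Or.inr (hla ▸ haz)
          · exact Or.inl (hy.2 l hlS fun h => hlF (Finset.mem_insert_of_mem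
              ((Finset.mem_insert.1 h).resolve_left hla)))
        have h4 : 0 < -(A i z) := by linarith
        simp only [map_add, map_smul, smul_eq_mul]
        rcases h3 with h3 | h3
        · have := mul_pos h4 h3
          have := mul_nonneg hyi.le h2
          linarith
        · have := mul_pos hyi h3
          have := mul_nonneg h4.le h1
          linarith

theorem Gen.exists_neighbor' (hA : Gen A S) (hS : finrank ℝ E ≤ S.card) :
    ∀ I ∈ vtxSet A S, ∀ j ∈ I, ∃ l, l ∉ I ∧ insert l (I.erase j) ∈ vtxSet A S := by
  intro I hI j hj
  obtain ⟨l, -, h1, h2⟩ := hA.exists_neighbor hS hI hj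
  exact ⟨l, h1, h2⟩

/-- The constraint `i` cuts off exactly the vertex `I` of the configuration on `S`. -/
def TruncAt (A : ι → E →L[ℝ] ℝ) (S : Finset ι) (i : ι) (I : Finset ι) : Prop :=
  I ∈ vtxSet A S ∧ (∃ y, Wit A S I y ∧ A i y < 0) ∧
    ∀ J ∈ vtxSet A S, J ≠ I → ∃ y, Wit A S J y ∧ 0 < A i y

namespace TruncAt

variable {I : Finset ι}

theorem vtxSet_eq (h : TruncAt A S i I) (hi : i ∉ S) (hA : Gen A (insert i S))
    (hS : finrank ℝ E ≤ S.card) : vtxSet A (insert i S) = cutFam (vtxSet A S) (· ≠ I) i := by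
  rw [vtxSet_insert hi hA hS]
  refine cutFam_congr fun J hJ => ⟨?_, h.2.2 J hJ⟩
  rintro ⟨y, hy, hpos⟩ rfl
  obtain ⟨z, hz, hneg⟩ := h.2.1
  have := hy.pos_of_pos hS (hA.subset (Finset.subset_insert i S)) h.1 hz hpos
  linarith

/-- The uncut family is the cut by the constantly true predicate, so truncation is a change of
predicate at the single vertex `I`. -/
theorem not_subset_iff (h : TruncAt A S i I) (hi : i ∉ S) (hA : Gen A (insert i S))
    (hS : finrank ℝ E ≤ S.card) {K : Finset ι} (hK : ¬ K ⊆ insert i I) :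
    K ∈ vtxSet A (insert i S) ↔ K ∈ vtxSet A S := by
  rw [h.vtxSet_eq hi hA hS]
  have e : ∀ J ∈ vtxSet A S, J ≠ I → (J ≠ I ↔ True) := fun J _ hJ => by simp [hJ]
  constructor
  · intro h1
    have := mem_cutFam_of_not_subset e hK h1
    rwa [cutFam_true] at this
  · intro h1
    refine mem_cutFam_of_not_subset (p := fun _ => True) (fun J hJ hne => (e J hJ hne).symm) hK ?_
    rwa [cutFam_true]

theorem erase_mem_iff (h : TruncAt A S i I) (hi : i ∉ S) (hA : Gen A (insert i S))
    (hS : finrank ℝ E ≤ S.card) {j : ι} (hj : j ∈ insert i I) :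
    (insert i I).erase j ∈ vtxSet A (insert i S) ↔ (insert i I).erase j ∉ vtxSet A S := by
  have hAS := hA.subset (Finset.subset_insert i S)
  rw [h.vtxSet_eq hi hA hS]
  have := erase_mem_cutFam_iff (p := (· ≠ I)) (p' := fun _ => True)
    (fun J hJ hiJ => hi (hJ.1 hiJ)) hAS.atMostTwo (hAS.exists_neighbor' hS) h.1
    (fun J _ hJ => by simp [hJ]) (by simp) hj
  rwa [cutFam_true] at this

theorem insert_erase_mem (h : TruncAt A S i I) (hi : i ∉ S) (hA : Gen A (insert i S))
    (hS : finrank ℝ E ≤ S.card) {j : ι} (hj : j ∈ I) :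
    insert i (I.erase j) ∈ vtxSet A (insert i S) := by
  have hij : i ≠ j := by rintro rfl; exact hi (h.1.1 hj)
  rw [← Finset.erase_insert_of_ne hij, h.erase_mem_iff hi hA hS (Finset.mem_insert_of_mem hj)]
  intro h'
  exact hi (h'.1 (Finset.mem_erase.2 ⟨hij, Finset.mem_insert_self _ _⟩))

theorem card_insert (h : TruncAt A S i I) (hi : i ∉ S) : (insert i I).card = finrank ℝ E := by
  rw [Finset.card_insert_of_notMem fun h' => hi (h.1.1 h'), h.1.2.1]

theorem fDiamLE (h : TruncAt A S i I) (hi : i ∉ S) (hA : Gen A (insert i S))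
    (hS : finrank ℝ E ≤ S.card) {k : ℕ} (hk : FDiamLE (vtxSet A S) k) :
    FDiamLE (vtxSet A (insert i S)) (k + 1) := by
  have hc := h.card_insert hi
  refine FDiamLE.flip (T := insert i I) (fun J hJ => by rw [hc, hJ.2.1])
    (fun J hJ => by rw [hc, hJ.2.1]) (fun K hK => (h.not_subset_iff hi hA hS hK).symm)
    (fun j hj => ?_) (hA.subset (Finset.subset_insert i S)).atMostTwo
    ⟨i, Finset.mem_insert_self _ _, ?_⟩ (Or.inl le_rfl) hk
  · rw [h.erase_mem_iff hi hA hS hj, not_not]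
  · rw [Finset.erase_insert fun h' => hi (h.1.1 h')]; exact h.1

/-- Undoing a truncation is a flip with `e = 0`: the only remaining vertex inside `insert i I` is
`I` itself. -/
theorem stepReach (h : TruncAt A S i I) (hi : i ∉ S) (hA : Gen A (insert i S))
    (hS : finrank ℝ E ≤ S.card) {m : ℕ} {K J K' J' : Finset ι}
    (hr : StepReach (VRel (vtxSet A (insert i S))) m K J)
    (hK : (K = K' ∧ K ∈ vtxSet A (insert i S) ∧ ¬ K ⊆ insert i I) ∨
      (K ∈ vtxSet A (insert i S) ∧ K' ∈ vtxSet A S ∧ K ⊆ insert i I ∧ K' ⊆ insert i I))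
    (hJ : (J = J' ∧ J ∈ vtxSet A (insert i S) ∧ ¬ J ⊆ insert i I) ∨
      (J ∈ vtxSet A (insert i S) ∧ J' ∈ vtxSet A S ∧ J ⊆ insert i I ∧ J' ⊆ insert i I)) :
    StepReach (VRel (vtxSet A S)) m K' J' := by
  have hc := h.card_insert hi
  refine StepReach.flip (e := 0) (T := insert i I) (fun J hJ => by rw [hc, hJ.2.1])
    (fun J hJ => by rw [hc, hJ.2.1]) (fun K hK => h.not_subset_iff hi hA hS hK)
    (fun j hj => h.erase_mem_iff hi hA hS hj) hA.atMostTwo (Or.inr ⟨I, fun L hL hLT => ?_⟩) hr hK hJ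
  refine Finset.eq_of_subset_of_card_le (fun x hx => ?_) ?_
  · exact (Finset.mem_insert.1 (hLT hx)).resolve_left fun h' => hi (hL.1 (h' ▸ hx))
  · have := hL.2.1
    have := h.1.2.1
    omega

/-- `I` is represented by a vertex of the simplex that the cut produced; `hfin` makes `I` non-empty,
so that there is one of the form `insert i (I.erase j)`. -/
theorem fDiamLE_of_insert (h : TruncAt A S i I) (hi : i ∉ S) (hA : Gen A (insert i S))
    (hS : finrank ℝ E ≤ S.card) (hfin : 2 ≤ finrank ℝ E) {k : ℕ}
    (hk : FDiamLE (vtxSet A (insert i S)) k) :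
    FDiamLE (vtxSet A S) k := by
  have hIne : I.Nonempty := Finset.card_pos.1 (by have := h.1.2.1; omega)
  obtain ⟨j, hj⟩ := hIne
  have hij : i ≠ j := by rintro rfl; exact hi (h.1.1 hj)
  have hu := h.insert_erase_mem hi hA hS hj
  have rep : ∀ K' ∈ vtxSet A S, ∃ K ∈ vtxSet A (insert i S),
      (K = K' ∧ K ∈ vtxSet A (insert i S) ∧ ¬ K ⊆ insert i I) ∨
      (K ∈ vtxSet A (insert i S) ∧ K' ∈ vtxSet A S ∧ K ⊆ insert i I ∧ K' ⊆ insert i I) := by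
    intro K' hK'
    by_cases hT : K' ⊆ insert i I
    · exact ⟨_, hu, Or.inr ⟨hu, hK', Finset.insert_subset_insert _ (Finset.erase_subset _ _), hT⟩⟩
    · have := (h.not_subset_iff hi hA hS hT).2 hK'
      exact ⟨K', this, Or.inl ⟨rfl, this, hT⟩⟩
  intro K' hK' J' hJ'
  obtain ⟨K, hK, hKK⟩ := rep K' hK'
  obtain ⟨J, hJ, hJJ⟩ := rep J' hJ'
  exact h.stepReach hi hA hS (hk K hK J hJ) hKK hJJ

theorem not_subset (h : TruncAt A S i I) (hi : i ∉ S) {Z : Finset ι} (hZ : Z ∈ vtxSet A S)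
    (hZI : Z ≠ I) : ¬ Z ⊆ insert i I := by
  intro hZT
  refine hZI (Finset.eq_of_subset_of_card_le (fun x hx => ?_) ?_)
  · exact (Finset.mem_insert.1 (hZT hx)).resolve_left (by rintro rfl; exact hi (hZ.1 hx))
  · have := hZ.2.1
    have := h.1.2.1
    omega

theorem mem_of_ne (h : TruncAt A S i I) (hi : i ∉ S) (hA : Gen A (insert i S))
    (hS : finrank ℝ E ≤ S.card) {Z : Finset ι} (hZ : Z ∈ vtxSet A S) (hZI : Z ≠ I) :
    Z ∈ vtxSet A (insert i S) :=
  (h.not_subset_iff hi hA hS (h.not_subset hi hZ hZI)).2 hZ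

/-- The new vertex on the edge from the truncated vertex `I` to its neighbour `K` is farther from
`Z` than both of them. -/
theorem not_stepReach (h : TruncAt A S i I) (hi : i ∉ S) (hA : Gen A (insert i S))
    (hS : finrank ℝ E ≤ S.card) {j l : ι} (hj : j ∈ I) (hl : l ∉ I)
    (hK : insert l (I.erase j) ∈ vtxSet A S) {Z : Finset ι} (hZ : Z ∈ vtxSet A S) (hZI : Z ≠ I)
    {k : ℕ} (h1 : ¬ StepReach (VRel (vtxSet A S)) k I Z)
    (h2 : ¬ StepReach (VRel (vtxSet A S)) k (insert l (I.erase j)) Z) :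
    ¬ StepReach (VRel (vtxSet A (insert i S))) (k + 1) (insert i (I.erase j)) Z := by
  rintro ⟨c, hc, hcZ⟩
  have hAS := hA.subset (Finset.subset_insert i S)
  have hij : i ≠ j := by rintro rfl; exact hi (h.1.1 hj)
  have hiI : i ∉ I := fun h' => hi (h.1.1 h')
  have hu := h.insert_erase_mem hi hA hS hj
  have hZ' := h.not_subset hi hZ hZI
  have hZm := h.mem_of_ne hi hA hS hZ hZI
  have hcm : c ∈ vtxSet A (insert i S) := by
    rcases hc with rfl | hc
    · exact hu
    · exact hc.2.1
  -- A first step within the cut simplex collapses to `I`, too far from `Z`. Since no edge has three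
  -- ends, a first step out of the simplex can only lead to `insert l (I.erase j)`, also too far.
  by_cases hcT : c ⊆ insert i I
  · exact h1 (h.stepReach hi hA hS hcZ
      (Or.inr ⟨hcm, h.1, hcT, Finset.subset_insert _ _⟩) (Or.inl ⟨rfl, hZm, hZ'⟩))
  have hreach := h.stepReach hi hA hS hcZ (Or.inl ⟨rfl, hcm, hcT⟩) (Or.inl ⟨rfl, hZm, hZ'⟩)
  rcases hc with rfl | hc
  · exact hcT (Finset.insert_subset_insert _ (Finset.erase_subset _ _))
  have hue : insert i (I.erase j) = (insert i I).erase j := by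
    rw [Finset.erase_insert_of_ne hij]
  rw [hue] at hc hu
  have hjT : j ∈ insert i I := Finset.mem_insert_of_mem hj
  obtain ⟨m, hmT, hmj, -, x, hx, rfl⟩ := FAdj.exists_erase hjT hcT hc.2.2.symm
  by_cases hmi : m = i
  · subst hmi
    have hF : ((insert m I).erase j).erase m = I.erase j := by
      rw [← hue, Finset.erase_insert fun h' => hiI (Finset.mem_of_mem_erase h')]
    rw [hF] at hreach hcT hcm
    have hxI : x ∉ I := fun h' => hx (Finset.mem_insert_of_mem h')
    by_cases hxl : x = l
    · subst hxl; exact h2 hreach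
    · refine hAS.atMostTwo (I.erase j) j l x (by simp)
        (fun h' => hl (Finset.mem_of_mem_erase h')) (fun h' => hxI (Finset.mem_of_mem_erase h'))
        (by rintro rfl; exact hl hj) (by rintro rfl; exact hxI hj) (Ne.symm hxl) ?_ hK
        ((h.not_subset_iff hi hA hS hcT).1 hcm)
      rw [Finset.insert_erase hj]; exact h.1
  · have hmI : m ∈ I := (Finset.mem_insert.1 hmT).resolve_left hmi
    have hm := h.insert_erase_mem hi hA hS hmI
    rw [← Finset.erase_insert_of_ne (Ne.symm hmi)] at hm
    refine hA.atMostTwo (((insert i I).erase j).erase m) m j x (by simp) (by simp)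
      (fun h' => hx (Finset.mem_of_mem_erase (Finset.mem_of_mem_erase h'))) hmj
      (by rintro rfl; exact hx hmT) (by rintro rfl; exact hx hjT) ?_ ?_ hcm
    · rw [Finset.insert_erase (Finset.mem_erase.2 ⟨hmj, hmT⟩)]; exact hu
    · rw [Finset.erase_right_comm, Finset.insert_erase (Finset.mem_erase.2 ⟨hmj.symm, hjT⟩)]
      exact hm

end TruncAt

end Cuts

open Module Filter Topology

/-! ### Generic functionals, and irredundancy after adding a constraint -/

section Generic

variable {ι : Type*} {E : Type*} [NormedAddCommGroup E] [NormedSpace ℝ E]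

/-- A non-empty open set contains a point where none of finitely many given non-zero functionals
vanishes. -/
theorem exists_forall_ne_zero {Q : Set (E →L[ℝ] ℝ)} (hQ : Q.Finite) (h0 : ∀ f ∈ Q, f ≠ 0) {x : E}
    {P : E → Prop} (hP : ∀ᶠ y in 𝓝 x, P y) : ∃ y, P y ∧ ∀ f ∈ Q, f y ≠ 0 := by
  induction Q, hQ using Set.Finite.induction_on generalizing P with
  | empty => exact ⟨x, hP.self_of_nhds, by simp⟩
  | @insert f Q hf hQ ih =>
    obtain ⟨y, hyP, hyQ⟩ := ih (fun z hz => h0 z (Set.mem_insert_of_mem _ hz))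
      (eventually_eventually_nhds.2 hP)
    obtain ⟨w, hw⟩ := DFunLike.ne_iff.1 (h0 f (Set.mem_insert _ _))
    have hcont : Tendsto (fun ε : ℝ => y + ε • w) (𝓝[≠] 0) (𝓝 y) := by
      have : Continuous (fun ε : ℝ => y + ε • w) := by fun_prop
      have h := this.tendsto 0
      simp only [zero_smul, add_zero] at h
      exact h.mono_left nhdsWithin_le_nhds
    have hQ' : ∀ᶠ z in 𝓝 y, ∀ f ∈ Q, f z ≠ 0 := by
      rw [hQ.eventually_all]
      exact fun g hg => g.continuous.continuousAt.eventually_ne (hyQ g hg)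
    have hf' : ∀ᶠ ε : ℝ in 𝓝[≠] 0, f (y + ε • w) ≠ 0 := by
      by_cases hfy : f y = 0
      · filter_upwards [self_mem_nhdsWithin] with ε hε
        rw [map_add, hfy, zero_add, map_smul, smul_eq_mul]
        exact mul_ne_zero hε hw
      · exact hcont.eventually (f.continuous.continuousAt.eventually_ne hfy)
    obtain ⟨ε, h1, h2, h3⟩ := ((hcont.eventually hyP).and ((hcont.eventually hQ').and hf')).exists
    refine ⟨_, h1, fun g hg => ?_⟩
    rcases hg with rfl | hg
    · exact h3
    · exact h2 g hg

/-- A non-empty open set of functionals contains one that vanishes at none of finitely many given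
non-zero points. -/
theorem exists_generic {Q : Set E} (hQ : Q.Finite) (h0 : ∀ z ∈ Q, z ≠ 0) {a₁ : E →L[ℝ] ℝ}
    {P : (E →L[ℝ] ℝ) → Prop} (hP : ∀ᶠ a in 𝓝 a₁, P a) : ∃ a, P a ∧ ∀ z ∈ Q, a z ≠ 0 := by
  obtain ⟨a, h1, h2⟩ := exists_forall_ne_zero
    (hQ.image (ContinuousLinearMap.apply ℝ ℝ : E →L[ℝ] (E →L[ℝ] ℝ) →L[ℝ] ℝ)) (by
      rintro _ ⟨z, hz, rfl⟩ h
      obtain ⟨φ, hφ⟩ := SeparatingDual.exists_ne_zero (R := ℝ) (h0 z hz)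
      exact hφ (DFunLike.congr_fun h φ)) hP
  exact ⟨a, h1, fun z hz => h2 _ ⟨z, hz, rfl⟩⟩

/-- Tilting `a₀` slightly by `φ` makes it negative at `y₀` and keeps it positive on `P`. Both
conditions are open, leaving room to avoid zeros on `Q`. The intended `a₀` is the sum of the
functionals tight at a vertex. -/
theorem exists_functional {y₀ : E} {a₀ φ : E →L[ℝ] ℝ} (hφ : φ y₀ < 0) (h₀ : a₀ y₀ = 0)
    {P Q : Set E} (hP : P.Finite) (hpos : ∀ z ∈ P, 0 < a₀ z) (hQ : Q.Finite)
    (hne : ∀ z ∈ Q, z ≠ 0) : ∃ a : E →L[ℝ] ℝ, a y₀ < 0 ∧ (∀ z ∈ P, 0 < a z) ∧ ∀ z ∈ Q, a z ≠ 0 := by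
  have hP' : ∀ᶠ b in 𝓝 a₀, ∀ z ∈ P, 0 < b z := by
    rw [hP.eventually_all]
    intro x hx
    have : Continuous (fun b : E →L[ℝ] ℝ => b x) := by fun_prop
    exact this.continuousAt.eventually (lt_mem_nhds (hpos x hx))
  have hcont : Tendsto (fun ε : ℝ => a₀ + ε • φ) (𝓝[>] 0) (𝓝 a₀) := by
    have : Continuous (fun ε : ℝ => a₀ + ε • φ) := by fun_prop
    have h := this.tendsto 0
    simp only [zero_smul, add_zero] at h
    exact h.mono_left nhdsWithin_le_nhds
  obtain ⟨ε, h1, h2⟩ := ((hcont.eventually (eventually_eventually_nhds.2 hP')).and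
    self_mem_nhdsWithin).exists
  have h3 : (a₀ + ε • φ) y₀ < 0 := by
    have : 0 < ε := h2
    simp [h₀]; nlinarith
  have h4 : ∀ᶠ b in 𝓝 (a₀ + ε • φ), b y₀ < 0 := by
    have : Continuous (fun b : E →L[ℝ] ℝ => b y₀) := by fun_prop
    exact this.continuousAt.eventually (gt_mem_nhds h3)
  obtain ⟨a, ⟨ha1, ha2⟩, ha3⟩ := exists_generic hQ hne (h4.and h1)
  exact ⟨a, ha1, ha2, ha3⟩

variable {A A' : ι → E →L[ℝ] ℝ} {S : Finset ι} {i : ι}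

theorem wit_congr (h : ∀ l ∈ S, A l = A' l) {I : Finset ι} (hI : I ⊆ S) {y : E} :
    Wit A S I y ↔ Wit A' S I y := by
  constructor
  · exact fun hw => ⟨fun m hm => by rw [← h m (hI hm)]; exact hw.1 m hm,
      fun l hl hlI => by rw [← h l hl]; exact hw.2 l hl hlI⟩
  · exact fun hw => ⟨fun m hm => by rw [h m (hI hm)]; exact hw.1 m hm,
      fun l hl hlI => by rw [h l hl]; exact hw.2 l hl hlI⟩

theorem vtxSet_congr (h : ∀ l ∈ S, A l = A' l) : vtxSet A S = vtxSet A' S := by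
  ext I
  constructor
  · rintro ⟨h1, h2, y, hy⟩
    exact ⟨h1, h2, y, (wit_congr h h1).1 hy⟩
  · rintro ⟨h1, h2, y, hy⟩
    exact ⟨h1, h2, y, (wit_congr h h1).2 hy⟩

theorem Gen.congr (h : ∀ l ∈ S, A l = A' l) (hA : Gen A S) : Gen A' S :=
  fun T hT hc y hy => hA T hT hc y fun m hm => by rw [h m (hT hm)]; exact hy m hm

theorem Irred.congr (h : ∀ l ∈ S, A l = A' l) (hA : Irred A S) : Irred A' S := by
  intro l hl
  obtain ⟨z, hz, hz'⟩ := hA l hl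
  exact ⟨z, by rw [← h l hl]; exact hz, fun m hm hml => by rw [← h m hm]; exact hz' m hm hml⟩

theorem Irred.subset {S' : Finset ι} (hS : S' ⊆ S) (hA : Irred A S) : Irred A S' := by
  intro l hl
  obtain ⟨z, hz, hz'⟩ := hA l (hS hl)
  exact ⟨z, hz, fun m hm => hz' m (hS hm)⟩

theorem vtxSet_finite : (vtxSet A S).Finite :=
  S.powerset.finite_toSet.subset fun _ hI => Finset.mem_coe.2 (Finset.mem_powerset.2 hI.1)

variable [DecidableEq ι]

theorem TruncAt.congr {I : Finset ι} (h : ∀ l ∈ S, A l = A' l) (hi : A i = A' i)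
    (hT : TruncAt A S i I) : TruncAt A' S i I := by
  obtain ⟨h1, ⟨y, hy, hy'⟩, h3⟩ := hT
  rw [vtxSet_congr h] at h1
  refine ⟨h1, ⟨y, (wit_congr h h1.1).1 hy, hi ▸ hy'⟩, fun J hJ hne => ?_⟩
  obtain ⟨z, hz, hz'⟩ := h3 J (by rwa [vtxSet_congr h]) hne
  exact ⟨z, (wit_congr h hJ.1).1 hz, hi ▸ hz'⟩

/-- A critical set containing `i` is `i` together with some `J` whose common kernel is the line
through `k J`; the new functional only has to be non-zero on these lines. -/
theorem Gen.insert_of_ne (hA : Gen A S) (hS : finrank ℝ E ≤ S.card) {k : Finset ι → E}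
    (hk : ∀ J ⊆ S, J.card + 1 = finrank ℝ E → k J ≠ 0 ∧ ∀ m ∈ J, A m (k J) = 0)
    (hne : ∀ J ⊆ S, J.card + 1 = finrank ℝ E → A i (k J) ≠ 0) : Gen A (insert i S) := by
  intro T hT hc y hy
  by_cases hiT : i ∈ T
  · have hJS : T.erase i ⊆ S := fun x hx =>
      (Finset.mem_insert.1 (hT (Finset.mem_of_mem_erase hx))).resolve_left
        (Finset.ne_of_mem_erase hx)
    have hJc : (T.erase i).card + 1 = finrank ℝ E := by rw [Finset.card_erase_add_one hiT, hc]
    obtain ⟨hk0, hkJ⟩ := hk _ hJS hJc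
    obtain ⟨l, hl, hlJ⟩ := Finset.exists_mem_notMem_of_card_lt_card
      (show (T.erase i).card < S.card by omega)
    have hprop := hA.proportional hJS hJc hl hlJ hkJ fun m hm => hy m (Finset.mem_of_mem_erase hm)
    have hlk : A l (k (T.erase i)) ≠ 0 := fun h => hk0 <|
      hA (insert l (T.erase i)) (Finset.insert_subset hl hJS)
        (by rw [Finset.card_insert_of_notMem hlJ, hJc]) _ fun m hm => by
          rcases Finset.mem_insert.1 hm with rfl | hm
          · exact h
          · exact hkJ m hm
    have h1 := congrArg (A i) hprop
    simp only [map_smul, smul_eq_mul, hy i hiT, mul_zero, mul_eq_zero, hne _ hJS hJc,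
      or_false] at h1
    rw [h1, zero_smul] at hprop
    exact (smul_eq_zero.1 hprop.symm).resolve_left hlk
  · exact hA T (fun x hx => (Finset.mem_insert.1 (hT hx)).resolve_left
      (by rintro rfl; exact hiT hx)) hc y hy

/-- Facet points of two different constraints add up to a point positive everywhere. Moving from `y`
in its direction until `A i` vanishes gives a facet point for `i`. -/
theorem irred_insert (hS : 2 ≤ S.card)
    (h : ∀ l ∈ S, ∃ z, A l z = 0 ∧ (∀ m ∈ S, m ≠ l → 0 < A m z) ∧ 0 < A i z)
    (hi : ∃ y, (∀ l ∈ S, 0 ≤ A l y) ∧ A i y < 0) : Irred A (insert i S) := by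
  intro l hl
  by_cases hlS : l ∈ S
  · obtain ⟨z, h1, h2, h3⟩ := h l hlS
    refine ⟨z, h1, fun m hm hml => ?_⟩
    rcases Finset.mem_insert.1 hm with rfl | hm
    · exact h3
    · exact h2 m hm hml
  · obtain rfl : l = i := (Finset.mem_insert.1 hl).resolve_right hlS
    obtain ⟨p, hp, q, hq, hpq⟩ := Finset.one_lt_card.1 hS
    obtain ⟨zp, p1, p2, p3⟩ := h p hp
    obtain ⟨zq, q1, q2, q3⟩ := h q hq
    obtain ⟨y, hy, hyi⟩ := hi
    have hpos : 0 < A l (zp + zq) := by simpa using add_pos p3 q3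
    refine ⟨y + (-(A l y) / A l (zp + zq)) • (zp + zq), ?_, fun m hm hml => ?_⟩
    · have := hpos.ne'
      rw [map_add, map_smul, smul_eq_mul, div_mul_cancel₀ _ this]; ring
    · have hmS := (Finset.mem_insert.1 hm).resolve_left hml
      have hm' : 0 < A m (zp + zq) := by
        rw [map_add]
        by_cases hmp : m = p
        · subst hmp
          rw [p1, zero_add]
          exact q2 m hmS hpq
        · have := p2 m hmS hmp
          by_cases hmq : m = q
          · subst hmq; rw [q1, add_zero]; exact this
          · exact add_pos this (q2 m hmS hmq)
      rw [map_add, map_smul, smul_eq_mul]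
      have := mul_pos (div_pos (neg_pos.2 hyi) hpos) hm'
      have := hy m hmS
      linarith

theorem exists_pos_add_mul {x : ℝ} (hx : 0 < x) (c : ℝ) : ∃ η > 0, 0 < x + η * c := by
  refine ⟨x / (|c| + 1), by positivity, ?_⟩
  have h1 : -|c| ≤ c := neg_abs_le c
  have h2 : 0 < |c| + 1 := by positivity
  have : x + x / (|c| + 1) * c = x * (|c| + 1 + c) / (|c| + 1) := by field_simp
  rw [this]
  apply div_pos (mul_pos hx (by linarith)) h2

variable [FiniteDimensional ℝ E]

/-- Each old facet has a vertex other than `I`: if `I` is on it, dropping another element of `I`,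
available by `hfin`, leads to a neighbour on the same facet. A small multiple of the facet point
added to that vertex is not cut off. -/
theorem TruncAt.irred {I : Finset ι} (h : TruncAt A S i I)
    (hA : Gen A (insert i S)) (hS : finrank ℝ E ≤ S.card) (hfin : 3 ≤ finrank ℝ E)
    (hI : Irred A S) : Irred A (insert i S) := by
  have hAS := hA.subset (Finset.subset_insert i S)
  refine irred_insert (by omega) (fun l hl => ?_) ?_
  · obtain ⟨z, hz, hz'⟩ := hI l hl
    obtain ⟨J, hJ, hlJ, hJI⟩ : ∃ J ∈ vtxSet A S, l ∈ J ∧ J ≠ I := by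
      obtain ⟨m, hm, hml⟩ := Finset.exists_mem_ne (show 1 < S.card by omega) l
      have hnn : ∀ m ∈ S, 0 ≤ A m z := fun m hm => by
        by_cases hml : m = l
        · rw [hml, hz]
        · exact (hz' m hm hml).le
      obtain ⟨J, hJ, hlJ, -⟩ := exists_vertex hS (fun y hy _ => hAS.card_tight hy) hnn
        (a := -A m) (by simpa using hz' m hm hml)
      have hlJ : l ∈ J := hlJ (Finset.mem_filter.2 ⟨hl, hz⟩)
      by_cases hJI : J = I
      · subst hJI
        obtain ⟨j, hj, hjl⟩ := Finset.exists_mem_ne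
          (show 1 < J.card by have := hJ.2.1; omega) l
        obtain ⟨x, hx, hxJ, hK⟩ := hAS.exists_neighbor hS hJ hj
        exact ⟨_, hK, Finset.mem_insert_of_mem (Finset.mem_erase.2 ⟨hjl.symm, hlJ⟩),
          fun h => hxJ (h ▸ Finset.mem_insert_self _ _)⟩
      · exact ⟨J, hJ, hlJ, hJI⟩
    obtain ⟨y, hy, hyi⟩ := h.2.2 J hJ hJI
    obtain ⟨η, hη, hpos⟩ := exists_pos_add_mul hyi (A i z)
    refine ⟨y + η • z, by simp [hy.1 l hlJ, hz], fun m hm hml => ?_, by simpa using hpos⟩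
    have := hy.nonneg hm
    have := mul_pos hη (hz' m hm hml)
    simp only [map_add, map_smul, smul_eq_mul]
    linarith
  · obtain ⟨y, hy, hyi⟩ := h.2.1
    exact ⟨y, fun l hl => hy.nonneg hl, hyi⟩

end Generic

/-! ### Moving one constraint: every passage over a vertex is a flip -/

section Moves

variable {ι : Type*} {E : Type*} [NormedAddCommGroup E] [NormedSpace ℝ E]
  [FiniteDimensional ℝ E] [DecidableEq ι] {A : ι → E →L[ℝ] ℝ} {S : Finset ι} {i : ι}

/-- The configuration in which the functional `A i` is moved to `A i + s • h`. -/
def shiftAt (A : ι → E →L[ℝ] ℝ) (i : ι) (h : E →L[ℝ] ℝ) (s : ℝ) : ι → E →L[ℝ] ℝ :=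
  Function.update A i (A i + s • h)

theorem shiftAt_self (h : E →L[ℝ] ℝ) (s : ℝ) (y : E) :
    shiftAt A i h s i y = A i y + s * h y := by simp [shiftAt]

theorem shiftAt_of_mem (hi : i ∉ S) (h : E →L[ℝ] ℝ) (s : ℝ) : ∀ l ∈ S, A l = shiftAt A i h s l :=
  fun l hl => (Function.update_of_ne (by rintro rfl; exact hi hl) _ _).symm

/-- Passing from one position of the constraint `i` to another one such that the signs at the
vertices differ in at most one vertex `J₀`. -/
theorem fDiamLE_cutFam (hi : i ∉ S) (hS : finrank ℝ E ≤ S.card) (hfin : 0 < finrank ℝ E)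
    {B : ι → E →L[ℝ] ℝ} (hAB : ∀ l ∈ S, A l = B l)
    (hA : Gen A (insert i S)) (hB : Gen B (insert i S)) (hBI : Irred B (insert i S))
    {J₀ : Finset ι} (hJ₀ : J₀ ∈ vtxSet A S) {v : Finset ι → E}
    (hv : ∀ J ∈ vtxSet A S, Wit A S J (v J))
    (hagree : ∀ J ∈ vtxSet A S, J ≠ J₀ → (0 < A i (v J) ↔ 0 < B i (v J)))
    {K : ℕ} (hk : FDiamLE (vtxSet A (insert i S)) K) :
    FDiamLE (vtxSet B (insert i S)) (K + 1) := by
  have hAS := hA.subset (Finset.subset_insert i S)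
  have eA : vtxSet A (insert i S) = cutFam (vtxSet A S) (fun J => 0 < A i (v J)) i := by
    rw [vtxSet_insert hi hA hS]
    exact cutFam_congr fun J hJ => ⟨fun ⟨y, hy, hpos⟩ => hy.pos_of_pos hS hAS hJ (hv J hJ) hpos,
      fun h => ⟨_, hv J hJ, h⟩⟩
  have eB : vtxSet B (insert i S) = cutFam (vtxSet A S) (fun J => 0 < B i (v J)) i := by
    rw [vtxSet_insert hi hB hS, ← vtxSet_congr hAB]
    refine cutFam_congr fun J hJ => ⟨fun ⟨y, hy, hpos⟩ => ?_,
      fun h => ⟨_, (wit_congr hAB hJ.1).1 (hv J hJ), h⟩⟩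
    exact ((wit_congr hAB hJ.1).2 hy).pos_of_pos hS hAS hJ (hv J hJ) hpos
  by_cases h₀ : 0 < A i (v J₀) ↔ 0 < B i (v J₀)
  · have : vtxSet A (insert i S) = vtxSet B (insert i S) := by
      rw [eA, eB]
      refine cutFam_congr fun J hJ => ?_
      by_cases hJJ : J = J₀
      · rw [hJJ, h₀]
      · exact hagree J hJ hJJ
    rw [← this]
    exact hk.mono (Nat.le_succ K)
  · have hiV : ∀ J ∈ vtxSet A S, i ∉ J := fun J hJ hiJ => hi (hJ.1 hiJ)
    have hT : (insert i J₀).card = finrank ℝ E := by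
      rw [Finset.card_insert_of_notMem (hiV _ hJ₀), hJ₀.2.1]
    have hpart : ∀ j ∈ insert i J₀, ((insert i J₀).erase j ∈ vtxSet A (insert i S) ↔
        (insert i J₀).erase j ∉ vtxSet B (insert i S)) := by
      intro j hj
      rw [eA, eB]
      exact erase_mem_cutFam_iff hiV hAS.atMostTwo (hAS.exists_neighbor' hS) hJ₀ hagree
        (by tauto) hj
    refine FDiamLE.flip (T := insert i J₀) (fun I hI => by rw [hT, hI.2.1])
      (fun I hI => by rw [hT, hI.2.1]) (fun I hI => ?_) hpart hA.atMostTwo ?_ (Or.inl le_rfl) hk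
    · rw [eA, eB]
      exact ⟨mem_cutFam_of_not_subset hagree hI,
        mem_cutFam_of_not_subset (fun J hJ hne => (hagree J hJ hne).symm) hI⟩
    -- If no codimension-one subset of `insert i J₀` were a vertex before the move, all of them
    -- would be afterwards, and irredundancy excludes such a simplex.
    · by_contra hne
      push Not at hne
      refine hBI.not_simplex hB (Finset.insert_subset_insert i hJ₀.1) hT ?_ hfin fun j hj => ?_
      · rw [Finset.card_insert_of_notMem hi]; omega
      · by_contra h
        exact hne j hj ((hpart j hj).2 h)

/-- Around every parameter, good or bad, `Q` is constant on the nearby good ones. Density of `G`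
lets two such neighbourhoods be chained, and connectedness of the segment does the rest. -/
theorem segment_induction {G : Set ℝ} (hfin : (Set.Icc 0 1 \ G).Finite)
    {Q : ℝ → Prop} (hloc : ∀ s₀ ∈ Set.Icc (0 : ℝ) 1, ∃ U ∈ 𝓝 s₀, ∀ s ∈ U, ∀ s' ∈ U, s ∈ G →
      s' ∈ G → Q s → Q s') (h0 : 0 ∈ G) (h1 : 1 ∈ G) : Q 1 → Q 0 := by
  let P : ℝ → ℝ → Prop := fun x y => ∃ U ∈ 𝓝 x, ∃ U' ∈ 𝓝 y, ∀ s ∈ U, ∀ s' ∈ U', s ∈ G → s' ∈ G →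
    (Q s ↔ Q s')
  have hdense : Set.Icc (0 : ℝ) 1 ⊆ closure G := by
    have h2 : Dense ((Set.Icc 0 1 \ G)ᶜ) := hfin.countable.dense_compl ℝ
    have h3 := h2.open_subset_closure_inter (isOpen_Ioo (a := (0 : ℝ)) (b := 1))
    rw [← closure_Ioo (zero_ne_one)]
    refine closure_minimal (h3.trans (closure_mono ?_)) isClosed_closure
    rintro x ⟨hx, hxG⟩
    by_contra h
    exact hxG ⟨⟨hx.1.le, hx.2.le⟩, h⟩
  have hP : P 0 1 := by
    refine isPreconnected_Icc.induction₂ P ?_ ?_ ?_ (Set.left_mem_Icc.2 zero_le_one)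
      (Set.right_mem_Icc.2 zero_le_one)
    · intro x hx
      obtain ⟨U, hU, hUQ⟩ := hloc x hx
      refine mem_nhdsWithin_of_mem_nhds ?_
      filter_upwards [eventually_mem_nhds_iff.2 hU] with y hy
      exact ⟨U, hU, U, hy, fun s hs s' hs' hG hG' => ⟨hUQ s hs s' hs' hG hG',
        hUQ s' hs' s hs hG' hG⟩⟩
    · rintro x y z - hy - ⟨U, hU, V, hV, h⟩ ⟨V', hV', W, hW, h'⟩
      obtain ⟨t, ht, htG⟩ := mem_closure_iff_nhds.1 (hdense hy) _ (inter_mem hV hV')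
      exact ⟨U, hU, W, hW, fun s hs s' hs' hG hG' =>
        (h s hs t ht.1 hG htG).trans (h' t ht.2 s' hs' htG hG')⟩
    · rintro x y - - ⟨U, hU, V, hV, h⟩
      exact ⟨V, hV, U, hU, fun s hs s' hs' hG hG' => (h s' hs' s hs hG' hG).symm⟩
  obtain ⟨U, hU, V, hV, h⟩ := hP
  exact (h 0 (mem_of_mem_nhds hU) 1 (mem_of_mem_nhds hV) h0 h1).2

/-- If no configuration has diameter exactly `K + 1`, then moving one constraint along a suitable
segment until it cuts off just one vertex of the remaining polytope does not change on which side
of `K + 1` the diameter lies. -/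
theorem exists_truncation (hi : i ∉ S) (hA : Gen A (insert i S)) (hI : Irred A (insert i S))
    (hS : finrank ℝ E ≤ S.card) (hfin : 3 ≤ finrank ℝ E) {K : ℕ}
    (hgap : ∀ B : ι → E →L[ℝ] ℝ, Gen B (insert i S) → Irred B (insert i S) →
      FDiamLE (vtxSet B (insert i S)) (K + 1) → FDiamLE (vtxSet B (insert i S)) K) :
    ∃ (a : E →L[ℝ] ℝ) (I : Finset ι), Gen (Function.update A i a) (insert i S) ∧
      TruncAt (Function.update A i a) S i I ∧
      (FDiamLE (vtxSet (Function.update A i a) (insert i S)) K →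
        FDiamLE (vtxSet A (insert i S)) K) := by
  have hAS := hA.subset (Finset.subset_insert i S)
  have hIS := hI.subset (Finset.subset_insert i S)
  have hiS : ∀ l ∈ S, l ≠ i := fun l hl => by rintro rfl; exact hi hl
  choose! v hv using fun J (hJ : J ∈ vtxSet A S) => hJ.2.2
  choose! k hk0 hk using fun J (hJ : J ⊆ S ∧ J.card + 1 = finrank ℝ E) =>
    exists_ker (A := A) (J := J) (by omega)
  choose! z hz0 hzpos using hI
  have hAk : ∀ J ⊆ S, J.card + 1 = finrank ℝ E → A i (k J) ≠ 0 := fun J hJ hc h =>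
    hk0 J ⟨hJ, hc⟩ <| hA (insert i J) (Finset.insert_subset_insert i hJ)
      (by rw [Finset.card_insert_of_notMem fun h => hi (hJ h), hc]) _ fun m hm => by
        rcases Finset.mem_insert.1 hm with rfl | hm
        · exact h
        · exact hk J ⟨hJ, hc⟩ m hm
  have hv0 : ∀ J ∈ vtxSet A S, v J ≠ 0 := fun J hJ h => by
    obtain ⟨l, hl, hlJ⟩ := vtxSet_exists_notMem hS hJ
    have := (hv J hJ).2 l hl hlJ
    rw [h] at this; simp at this
  have hAv : ∀ J ∈ vtxSet A S, A i (v J) ≠ 0 := fun J hJ h =>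
    hv0 J hJ <| hA (insert i J) (Finset.insert_subset_insert i hJ.1)
      (by rw [Finset.card_insert_of_notMem fun h => hi (hJ.1 h), hJ.2.1]) _ fun m hm => by
        rcases Finset.mem_insert.1 hm with rfl | hm
        · exact h
        · exact (hv J hJ).1 m hm
  -- a vertex that is cut off by the constraint `i`
  obtain ⟨I, hIV, hIneg⟩ : ∃ I ∈ vtxSet A S, A i (v I) < 0 := by
    have hzi := hz0 i (Finset.mem_insert_self _ _)
    obtain ⟨w, hw⟩ : ∃ w, A i w < 0 := by
      obtain ⟨l, hl⟩ := Finset.card_pos.1 (show 0 < S.card by omega)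
      have hpos := hzpos l (Finset.mem_insert_of_mem hl) i (Finset.mem_insert_self _ _)
        (hiS l hl).symm
      exact ⟨-z l, by simpa using hpos⟩
    have hcont : Continuous fun t : ℝ => z i + t • w := by fun_prop
    have hev : ∀ᶠ t : ℝ in 𝓝[>] 0, ∀ l ∈ S, 0 ≤ A l (z i + t • w) := by
      rw [S.eventually_all]
      intro l hl
      have h1 : 0 < A l (z i + (0 : ℝ) • w) := by
        simpa using hzpos i (Finset.mem_insert_self _ _) l (Finset.mem_insert_of_mem hl) (hiS l hl)
      have h2 : Continuous fun t : ℝ => A l (z i + t • w) := by fun_prop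
      filter_upwards [(h2.tendsto 0).mono_left nhdsWithin_le_nhds (lt_mem_nhds h1)] with t ht
      exact le_of_lt ht
    obtain ⟨t, ht, ht0⟩ := (hev.and self_mem_nhdsWithin).exists
    have ht0 : 0 < t := ht0
    obtain ⟨I, hIV, -, y, hy, hyneg⟩ := exists_vertex hS (fun y hy _ => hAS.card_tight hy) ht
      (a := A i) (by rw [map_add, map_smul, hzi, zero_add, smul_eq_mul]; nlinarith)
    refine ⟨I, hIV, ?_⟩
    have := hy.pos_of_pos hS hAS hIV (hv I hIV) (φ := -A i) (by simpa using hyneg)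
    simpa using this
  -- the target functional
  obtain ⟨p, hp, hpI⟩ := vtxSet_exists_notMem hS hIV
  obtain ⟨a, haI, hapos, hane⟩ := exists_functional (y₀ := v I) (a₀ := ∑ j ∈ I, A j) (φ := -A p)
    (P := z '' S ∪ v '' {J | J ∈ vtxSet A S ∧ J ≠ I})
    -- Non-vanishing at the `k J` puts the target in general position. The second family ensures
    -- that the moving functional vanishes at different vertices for different parameters.
    (Q := k '' {J | J ⊆ S ∧ J.card + 1 = finrank ℝ E} ∪
      (fun x : Finset ι × Finset ι => A i (v x.1) • v x.2 - A i (v x.2) • v x.1) ''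
        ((vtxSet A S ×ˢ vtxSet A S) ∩ {x | x.1 ≠ x.2}))
    (by simpa using (hv I hIV).2 p hp hpI)
    (by rw [sum_apply]; exact Finset.sum_eq_zero (hv I hIV).1)
    ((S.finite_toSet.image _).union ((vtxSet_finite.subset fun _ h => h.1).image _))
    (by
      rintro _ (⟨l, hl, rfl⟩ | ⟨J, ⟨hJ, hJI⟩, rfl⟩)
      · have hl : l ∈ S := hl
        rw [sum_apply]
        obtain ⟨j, hj, hjl⟩ := Finset.exists_mem_ne
          (show 1 < I.card by have := hIV.2.1; omega) l
        refine Finset.sum_pos' (fun m hm => ?_) ⟨j, hj, hzpos l (Finset.mem_insert_of_mem hl) j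
          (Finset.mem_insert_of_mem (hIV.1 hj)) hjl⟩
        by_cases hml : m = l
        · rw [hml, hz0 l (Finset.mem_insert_of_mem hl)]
        · exact (hzpos l (Finset.mem_insert_of_mem hl) m
            (Finset.mem_insert_of_mem (hIV.1 hm)) hml).le
      · rw [sum_apply]
        have : ∃ j ∈ I, j ∉ J := by
          by_contra hcon
          push Not at hcon
          exact hJI (Finset.eq_of_subset_of_card_le hcon
            (by have := hIV.2.1; have := hJ.2.1; omega)).symm
        obtain ⟨j, hj, hjJ⟩ := this
        exact Finset.sum_pos' (fun m hm => (hv J hJ).nonneg (hIV.1 hm))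
          ⟨j, hj, (hv J hJ).2 j (hIV.1 hj) hjJ⟩)
    (((S.powerset.finite_toSet.subset fun J hJ =>
        Finset.mem_coe.2 (Finset.mem_powerset.2 hJ.1)).image _).union
      (((vtxSet_finite.prod vtxSet_finite).subset Set.inter_subset_left).image _))
    (by
      rintro _ (⟨J, hJ, rfl⟩ | ⟨⟨J, J'⟩, ⟨⟨hJ, hJ'⟩, hne⟩, rfl⟩)
      · exact hk0 J hJ
      · simp only [ne_eq, Set.mem_ofPred_eq] at hne hJ hJ' ⊢
        intro h
        have : ∃ l ∈ J, l ∉ J' := by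
          by_contra hcon
          push Not at hcon
          exact hne (Finset.eq_of_subset_of_card_le hcon
            (by have := hJ.2.1; have := hJ'.2.1; omega))
        obtain ⟨l, hl, hlJ'⟩ := this
        have h1 := congrArg (A l) h
        simp [(hv J hJ).1 l hl, hAv J hJ] at h1
        exact ((hv J' hJ').2 l (hJ.1 hl) hlJ').ne' h1)
  have hshift1 : Function.update A i a = shiftAt A i (a - A i) 1 := by simp [shiftAt]
  have hshift0 : A = shiftAt A i (a - A i) 0 := by simp [shiftAt]
  have hagr : ∀ s, ∀ l ∈ S, A l = shiftAt A i (a - A i) s l := fun s => shiftAt_of_mem hi _ s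
  have hval : ∀ s y, shiftAt A i (a - A i) s i y = (1 - s) * A i y + s * a y := by
    intro s y
    rw [shiftAt_self]; simp; ring
  have hak : ∀ J ⊆ S, J.card + 1 = finrank ℝ E → a (k J) ≠ 0 := fun J hJ hc =>
    hane _ (Or.inl ⟨J, ⟨hJ, hc⟩, rfl⟩)
  have hGen : ∀ s, (∀ J ⊆ S, J.card + 1 = finrank ℝ E → (1 - s) * A i (k J) + s * a (k J) ≠ 0) →
      Gen (shiftAt A i (a - A i) s) (insert i S) := by
    intro s hs
    refine (hAS.congr (hagr s)).insert_of_ne hS (k := k) (fun J hJ hc => ⟨hk0 J ⟨hJ, hc⟩,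
      fun m hm => ?_⟩) fun J hJ hc => ?_
    · rw [← hagr s m (hJ hm)]; exact hk J ⟨hJ, hc⟩ m hm
    · rw [hval]; exact hs J hJ hc
  -- The points `z l` and the cut-off vertex `v I` have the required sign under `A i` and under `a`,
  -- hence under all convex combinations.
  have hIrr : ∀ s ∈ Set.Icc (0 : ℝ) 1, Irred (shiftAt A i (a - A i) s) (insert i S) := by
    intro s hs
    refine irred_insert (by omega) (fun l hl => ⟨z l, ?_, fun m hm hml => ?_, ?_⟩)
      ⟨v I, fun l hl => ?_, ?_⟩
    · rw [← hagr s l hl]; exact hz0 l (Finset.mem_insert_of_mem hl)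
    · rw [← hagr s m hm]
      exact hzpos l (Finset.mem_insert_of_mem hl) m (Finset.mem_insert_of_mem hm) hml
    · rw [hval]
      have h1 := hzpos l (Finset.mem_insert_of_mem hl) i (Finset.mem_insert_self _ _)
        (hiS l hl).symm
      have h2 := hapos (z l) (Or.inl ⟨l, hl, rfl⟩)
      have := hs.1
      have := hs.2
      rcases hs.1.eq_or_lt with h | h
      · rw [← h]; simpa using h1
      · have := mul_pos h h2
        have := mul_nonneg (sub_nonneg.2 hs.2) h1.le
        linarith
    · rw [← hagr s l hl]; exact (hv I hIV).nonneg hl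
    · rw [hval]
      rcases hs.1.eq_or_lt with h | h
      · rw [← h]; simpa using hIneg
      · have := mul_pos h (neg_pos.2 haI)
        have := mul_nonneg (sub_nonneg.2 hs.2) (neg_pos.2 hIneg).le
        linarith
  have hG1 : Gen (shiftAt A i (a - A i) 1) (insert i S) :=
    hGen 1 fun J hJ hc => by simpa using hak J hJ hc
  refine ⟨a, I, hshift1 ▸ hG1, ?_, ?_⟩
  · refine ⟨by rw [← vtxSet_congr (hshift1 ▸ hagr 1)]; exact hIV, ⟨v I,
      (wit_congr (hshift1 ▸ hagr 1) hIV.1).1 (hv I hIV), by simpa using haI⟩, fun J hJ hne => ?_⟩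
    rw [← vtxSet_congr (hshift1 ▸ hagr 1)] at hJ
    exact ⟨v J, (wit_congr (hshift1 ▸ hagr 1) hJ.1).1 (hv J hJ),
      by simpa using hapos (v J) (Or.inr ⟨J, ⟨hJ, hne⟩, rfl⟩)⟩
  let G : Set ℝ := {s | s ∈ Set.Icc (0 : ℝ) 1 ∧ Gen (shiftAt A i (a - A i) s) (insert i S)}
  have hres := segment_induction (G := G)
    (Q := fun s => FDiamLE (vtxSet (shiftAt A i (a - A i) s) (insert i S)) K)
    ?_ ?_ ⟨Set.left_mem_Icc.2 zero_le_one, by rw [← hshift0]; exact hA⟩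
    ⟨Set.right_mem_Icc.2 zero_le_one, hG1⟩
  · intro h
    rw [hshift1] at h
    have := hres h
    rwa [← hshift0] at this
  · have hfin' : (⋃ J ∈ {J | J ⊆ S ∧ J.card + 1 = finrank ℝ E},
        {s : ℝ | (1 - s) * A i (k J) + s * a (k J) = 0}).Finite := by
      refine Set.Finite.biUnion (S.powerset.finite_toSet.subset fun J hJ =>
        Finset.mem_coe.2 (Finset.mem_powerset.2 hJ.1)) fun J hJ => Set.Subsingleton.finite ?_
      intro s hs s' hs'
      simp only [Set.mem_ofPred_eq] at hs hs'
      have h1 := hAk J hJ.1 hJ.2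
      have h2 : (s - s') * A i (k J) = (s - s') * a (k J) := by linarith
      by_contra hne
      have h3 := mul_left_cancel₀ (sub_ne_zero.2 hne) h2
      rw [← h3] at hs
      exact h1 (by linarith)
    refine hfin'.subset fun s hs => ?_
    by_contra hcon
    refine hs.2 ⟨hs.1, hGen s fun J hJ hc h => hcon ?_⟩
    exact Set.mem_biUnion (show J ∈ {J | J ⊆ S ∧ J.card + 1 = finrank ℝ E} from ⟨hJ, hc⟩) h
  -- At most one vertex lies on the hyperplane at `s₀`, and the others keep their sign nearby.
  -- Crossing `s₀` is thus at most one flip, which gives the bound `K + 1`, and `hgap` restores `K`.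
  · intro s₀ hs₀
    have huniq : ∀ J ∈ vtxSet A S, ∀ J' ∈ vtxSet A S,
        (1 - s₀) * A i (v J) + s₀ * a (v J) = 0 →
        (1 - s₀) * A i (v J') + s₀ * a (v J') = 0 → J = J' := by
      intro J hJ J' hJ' h h'
      by_contra hne
      have h1 := hane _ (Or.inr ⟨(J, J'), ⟨⟨hJ, hJ'⟩, hne⟩, rfl⟩)
      simp only [map_sub, map_smul, smul_eq_mul] at h1
      have hs : s₀ ≠ 0 := by
        rintro rfl
        exact hAv J hJ (by simpa using h)
      apply h1
      apply mul_left_cancel₀ hs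
      linear_combination A i (v J) * h' - A i (v J') * h
    have hU : ∀ᶠ s in 𝓝 s₀, ∀ J ∈ vtxSet A S, (1 - s₀) * A i (v J) + s₀ * a (v J) ≠ 0 →
        (0 < (1 - s) * A i (v J) + s * a (v J) ↔ 0 < (1 - s₀) * A i (v J) + s₀ * a (v J)) := by
      rw [vtxSet_finite.eventually_all]
      intro J hJ
      have hc : Continuous fun s : ℝ => (1 - s) * A i (v J) + s * a (v J) := by fun_prop
      by_cases hne : (1 - s₀) * A i (v J) + s₀ * a (v J) = 0
      · exact Eventually.of_forall fun s h => absurd hne h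
      rcases lt_or_gt_of_ne hne with h | h
      · filter_upwards [hc.continuousAt.eventually (gt_mem_nhds h)] with s hs _
        exact ⟨fun h' => absurd h' (not_lt.2 hs.le), fun h' => absurd h' (not_lt.2 h.le)⟩
      · filter_upwards [hc.continuousAt.eventually (lt_mem_nhds h)] with s hs _
        exact ⟨fun _ => h, fun _ => hs⟩
    refine ⟨_, hU, fun s hs s' hs' hsG hsG' hQ => ?_⟩
    have hAB : ∀ l ∈ S, shiftAt A i (a - A i) s l = shiftAt A i (a - A i) s' l := fun l hl => by
      rw [← hagr s l hl, hagr s' l hl]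
    obtain ⟨J₀, hJ₀, hJ₀'⟩ : ∃ J₀ ∈ vtxSet A S, ∀ J ∈ vtxSet A S, J ≠ J₀ →
        (1 - s₀) * A i (v J) + s₀ * a (v J) ≠ 0 := by
      by_cases hex : ∃ J₀ ∈ vtxSet A S, (1 - s₀) * A i (v J₀) + s₀ * a (v J₀) = 0
      · obtain ⟨J₀, hJ₀, h⟩ := hex
        exact ⟨J₀, hJ₀, fun J hJ hne h' => hne (huniq J hJ J₀ hJ₀ h' h)⟩
      · exact ⟨I, hIV, fun J hJ _ h => hex ⟨J, hJ, h⟩⟩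
    refine hgap _ hsG'.2 (hIrr s' hsG'.1) (fDiamLE_cutFam hi hS (by omega) hAB hsG.2 hsG'.2
      (hIrr s' hsG'.1) (J₀ := J₀) (v := v) ?_ ?_ ?_ hQ)
    · rw [← vtxSet_congr (hagr s)]; exact hJ₀
    · intro J hJ
      rw [← vtxSet_congr (hagr s)] at hJ
      exact (wit_congr (hagr s) hJ.1).1 (hv J hJ)
    · intro J hJ hne
      rw [← vtxSet_congr (hagr s)] at hJ
      rw [hval, hval, hs J hJ (hJ₀' J hJ hne), hs' J hJ (hJ₀' J hJ hne)]

end Moves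

/-! ### Iterated truncations of a simplex and the intermediate value argument -/

section IntermediateDiameter

variable {ι : Type*} {E : Type*} [NormedAddCommGroup E] [NormedSpace ℝ E]
  [FiniteDimensional ℝ E] [DecidableEq ι] {A : ι → E →L[ℝ] ℝ} {S : Finset ι} {i : ι}

/-- The segment ends at a truncation at some `J`, whereas the given one is at `I`. They are compared
through the configuration on `S`: undoing the truncation at `I` keeps the bound, truncating at `J`
adds one, and `hgap` removes it. -/
theorem FDiamLE.of_update (hi : i ∉ S) (hA : Gen A (insert i S)) (hI : Irred A (insert i S))
    (hS : finrank ℝ E ≤ S.card) (hfin : 3 ≤ finrank ℝ E) {K : ℕ}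
    (hgap : ∀ B : ι → E →L[ℝ] ℝ, Gen B (insert i S) → Irred B (insert i S) →
      FDiamLE (vtxSet B (insert i S)) (K + 1) → FDiamLE (vtxSet B (insert i S)) K)
    {a : E →L[ℝ] ℝ} {I : Finset ι} (ha : Gen (Function.update A i a) (insert i S))
    (hT : TruncAt (Function.update A i a) S i I)
    (hk : FDiamLE (vtxSet (Function.update A i a) (insert i S)) K) :
    FDiamLE (vtxSet A (insert i S)) K := by
  obtain ⟨b, J, hb, hbT, h⟩ := exists_truncation hi hA hI hS hfin hgap
  have agree : ∀ c : E →L[ℝ] ℝ, ∀ l ∈ S, A l = Function.update A i c l := fun c l hl =>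
    (Function.update_of_ne (by rintro rfl; exact hi hl) _ _).symm
  refine h (hgap _ hb (hbT.irred hb hS hfin ?_) (hbT.fDiamLE hi hb hS ?_))
  · exact (hI.subset (Finset.subset_insert i S)).congr (agree b)
  · rw [← vtxSet_congr (agree b), vtxSet_congr (agree a)]
    exact hT.fDiamLE_of_insert hi ha hS (by omega) hk

/-- The constraints in the list cut off, starting from its end, one vertex each of the polytope
given by `U` and the previous constraints. -/
def Tower (A : ι → E →L[ℝ] ℝ) (U : Finset ι) : List ι → Prop
  | [] => True
  | m :: L => (m ∉ U ∪ L.toFinset ∧ ∃ I, TruncAt A (U ∪ L.toFinset) m I) ∧ Tower A U L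

theorem Tower.notMem {U : Finset ι} {L : List ι} (h : Tower A U L) {x : ι} (hx : x ∈ L) :
    x ∉ U := by
  induction L with
  | nil => simp at hx
  | cons m L ih =>
    rcases List.mem_cons.1 hx with rfl | hx
    · exact fun hU => h.1.1 (Finset.mem_union_left _ hU)
    · exact ih h.2 hx

theorem Tower.congr {B : ι → E →L[ℝ] ℝ} {U : Finset ι} {L : List ι} (h : Tower A U L)
    (hAB : ∀ l ∈ U ∪ L.toFinset, A l = B l) : Tower B U L := by
  induction L with
  | nil => trivial
  | cons m L ih =>
    have hsub : ∀ l ∈ U ∪ L.toFinset, A l = B l := fun l hl => hAB l (by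
      simp only [List.toFinset_cons, Finset.mem_union, Finset.mem_insert] at hl ⊢
      tauto)
    obtain ⟨⟨h1, I, hI⟩, h2⟩ := h
    exact ⟨⟨h1, I, hI.congr hsub (hAB m (by simp))⟩, ih h2 hsub⟩

/-- The vertices of the base simplex are pairwise adjacent, which accounts for the one; each
truncation adds at most one. -/
theorem Tower.fDiamLE {U : Finset ι} (hU : U.card = finrank ℝ E) {L : List ι}
    (h : Tower A U L) (hA : Gen A (U ∪ L.toFinset)) :
    FDiamLE (vtxSet A (U ∪ L.toFinset)) (L.length + 1) := by
  induction L with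
  | nil =>
    intro I hI J hJ
    simp only [List.toFinset_nil, Finset.union_empty] at hI hJ ⊢
    have sub : ∀ K ∈ vtxSet A U, ∃ j ∈ U, K = U.erase j := by
      intro K hK
      have : (U \ K).card = 1 := by
        have := Finset.card_sdiff_add_card_eq_card hK.1
        have := hK.2.1
        omega
      obtain ⟨j, hj⟩ := Finset.card_eq_one.1 this
      have hj' : ∀ x, (x ∈ U ∧ x ∉ K) ↔ x = j := fun x => by
        rw [← Finset.mem_sdiff, hj, Finset.mem_singleton]
      refine ⟨j, ((hj' j).2 rfl).1, ?_⟩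
      ext x
      have := hj' x
      have := @hK.1 x
      simp
      tauto
    obtain ⟨a, ha, rfl⟩ := sub I hI
    obtain ⟨b, hb, rfl⟩ := sub J hJ
    refine StepReach.single ?_
    by_cases hab : a = b
    · exact Or.inl (by rw [hab])
    · exact Or.inr ⟨hI, hJ, fAdj_erase ha hb hab⟩
  | cons m L ih =>
    obtain ⟨⟨h1, I, hI⟩, h2⟩ := h
    have e : U ∪ (m :: L).toFinset = insert m (U ∪ L.toFinset) := by
      rw [List.toFinset_cons, Finset.union_insert]
    rw [e] at hA ⊢
    exact hI.fDiamLE h1 hA (by rw [← hU]; exact Finset.card_le_card Finset.subset_union_left)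
      (ih h2 (hA.subset (Finset.subset_insert _ _)))

/-- Induction on the number of constraints outside the simplex `B₀` that are still to be moved; `L`
lists those already moved. Each is moved to cut off a vertex contained in `B₀ ∪ L.toFinset`, which
is thus a vertex for every admissible `U'`. Requiring the tower over all `U'` lets earlier
truncations survive later moves. At the end the tower bound is `K + 1`, which `hgap` improves to
`K`. -/
theorem fDiamLE_of_tower (hfin : 3 ≤ finrank ℝ E) {K : ℕ} (hK : K + finrank ℝ E = S.card)
    (hgap : ∀ B : ι → E →L[ℝ] ℝ, Gen B S → Irred B S →
      FDiamLE (vtxSet B S) (K + 1) → FDiamLE (vtxSet B S) K)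
    {B₀ : Finset ι} (hB₀ : B₀.card = finrank ℝ E) (n : ℕ) :
    ∀ (U : Finset ι) (L : List ι) (A : ι → E →L[ℝ] ℝ), U.card = finrank ℝ E + n → B₀ ⊆ U →
      U ∪ L.toFinset = S → U.card + L.length = S.card →
      (∀ U', B₀ ⊆ U' → U' ⊆ U → Tower A U' L) → Gen A S → Irred A S →
      (∃ I ∈ vtxSet A S, I ⊆ B₀ ∪ L.toFinset) → FDiamLE (vtxSet A S) K := by
  induction n with
  | zero =>
    intro U L A hUc hBU hUL hc hT hA hI hex
    obtain rfl : B₀ = U := Finset.eq_of_subset_of_card_le hBU (by omega)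
    subst hUL
    have := (hT B₀ subset_rfl subset_rfl).fDiamLE hB₀ hA
    refine hgap A hA hI (this.mono (by omega))
  | succ n ih =>
    intro U L A hUc hBU hUL hc hT hA hI hex
    obtain ⟨m, hmU, hmB⟩ := Finset.exists_mem_notMem_of_card_lt_card
      (show B₀.card < U.card by omega)
    obtain ⟨I, hIV, hIB⟩ := hex
    have hmL : m ∉ L.toFinset := fun h =>
      (hT U hBU subset_rfl).notMem (List.mem_toFinset.1 h) hmU
    have hsub : ∀ U', U' ⊆ U.erase m → m ∉ U' ∪ L.toFinset := fun U' hU' h => by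
      rcases Finset.mem_union.1 h with h | h
      · exact (Finset.notMem_erase m U) (hU' h)
      · exact hmL h
    set S₀ := U.erase m ∪ L.toFinset with hS₀
    have hmS₀ : m ∉ S₀ := hsub _ subset_rfl
    have hS : S = insert m S₀ := by
      rw [hS₀, ← Finset.insert_union, Finset.insert_erase hmU, hUL]
    have hS₀S : S₀ ⊆ S := hS ▸ Finset.subset_insert _ _
    have hS₀c : finrank ℝ E ≤ S₀.card := by
      have := congrArg Finset.card hS
      rw [Finset.card_insert_of_notMem hmS₀] at this
      omega
    have hAS₀ := hA.subset hS₀S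
    have hIS₀ : I ⊆ S₀ := hIB.trans (Finset.union_subset_union_left
      fun x hx => Finset.mem_erase.2 ⟨by rintro rfl; exact hmB hx, hBU hx⟩)
    obtain ⟨y, hy⟩ := hIV.2.2
    have hIV₀ := vtxSet_subset hS₀S hIS₀ hIV
    obtain ⟨p, hp, hpI⟩ := vtxSet_exists_notMem hS₀c hIV₀
    choose! v hv using fun (X : Finset ι) (J : Finset ι) (hJ : J ∈ vtxSet A X) => hJ.2.2
    choose! k hk0 hk using fun J (hJ : J ⊆ S₀ ∧ J.card + 1 = finrank ℝ E) =>
      exists_ker (A := A) (J := J) (by omega)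
    obtain ⟨a, haI, hapos, hane⟩ := exists_functional (y₀ := y) (a₀ := ∑ j ∈ I, A j)
      (φ := -A p)
      -- Positivity is imposed at the other vertices of all subconfigurations containing `I`, so
      -- that one functional truncates each of the needed ones at `I`.
      (P := ⋃ X ∈ {X | X ⊆ S ∧ I ⊆ X}, v X '' {J | J ∈ vtxSet A X ∧ J ≠ I})
      (Q := k '' {J | J ⊆ S₀ ∧ J.card + 1 = finrank ℝ E})
      (by simpa using hy.2 p (hS₀S hp) hpI)
      (by rw [sum_apply]; exact Finset.sum_eq_zero hy.1)
      (Set.Finite.biUnion (S.powerset.finite_toSet.subset fun X hX =>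
        Finset.mem_coe.2 (Finset.mem_powerset.2 hX.1))
        fun X _ => (vtxSet_finite.subset fun _ h => h.1).image _)
      (by
        intro z hz
        simp only [Set.mem_iUnion] at hz
        obtain ⟨X, ⟨-, hIX⟩, J, ⟨hJ, hJI⟩, rfl⟩ := hz
        rw [sum_apply]
        have : ∃ j ∈ I, j ∉ J := by
          by_contra hcon
          push Not at hcon
          exact hJI (Finset.eq_of_subset_of_card_le hcon
            (by have := hIV.2.1; have := hJ.2.1; omega)).symm
        obtain ⟨j, hj, hjJ⟩ := this
        exact Finset.sum_pos' (fun m hm => (hv X J hJ).nonneg (hIX hm))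
          ⟨j, hj, (hv X J hJ).2 j (hIX hj) hjJ⟩)
      ((S₀.powerset.finite_toSet.subset fun J hJ =>
        Finset.mem_coe.2 (Finset.mem_powerset.2 hJ.1)).image _)
      (by rintro _ ⟨J, hJ, rfl⟩; exact hk0 J hJ)
    have agree : ∀ X : Finset ι, m ∉ X → ∀ l ∈ X, A l = Function.update A m a l := fun X hX l hl =>
      (Function.update_of_ne (by rintro rfl; exact hX hl) _ _).symm
    have hself : Function.update A m a m = a := by simp
    have hGen : Gen (Function.update A m a) (insert m S₀) := by
      refine (hAS₀.congr (agree _ hmS₀)).insert_of_ne hS₀c (k := k)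
        (fun J hJ hc => ⟨hk0 J ⟨hJ, hc⟩, fun l hl => ?_⟩) fun J hJ hc => ?_
      · rw [← agree _ hmS₀ l (hJ hl)]; exact hk J ⟨hJ, hc⟩ l hl
      · rw [hself]; exact hane _ ⟨J, ⟨hJ, hc⟩, rfl⟩
    have htr : ∀ U', B₀ ⊆ U' → U' ⊆ U.erase m →
        TruncAt (Function.update A m a) (U' ∪ L.toFinset) m I := by
      intro U' hBU' hU'
      have hm := hsub U' hU'
      have hIX : I ⊆ U' ∪ L.toFinset := hIB.trans (Finset.union_subset_union_left hBU')
      have hXS : U' ∪ L.toFinset ⊆ S :=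
        (Finset.union_subset_union_left hU').trans hS₀S
      have hIVX := vtxSet_subset hXS hIX hIV
      refine ⟨by rwa [← vtxSet_congr (agree _ hm)], ⟨y, (wit_congr (agree _ hm) hIX).1
        (hy.subset hXS), by rwa [hself]⟩, fun J hJ hJI => ?_⟩
      rw [← vtxSet_congr (agree _ hm)] at hJ
      refine ⟨v _ J, (wit_congr (agree _ hm) hJ.1).1 (hv _ J hJ), ?_⟩
      rw [hself]
      refine hapos _ ?_
      simp only [Set.mem_iUnion]
      exact ⟨U' ∪ L.toFinset, ⟨hXS, hIX⟩, J, ⟨hJ, hJI⟩, rfl⟩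
    have hBm : B₀ ⊆ U.erase m := fun x hx =>
      Finset.mem_erase.2 ⟨by rintro rfl; exact hmB hx, hBU hx⟩
    have htr₀ := htr _ hBm subset_rfl
    rw [← hS₀] at htr₀
    have hIrr : Irred (Function.update A m a) S := by
      rw [hS]
      exact htr₀.irred hGen hS₀c hfin ((hI.subset hS₀S).congr (agree _ hmS₀))
    have hUe := Finset.card_erase_add_one hmU
    have hnew : FDiamLE (vtxSet (Function.update A m a) S) K := by
      refine ih (U.erase m) (m :: L) _ (by omega) hBm ?_ ?_ ?_ (hS ▸ hGen) hIrr ?_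
      · rw [List.toFinset_cons, Finset.union_insert, ← hS₀, hS]
      · rw [List.length_cons]; omega
      · intro U' h1 h2
        exact ⟨⟨hsub U' h2, I, htr U' h1 h2⟩,
          (hT U' h1 (h2.trans (Finset.erase_subset _ _))).congr (agree _ (hsub U' h2))⟩
      · obtain ⟨j, hj⟩ : I.Nonempty := Finset.card_pos.1 (by have := hIV.2.1; omega)
        refine ⟨insert m (I.erase j), hS ▸ htr₀.insert_erase_mem hmS₀ hGen hS₀c hj, ?_⟩
        rw [List.toFinset_cons, Finset.union_insert]
        exact Finset.insert_subset_insert _ ((Finset.erase_subset _ _).trans hIB)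
    subst hS
    exact FDiamLE.of_update hmS₀ hA hI hS₀c hfin hgap hGen htr₀ hnew

/-- If a generic irredundant configuration has diameter at least `K + 1`, where
`K + finrank ℝ E` is the number of constraints, then some such configuration has diameter
exactly `K + 1`. -/
theorem exists_diam_eq (hfin : 3 ≤ finrank ℝ E) {K : ℕ} (hK : K + finrank ℝ E = S.card)
    (hA : Gen A S) (hI : Irred A S) (hd : ¬ FDiamLE (vtxSet A S) K) :
    ∃ B : ι → E →L[ℝ] ℝ, Gen B S ∧ Irred B S ∧ FDiamLE (vtxSet B S) (K + 1) ∧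
      ¬ FDiamLE (vtxSet B S) K := by
  by_contra hcon
  push Not at hcon
  obtain ⟨I, hIV⟩ : ∃ I, I ∈ vtxSet A S := by
    by_contra h
    push Not at h
    exact hd fun I hI => absurd hI (h I)
  obtain ⟨l, hl, hlI⟩ := vtxSet_exists_notMem (by omega) hIV
  refine hd (fDiamLE_of_tower (B₀ := insert l I) hfin hK hcon ?_ (S.card - finrank ℝ E) S [] A
    (by omega) (Finset.insert_subset hl hIV.1) (by simp) (by simp) (fun _ _ _ => trivial) hA hI
    ⟨I, hIV, ?_⟩)
  · rw [Finset.card_insert_of_notMem hlI, hIV.2.1]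
  · simp

end IntermediateDiameter

/-! ### From simple configurations to general position -/

section Perturbation

variable {ι : Type*} {E : Type*} [NormedAddCommGroup E] [NormedSpace ℝ E]
  {A : ι → E →L[ℝ] ℝ} {S : Finset ι} {i : ι}

/-- Linear independence of the functionals `A l`, `l ∈ J`, in terms of a dual family. -/
def DInd (A : ι → E →L[ℝ] ℝ) (J : Finset ι) : Prop :=
  ∀ l ∈ J, ∃ w, A l w ≠ 0 ∧ ∀ m ∈ J, m ≠ l → A m w = 0

/-- The tight constraints at every non-zero point of the cone are linearly independent. -/
def SimpleConfig (A : ι → E →L[ℝ] ℝ) (S : Finset ι) : Prop :=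
  ∀ y : E, y ≠ 0 → (∀ l ∈ S, 0 ≤ A l y) → DInd A (S.filter (fun l => A l y = 0))

theorem DInd.subset {J J' : Finset ι} (h : DInd A J) (hJ : J' ⊆ J) : DInd A J' := by
  intro l hl
  obtain ⟨w, h1, h2⟩ := h l (hJ hl)
  exact ⟨w, h1, fun m hm => h2 m (hJ hm)⟩

theorem DInd.congr {B : ι → E →L[ℝ] ℝ} {J : Finset ι} (hAB : ∀ l ∈ J, A l = B l)
    (h : DInd A J) : DInd B J := by
  intro l hl
  obtain ⟨w, h1, h2⟩ := h l hl
  exact ⟨w, by rwa [← hAB l hl], fun m hm hml => by rw [← hAB m hm]; exact h2 m hm hml⟩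

theorem DInd.card_lt [FiniteDimensional ℝ E] {J : Finset ι} (h : DInd A J) {y : E} (hy : y ≠ 0)
    (hyJ : ∀ l ∈ J, A l y = 0) : J.card + 1 ≤ finrank ℝ E := by
  classical
  let f : E →ₗ[ℝ] (J → ℝ) := LinearMap.pi fun i => (A i).toLinearMap
  choose! w hw hw' using h
  have hsurj : Function.Surjective f := by
    intro g
    refine ⟨∑ l : J, (g l / A l (w l)) • w l, ?_⟩
    ext m
    change A m (∑ l : J, (g l / A l (w l)) • w l) = g m
    rw [map_sum, Finset.sum_eq_single m]
    · rw [map_smul, smul_eq_mul, div_mul_cancel₀ _ (hw m m.2)]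
    · intro l _ hlm
      rw [map_smul, hw' l l.2 m m.2 fun h => hlm (Subtype.ext h.symm), smul_zero]
    · exact fun h => absurd (Finset.mem_univ _) h
  have h1 := f.finrank_range_add_finrank_ker
  rw [LinearMap.range_eq_top.2 hsurj, finrank_top] at h1
  have h2 : 0 < finrank ℝ f.ker := by
    exact finrank_pos_iff_exists_ne_zero.2 ⟨⟨y, LinearMap.mem_ker.2 (funext fun l => hyJ l l.2)⟩,
      fun h => hy (congrArg Subtype.val h)⟩
  have h3 : finrank ℝ (J → ℝ) = J.card := by simp
  omega

theorem SimpleConfig.card_tight [FiniteDimensional ℝ E] (hA : SimpleConfig A S) (y : E)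
    (hy : y ≠ 0) (hS : ∀ l ∈ S, 0 ≤ A l y) :
    (S.filter (fun l => A l y = 0)).card + 1 ≤ finrank ℝ E :=
  (hA y hy hS).card_lt hy fun _ hl => (Finset.mem_filter.1 hl).2

variable [DecidableEq ι]

/-- `w` is dual to `i`, and subtracting multiples of it clears the values at `i` of the old dual
vectors. -/
theorem DInd.insert_of_ker {J : Finset ι} (h : DInd A J) {w : E} (hw : ∀ l ∈ J, A l w = 0)
    (hwi : A i w ≠ 0) : DInd A (insert i J) := by
  intro l hl
  rcases Finset.mem_insert.1 hl with rfl | hlJ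
  · exact ⟨w, hwi, fun m hm hml => hw m ((Finset.mem_insert.1 hm).resolve_left hml)⟩
  · obtain ⟨v, hv, hv'⟩ := h l hlJ
    refine ⟨v - (A i v / A i w) • w, by simpa [hw l hlJ] using hv, fun m hm hml => ?_⟩
    rcases Finset.mem_insert.1 hm with rfl | hm
    · simp; field_simp; simp
    · simp [hw m hm, hv' m hm hml]

theorem continuous_eval (y : E) : Continuous fun a : E →L[ℝ] ℝ => a y := by fun_prop

theorem DInd.eventually_update {J : Finset ι} (h : DInd A J) :
    ∀ᶠ a in 𝓝 (A i), DInd (Function.update A i a) J := by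
  have agree : ∀ a : E →L[ℝ] ℝ, ∀ l, l ≠ i → A l = Function.update A i a l := fun a l hl =>
    (Function.update_of_ne hl _ _).symm
  by_cases hi : i ∈ J
  · obtain ⟨w, hw, hw'⟩ := h i hi
    filter_upwards [(continuous_eval w).continuousAt.eventually_ne hw] with a ha
    rw [← Finset.insert_erase hi]
    refine DInd.insert_of_ker (w := w) ((h.subset (Finset.erase_subset i J)).congr
      fun l hl => agree a l (Finset.ne_of_mem_erase hl)) (fun l hl => ?_) (by simpa using ha)
    rw [← agree a l (Finset.ne_of_mem_erase hl)]
    exact hw' l (Finset.mem_of_mem_erase hl) (Finset.ne_of_mem_erase hl)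
  · exact Eventually.of_forall fun a => h.congr fun l hl => agree a l (by rintro rfl; exact hi hl)

/-- A zero of `A i` can be followed when `A i` is perturbed. -/
theorem eventually_correct {z w : E} (hz : A i z = 0) (hw : A i w ≠ 0) {L : Finset ι}
    (hL : ∀ l ∈ L, 0 < A l z) :
    ∀ᶠ a in 𝓝 (A i), a (z - (a z / a w) • w) = 0 ∧ ∀ l ∈ L, 0 < A l (z - (a z / a w) • w) := by
  refine Eventually.and ?_ ((L.eventually_all).2 fun l hl => ?_)
  · filter_upwards [(continuous_eval w).continuousAt.eventually_ne hw] with a ha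
    rw [map_sub, map_smul, smul_eq_mul, div_mul_cancel₀ _ ha, sub_self]
  · have hc : ContinuousAt (fun a : E →L[ℝ] ℝ => A l (z - (a z / a w) • w)) (A i) := by
      have h1 : ContinuousAt (fun a : E →L[ℝ] ℝ => a z / a w) (A i) :=
        (continuous_eval z).continuousAt.div (continuous_eval w).continuousAt hw
      exact (A l).continuous.continuousAt.comp
        (continuousAt_const.sub (h1.smul continuousAt_const))
    refine hc.eventually (lt_mem_nhds ?_)
    simpa [hz] using hL l hl

theorem Irred.eventually_update (hI : Irred A S) (hS : 2 ≤ S.card) (hi : i ∈ S) :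
    ∀ᶠ a in 𝓝 (A i), Irred (Function.update A i a) S := by
  have agree : ∀ a : E →L[ℝ] ℝ, ∀ l, l ≠ i → Function.update A i a l = A l := fun a l hl =>
    Function.update_of_ne hl _ _
  refine (S.eventually_all).2 fun l hl => ?_
  obtain ⟨z, hz, hz'⟩ := hI l hl
  by_cases hli : l = i
  · subst hli
    obtain ⟨m, hm, hml⟩ := Finset.exists_mem_ne (show 1 < S.card by omega) l
    obtain ⟨w, -, hw⟩ := hI m hm
    filter_upwards [eventually_correct hz (hw l hl hml.symm).ne' (L := S.erase l)
      fun m hm => hz' m (Finset.mem_of_mem_erase hm) (Finset.ne_of_mem_erase hm)] with a ha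
    refine ⟨z - (a z / a w) • w, by rw [Function.update_self]; exact ha.1, fun m hm hml => ?_⟩
    rw [agree a m hml]
    exact ha.2 m (Finset.mem_erase.2 ⟨hml, hm⟩)
  · filter_upwards [(continuous_eval z).continuousAt.eventually
      (lt_mem_nhds (hz' i hi (Ne.symm hli)))] with a ha
    refine ⟨z, by rw [agree a l hli]; exact hz, fun m hm hml => ?_⟩
    by_cases hmi : m = i
    · subst hmi; simpa using ha
    · rw [agree a m hmi]; exact hz' m hm hml

variable [FiniteDimensional ℝ E]

/-- Near a point `y₀` of the cone only constraints tight at `y₀` can be tight, and their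
independence is an open condition; near a point outside, some constraint stays violated. Compactness
of the unit sphere makes this uniform, and scaling covers all `y ≠ 0`. -/
theorem SimpleConfig.eventually_tight (hA : SimpleConfig A S) (hi : i ∈ S) :
    ∀ᶠ a in 𝓝 (A i), ∀ y : E, y ≠ 0 → (∀ l ∈ S, 0 ≤ Function.update A i a l y) →
      ∃ y₀, y₀ ≠ 0 ∧ (∀ l ∈ S, 0 ≤ A l y₀) ∧
        S.filter (fun l => Function.update A i a l y = 0) ⊆ S.filter (fun l => A l y₀ = 0) ∧
        DInd (Function.update A i a) (S.filter (fun l => A l y₀ = 0)) := by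
  have key : ∀ᶠ a in 𝓝 (A i), ∀ y ∈ Metric.sphere (0 : E) 1,
      (∀ l ∈ S, 0 ≤ Function.update A i a l y) →
      ∃ y₀, y₀ ≠ 0 ∧ (∀ l ∈ S, 0 ≤ A l y₀) ∧
        S.filter (fun l => Function.update A i a l y = 0) ⊆ S.filter (fun l => A l y₀ = 0) ∧
        DInd (Function.update A i a) (S.filter (fun l => A l y₀ = 0)) := by
    refine (isCompact_sphere (0 : E) 1).eventually_forall_of_forall_eventually fun y₀ hy₀ => ?_
    have hy₀0 : y₀ ≠ 0 := by
      rintro rfl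
      simp at hy₀
    have hcont : ∀ l, ContinuousAt
        (fun p : (E →L[ℝ] ℝ) × E => Function.update A i p.1 l p.2) (A i, y₀) := by
      intro l
      by_cases hl : l = i
      · subst hl
        simp only [Function.update_self]
        exact (continuous_fst.clm_apply continuous_snd).continuousAt
      · simp only [Function.update_of_ne hl]
        exact ((A l).continuous.comp continuous_snd).continuousAt
    by_cases hneg : ∃ l ∈ S, A l y₀ < 0
    · obtain ⟨l, hl, hlt⟩ := hneg
      have := (hcont l).eventually (gt_mem_nhds (show Function.update A i (A i) l y₀ < 0 by
        simpa using hlt))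
      filter_upwards [this] with p hp h
      exact absurd (h l hl) (not_le.2 hp)
    · push Not at hneg
      have h1 : ∀ᶠ p : (E →L[ℝ] ℝ) × E in 𝓝 (A i, y₀), ∀ l ∈ S, A l y₀ ≠ 0 →
          0 < Function.update A i p.1 l p.2 := by
        refine (S.eventually_all).2 fun l hl => ?_
        by_cases h0 : A l y₀ = 0
        · exact Eventually.of_forall fun p h => absurd h0 h
        · filter_upwards [(hcont l).eventually (lt_mem_nhds
            (show 0 < Function.update A i (A i) l y₀ by
              simpa using (hneg l hl).lt_of_ne (Ne.symm h0)))] with p hp _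
          exact hp
      have h2 : ∀ᶠ p : (E →L[ℝ] ℝ) × E in 𝓝 (A i, y₀),
          DInd (Function.update A i p.1) (S.filter (fun l => A l y₀ = 0)) :=
        (continuous_fst.tendsto (A i, y₀)).eventually
          (hA y₀ hy₀0 hneg).eventually_update
      filter_upwards [h1, h2] with p hp1 hp2 _
      refine ⟨y₀, hy₀0, hneg, fun l hl => ?_, hp2⟩
      rw [Finset.mem_filter] at hl ⊢
      refine ⟨hl.1, ?_⟩
      by_contra h0
      exact (hp1 l hl.1 h0).ne' hl.2
  filter_upwards [key] with a ha y hy hnn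
  have hn : 0 < ‖y‖ := norm_pos_iff.2 hy
  obtain ⟨y₀, h1, h2, h3, h4⟩ := ha (‖y‖⁻¹ • y) (by simp [norm_smul, hn.ne'])
    (fun l hl => by
      rw [map_smul, smul_eq_mul]; exact mul_nonneg (inv_nonneg.2 hn.le) (hnn l hl))
  refine ⟨y₀, h1, h2, fun l hl => h3 ?_, h4⟩
  rw [Finset.mem_filter] at hl ⊢
  exact ⟨hl.1, by rw [map_smul, hl.2, smul_zero]⟩

theorem Wit.filter_eq {I : Finset ι} {y : E} (hy : Wit A S I y) (hI : I ⊆ S) :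
    S.filter (fun l => A l y = 0) = I := by
  ext l
  rw [Finset.mem_filter]
  constructor
  · rintro ⟨hl, h0⟩
    by_contra hlI
    exact (hy.2 l hl hlI).ne' h0
  · exact fun hl => ⟨hI hl, hy.1 l hl⟩

theorem wit_filter {y : E} (hy : ∀ l ∈ S, 0 ≤ A l y) :
    Wit A S (S.filter (fun l => A l y = 0)) y := by
  refine ⟨fun i hi => (Finset.mem_filter.1 hi).2, fun l hl hlI => ?_⟩
  exact (hy l hl).lt_of_ne fun h => hlI (Finset.mem_filter.2 ⟨hl, h.symm⟩)

theorem Wit.ne_zero (hS : finrank ℝ E ≤ S.card) {I : Finset ι} (hI : I ∈ vtxSet A S) {y : E}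
    (hy : Wit A S I y) : y ≠ 0 := by
  obtain ⟨l, hl, hlI⟩ := vtxSet_exists_notMem hS hI
  rintro rfl
  simpa using hy.2 l hl hlI

/-- Old vertices persist because their zeros can be followed. The tight set of a new vertex is
contained in that of some old point, and the cardinality bound makes them equal, so no vertex is
created. -/
theorem SimpleConfig.eventually_update (hA : SimpleConfig A S) (hS : finrank ℝ E ≤ S.card)
    (hi : i ∈ S) : ∀ᶠ a in 𝓝 (A i), SimpleConfig (Function.update A i a) S ∧
      vtxSet (Function.update A i a) S = vtxSet A S := by
  have agree : ∀ a : E →L[ℝ] ℝ, ∀ l, l ≠ i → Function.update A i a l = A l := fun a l hl =>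
    Function.update_of_ne hl _ _
  have hsup : ∀ᶠ a in 𝓝 (A i), ∀ I ∈ vtxSet A S, I ∈ vtxSet (Function.update A i a) S := by
    rw [vtxSet_finite.eventually_all]
    intro I hI
    obtain ⟨hIS, hc, y, hy⟩ := id hI
    have hD := hA y (hy.ne_zero hS hI) fun l hl => hy.nonneg hl
    rw [hy.filter_eq hIS] at hD
    by_cases hiI : i ∈ I
    · obtain ⟨w, hw, hw'⟩ := hD i hiI
      filter_upwards [eventually_correct (hy.1 i hiI) hw (L := S \ I) fun l hl => by
        rw [Finset.mem_sdiff] at hl; exact hy.2 l hl.1 hl.2] with a ha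
      refine ⟨hIS, hc, y - (a y / a w) • w, fun m hm => ?_, fun l hl hlI => ?_⟩
      · by_cases hmi : m = i
        · subst hmi; rw [Function.update_self]; exact ha.1
        · rw [agree a m hmi]; simp [hy.1 m hm, hw' m hm hmi]
      · rw [agree a l (by rintro rfl; exact hlI hiI)]
        exact ha.2 l (Finset.mem_sdiff.2 ⟨hl, hlI⟩)
    · filter_upwards [(continuous_eval y).continuousAt.eventually
        (lt_mem_nhds (hy.2 i hi hiI))] with a ha
      refine ⟨hIS, hc, y, fun m hm => ?_, fun l hl hlI => ?_⟩
      · rw [agree a m (by rintro rfl; exact hiI hm)]; exact hy.1 m hm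
      · by_cases hli : l = i
        · subst hli; simpa using ha
        · rw [agree a l hli]; exact hy.2 l hl hlI
  filter_upwards [hsup, hA.eventually_tight hi] with a ha1 ha2
  refine ⟨fun y hy hnn => ?_, Set.Subset.antisymm (fun K hK => ?_) ha1⟩
  · obtain ⟨y₀, -, -, h3, h4⟩ := ha2 y hy hnn
    exact h4.subset h3
  · obtain ⟨hKS, hc, y, hy⟩ := id hK
    obtain ⟨y₀, h1, h2, h3, -⟩ := ha2 y (hy.ne_zero hS hK) fun l hl => hy.nonneg hl
    rw [hy.filter_eq hKS] at h3
    have h5 := hA.card_tight y₀ h1 h2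
    have h6 : K = S.filter (fun l => A l y₀ = 0) := Finset.eq_of_subset_of_card_le h3 (by omega)
    exact ⟨hKS, hc, y₀, h6 ▸ wit_filter h2⟩

/-- A simple irredundant configuration can be perturbed to general position without changing
its vertices. -/
theorem SimpleConfig.exists_gen (hA : SimpleConfig A S) (hI : Irred A S)
    (hS : finrank ℝ E ≤ S.card) (hS2 : 2 ≤ S.card) :
    ∃ B : ι → E →L[ℝ] ℝ, Gen B S ∧ Irred B S ∧ vtxSet B S = vtxSet A S := by
  -- The functionals are perturbed one at a time. A functional non-zero at kernel vectors of the
  -- small subsets of `R` extends independence from `R` to `insert i R`.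
  have key : ∀ R ⊆ S, ∃ B : ι → E →L[ℝ] ℝ, SimpleConfig B S ∧ Irred B S ∧
      vtxSet B S = vtxSet A S ∧ ∀ J ⊆ R, J.card ≤ finrank ℝ E → DInd B J := by
    intro R
    induction R using Finset.induction_on with
    | empty =>
      intro _
      refine ⟨A, hA, hI, rfl, fun J hJ _ => ?_⟩
      rw [Finset.subset_empty.1 hJ]
      intro l hl
      simp at hl
    | insert i R hiR ih =>
      intro hR
      obtain ⟨B, hB1, hB2, hB3, hB4⟩ := ih ((Finset.subset_insert _ _).trans hR)
      have hiS := hR (Finset.mem_insert_self i R)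
      choose! k hk0 hk using fun J (hJ : J ⊆ R ∧ J.card < finrank ℝ E) =>
        exists_ker (A := B) (J := J) hJ.2
      obtain ⟨a, ⟨⟨ha1, ha2⟩, ha3⟩, ha4⟩ := exists_generic
        (Q := k '' {J | J ⊆ R ∧ J.card < finrank ℝ E})
        ((R.powerset.finite_toSet.subset fun J hJ =>
          Finset.mem_coe.2 (Finset.mem_powerset.2 hJ.1)).image _)
        (by rintro _ ⟨J, hJ, rfl⟩; exact hk0 J hJ)
        ((hB1.eventually_update hS hiS).and (hB2.eventually_update hS2 hiS))
      refine ⟨_, ha1, ha3, ha2.trans hB3, fun J hJ hc => ?_⟩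
      have agree : ∀ l, l ≠ i → B l = Function.update B i a l := fun l hl =>
        (Function.update_of_ne hl _ _).symm
      by_cases hiJ : i ∈ J
      · have hcJ := Finset.card_erase_add_one hiJ
        have hJe : J.erase i ⊆ R := fun x hx => (Finset.mem_insert.1
          (hJ (Finset.mem_of_mem_erase hx))).resolve_left (Finset.ne_of_mem_erase hx)
        rw [← Finset.insert_erase hiJ]
        refine DInd.insert_of_ker (w := k (J.erase i)) ((hB4 _ hJe (by omega)).congr
          fun l hl => agree l (Finset.ne_of_mem_erase hl)) (fun l hl => ?_) ?_
        · rw [← agree l (Finset.ne_of_mem_erase hl)]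
          exact hk _ ⟨hJe, by omega⟩ l hl
        · simpa using ha4 _ ⟨J.erase i, ⟨hJe, by omega⟩, rfl⟩
      · refine (hB4 J (fun x hx => ?_) hc).congr fun l hl => agree l ?_
        · exact (Finset.mem_insert.1 (hJ hx)).resolve_left (by rintro rfl; exact hiJ hx)
        · rintro rfl; exact hiJ hl
  obtain ⟨B, hB1, hB2, hB3, hB4⟩ := key S subset_rfl
  refine ⟨B, fun T hT hc y hy => ?_, hB2, hB3⟩
  by_contra hy0
  have := (hB4 T hT hc.le).card_lt hy0 hy
  omega

end Perturbation

/-! ### Existence of vertex truncations -/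

section Truncation

variable {ι : Type*} {E : Type*} [NormedAddCommGroup E] [NormedSpace ℝ E]
  [FiniteDimensional ℝ E] [DecidableEq ι] {A : ι → E →L[ℝ] ℝ} {S : Finset ι} {i : ι}

/-- The sum of the functionals in `I` is zero at the vertex `I` and positive at every other one;
tilting it slightly and generically gives the cut. -/
theorem exists_truncAt (hfin : 3 ≤ finrank ℝ E) (hS : finrank ℝ E ≤ S.card) (hA : Gen A S)
    (hI : Irred A S) (hi : i ∉ S) {I : Finset ι} (hIV : I ∈ vtxSet A S) :
    ∃ B : ι → E →L[ℝ] ℝ, vtxSet B S = vtxSet A S ∧ Gen B (insert i S) ∧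
      Irred B (insert i S) ∧ TruncAt B S i I := by
  obtain ⟨y, hy⟩ := hIV.2.2
  obtain ⟨p, hp, hpI⟩ := vtxSet_exists_notMem hS hIV
  choose! v hv using fun (J : Finset ι) (hJ : J ∈ vtxSet A S) => hJ.2.2
  choose! k hk0 hk using fun J (hJ : J ⊆ S ∧ J.card + 1 = finrank ℝ E) =>
    exists_ker (A := A) (J := J) (by omega)
  obtain ⟨a, haI, hapos, hane⟩ := exists_functional (y₀ := y) (a₀ := ∑ j ∈ I, A j)
    (φ := -A p) (P := v '' {J | J ∈ vtxSet A S ∧ J ≠ I})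
    (Q := k '' {J | J ⊆ S ∧ J.card + 1 = finrank ℝ E})
    (by simpa using hy.2 p hp hpI)
    (by rw [sum_apply]; exact Finset.sum_eq_zero hy.1)
    ((vtxSet_finite.subset fun _ h => h.1).image _)
    (by
      rintro _ ⟨J, ⟨hJ, hJI⟩, rfl⟩
      rw [sum_apply]
      have : ∃ j ∈ I, j ∉ J := by
        by_contra hcon
        push Not at hcon
        exact hJI (Finset.eq_of_subset_of_card_le hcon
          (by have := hIV.2.1; have := hJ.2.1; omega)).symm
      obtain ⟨j, hj, hjJ⟩ := this
      exact Finset.sum_pos' (fun m hm => (hv J hJ).nonneg (hIV.1 hm))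
        ⟨j, hj, (hv J hJ).2 j (hIV.1 hj) hjJ⟩)
    ((S.powerset.finite_toSet.subset fun J hJ =>
      Finset.mem_coe.2 (Finset.mem_powerset.2 hJ.1)).image _)
    (by rintro _ ⟨J, hJ, rfl⟩; exact hk0 J hJ)
  have agree : ∀ l ∈ S, A l = Function.update A i a l := fun l hl =>
    (Function.update_of_ne (by rintro rfl; exact hi hl) _ _).symm
  have hself : Function.update A i a i = a := by simp
  have hGen : Gen (Function.update A i a) (insert i S) := by
    refine (hA.congr agree).insert_of_ne hS (k := k)
      (fun J hJ hc => ⟨hk0 J ⟨hJ, hc⟩, fun l hl => ?_⟩) fun J hJ hc => ?_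
    · rw [← agree l (hJ hl)]; exact hk J ⟨hJ, hc⟩ l hl
    · rw [hself]; exact hane _ ⟨J, ⟨hJ, hc⟩, rfl⟩
  have htr : TruncAt (Function.update A i a) S i I := by
    refine ⟨by rwa [← vtxSet_congr agree], ⟨y, (wit_congr agree hIV.1).1 hy, by rwa [hself]⟩,
      fun J hJ hJI => ?_⟩
    rw [← vtxSet_congr agree] at hJ
    exact ⟨v J, (wit_congr agree hJ.1).1 (hv J hJ), by rw [hself]; exact hapos _ ⟨J, ⟨hJ, hJI⟩, rfl⟩⟩
  exact ⟨_, (vtxSet_congr agree).symm, hGen, htr.irred hGen hS hfin (hI.congr agree), htr⟩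

end Truncation

/-! ### Wedges over a facet -/

section Wedge

variable {ι : Type*} {E : Type*} [NormedAddCommGroup E] [NormedSpace ℝ E]
  [DecidableEq ι] {A : ι → E →L[ℝ] ℝ} {S : Finset ι} {f g : ι}

theorem Irred.exists_pos (hA : Irred A S) (hS : 2 ≤ S.card) : ∃ p, ∀ l ∈ S, 0 < A l p := by
  obtain ⟨f, hf⟩ : S.Nonempty := Finset.card_pos.1 (by omega)
  obtain ⟨z, hz, hz'⟩ := hA f hf
  obtain ⟨m, hm, hmf⟩ := Finset.exists_mem_ne (show 1 < S.card by omega) f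
  obtain ⟨w, hw, hw'⟩ := hA m hm
  refine ⟨z + w, fun l hl => ?_⟩
  rw [map_add]
  by_cases hlf : l = f
  · subst hlf; rw [hz]; linarith [hw' l hl hmf.symm]
  · by_cases hlm : l = m
    · subst hlm; rw [hw]; linarith [hz' l hl hmf]
    · linarith [hw' l hl hlm, hz' l hl hlf]

/-- The wedge over the facet `f`: the new facet is `g`. -/
def wedge (A : ι → E →L[ℝ] ℝ) (f g : ι) : ι → E × ℝ →L[ℝ] ℝ :=
  Function.update (Function.update (fun l => (A l).comp (.fst ℝ E ℝ)) f
    ((A f).comp (.fst ℝ E ℝ) - .snd ℝ E ℝ)) g (.snd ℝ E ℝ)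

theorem wedge_new (v : E × ℝ) : wedge A f g g v = v.2 := by simp [wedge]

theorem wedge_self (hfg : f ≠ g) (v : E × ℝ) : wedge A f g f v = A f v.1 - v.2 := by
  simp [wedge, Function.update_of_ne hfg]

theorem wedge_of_ne {l : ι} (hf : l ≠ f) (hg : l ≠ g) (v : E × ℝ) :
    wedge A f g l v = A l v.1 := by
  simp [wedge, Function.update_of_ne hg, Function.update_of_ne hf]

variable (hf : f ∈ S) (hg : g ∉ S)
include hf hg

theorem wedge_nonneg_iff {v : E × ℝ} : (∀ l ∈ insert g S, 0 ≤ wedge A f g l v) ↔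
    0 ≤ v.2 ∧ v.2 ≤ A f v.1 ∧ ∀ l ∈ S, l ≠ f → 0 ≤ A l v.1 := by
  have hfg : f ≠ g := by rintro rfl; exact hg hf
  constructor
  · intro h
    refine ⟨by simpa [wedge_new] using h g (by simp), ?_, fun l hl hlf => ?_⟩
    · have := h f (by simp [hf])
      rw [wedge_self hfg] at this
      linarith
    · have := h l (by simp [hl])
      rwa [wedge_of_ne hlf (by rintro rfl; exact hg hl)] at this
  · rintro ⟨h1, h2, h3⟩ l hl
    by_cases hlg : l = g
    · subst hlg; rwa [wedge_new]
    · have hlS := (Finset.mem_insert.1 hl).resolve_left hlg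
      by_cases hlf : l = f
      · subst hlf; rw [wedge_self hfg]; linarith
      · rw [wedge_of_ne hlf hlg]; exact h3 l hlS hlf

theorem wedge_base {v : E × ℝ} (h : ∀ l ∈ insert g S, 0 ≤ wedge A f g l v) (hv : v ≠ 0) :
    v.1 ≠ 0 ∧ ∀ l ∈ S, 0 ≤ A l v.1 := by
  obtain ⟨h1, h2, h3⟩ := (wedge_nonneg_iff hf hg).1 h
  refine ⟨fun h0 => hv (Prod.ext h0 ?_), fun l hl => ?_⟩
  · rw [h0, map_zero] at h2
    exact le_antisymm h2 h1
  · by_cases hlf : l = f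
    · subst hlf; linarith
    · exact h3 l hl hlf

/-- The fibre over a base point is the interval from `0` to `A f v.1`. It degenerates where `A f`
vanishes, making both `f` and `g` tight; elsewhere at most one end is attained. -/
theorem wedge_tight {v : E × ℝ} (h : ∀ l ∈ insert g S, 0 ≤ wedge A f g l v) :
    (A f v.1 = 0 ∧ (insert g S).filter (fun l => wedge A f g l v = 0) =
      insert g (S.filter (fun l => A l v.1 = 0))) ∨
    (A f v.1 ≠ 0 ∧ ∃ e, (e = f ∨ e = g) ∧ wedge A f g e (0, 1) ≠ 0 ∧
      (insert g S).filter (fun l => wedge A f g l v = 0) ⊆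
      insert e (S.filter (fun l => A l v.1 = 0))) := by
  have hfg : f ≠ g := by rintro rfl; exact hg hf
  obtain ⟨h1, h2, h3⟩ := (wedge_nonneg_iff hf hg).1 h
  by_cases hf0 : A f v.1 = 0
  · have h4 : v.2 = 0 := le_antisymm (hf0 ▸ h2) h1
    refine Or.inl ⟨hf0, ?_⟩
    ext l
    by_cases hlg : l = g
    · subst hlg; simp [wedge_new, h4]
    · by_cases hlf : l = f
      · subst hlf; simp [wedge_self hfg, h4, hf0, hf]
      · simp [wedge_of_ne hlf hlg, hlg]
  · refine Or.inr ⟨hf0, ?_⟩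
    by_cases h4 : v.2 = 0
    · refine ⟨g, Or.inr rfl, by simp [wedge_new], fun l hl => ?_⟩
      rw [Finset.mem_filter] at hl
      by_cases hlg : l = g
      · simp [hlg]
      · by_cases hlf : l = f
        · subst hlf; rw [wedge_self hfg] at hl; exact absurd hl.2 (by simpa [h4] using hf0)
        · rw [wedge_of_ne hlf hlg] at hl; simpa [hlg] using hl
    · refine ⟨f, Or.inl rfl, by simp [wedge_self hfg], fun l hl => ?_⟩
      rw [Finset.mem_filter] at hl
      by_cases hlg : l = g
      · subst hlg; rw [wedge_new] at hl; exact absurd hl.2 h4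
      · by_cases hlf : l = f
        · simp [hlf]
        · rw [wedge_of_ne hlf hlg] at hl; simpa [hlg, hlf] using hl

/-- Dual vectors lift with last coordinate zero. Over the facet, `(w, 0)` and `(w, A f w)` handle
`f` and `g`; off it the vertical vector `(0, 1)` suffices. All constraints other than `f` and `g`
vanish on that vector, so general position would be too much to ask for. -/
theorem SimpleConfig.wedge (hA : SimpleConfig A S) : SimpleConfig (wedge A f g) (insert g S) := by
  have hfg : f ≠ g := by rintro rfl; exact hg hf
  intro v hv h
  obtain ⟨h1, h2⟩ := wedge_base hf hg h hv
  have hD := hA v.1 h1 h2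
  have hlift : DInd (_root_.wedge A f g) ((S.filter (fun l => A l v.1 = 0)).erase f) := by
    intro l hl
    obtain ⟨w, hw, hw'⟩ := hD l (Finset.mem_of_mem_erase hl)
    have ne : ∀ m ∈ (S.filter (fun l => A l v.1 = 0)).erase f, m ≠ f ∧ m ≠ g := fun m hm =>
      ⟨Finset.ne_of_mem_erase hm, by
        rintro rfl; exact hg (Finset.mem_filter.1 (Finset.mem_of_mem_erase hm)).1⟩
    refine ⟨(w, 0), by rwa [wedge_of_ne (ne l hl).1 (ne l hl).2], fun m hm hml => ?_⟩
    rw [wedge_of_ne (ne m hm).1 (ne m hm).2]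
    exact hw' m (Finset.mem_of_mem_erase hm) hml
  have hker : ∀ w : E × ℝ, (∀ m ∈ S, A m v.1 = 0 → m ≠ f → A m w.1 = 0) →
      ∀ l ∈ (S.filter (fun l => A l v.1 = 0)).erase f, _root_.wedge A f g l w = 0 := by
    intro w hw l hl
    have h4 := Finset.mem_filter.1 (Finset.mem_of_mem_erase hl)
    rw [wedge_of_ne (Finset.ne_of_mem_erase hl) (by rintro rfl; exact hg h4.1)]
    exact hw l h4.1 h4.2 (Finset.ne_of_mem_erase hl)
  rcases wedge_tight hf hg h with ⟨hf0, heq⟩ | ⟨hf0, e, he, hne, hsub⟩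
  · rw [heq]
    have hfm : f ∈ S.filter (fun l => A l v.1 = 0) := Finset.mem_filter.2 ⟨hf, hf0⟩
    obtain ⟨w, hw, hw'⟩ := hD f hfm
    have hw'' : ∀ m ∈ S, A m v.1 = 0 → m ≠ f → A m w = 0 := fun m hm hm0 hmf =>
      hw' m (Finset.mem_filter.2 ⟨hm, hm0⟩) hmf
    have h5 := hlift.insert_of_ker (i := f) (w := (w, 0)) (hker _ hw'')
      (by simpa [wedge_self hfg] using hw)
    have h6 := h5.insert_of_ker (i := g) (w := (w, A f w)) (fun l hl => ?_)
      (by simpa [wedge_new] using hw)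
    · rwa [Finset.insert_erase hfm] at h6
    · rcases Finset.mem_insert.1 hl with rfl | hl
      · simp [wedge_self hfg]
      · exact hker _ hw'' l hl
  · refine DInd.subset ?_ hsub
    rw [← Finset.erase_eq_of_notMem (a := f) (s := S.filter (fun l => A l v.1 = 0))
      (by simp [hf0])]
    exact hlift.insert_of_ker (hker (0, 1) fun m _ _ _ => by simp) hne

theorem Irred.wedge (hA : Irred A S) (hS : 2 ≤ S.card) : Irred (wedge A f g) (insert g S) := by
  have hfg : f ≠ g := by rintro rfl; exact hg hf
  obtain ⟨p, hp⟩ := hA.exists_pos hS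
  have hne : ∀ l ∈ S, l ≠ g := fun l hl => by rintro rfl; exact hg hl
  intro l hl
  rcases Finset.mem_insert.1 hl with rfl | hl
  · refine ⟨(p, 0), wedge_new _, fun m hm hml => ?_⟩
    have hmS := (Finset.mem_insert.1 hm).resolve_left hml
    by_cases hmf : m = f
    · subst hmf; simpa [wedge_self hfg] using hp m hmS
    · rw [wedge_of_ne hmf hml]; exact hp m hmS
  · by_cases hlf : l = f
    · subst hlf
      refine ⟨(p, A l p), by simp [wedge_self hfg], fun m hm hml => ?_⟩
      rcases Finset.mem_insert.1 hm with rfl | hm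
      · rw [wedge_new]; exact hp l hf
      · rw [wedge_of_ne hml (hne m hm)]; exact hp m hm
    · obtain ⟨z, hz, hz'⟩ := hA l hl
      have hzf := hz' f hf (Ne.symm hlf)
      refine ⟨(z, A f z / 2), by rw [wedge_of_ne hlf (hne l hl)]; exact hz, fun m hm hml => ?_⟩
      rcases Finset.mem_insert.1 hm with rfl | hm
      · rw [wedge_new]; exact half_pos hzf
      · by_cases hmf : m = f
        · subst hmf; rw [wedge_self hfg]; exact sub_pos.2 (half_lt_self hzf)
        · rw [wedge_of_ne hmf (hne m hm)]; exact hz' m hm hml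

variable [FiniteDimensional ℝ E]

theorem wedge_insert_mem {I : Finset ι} (hI : I ∈ vtxSet A S) (hfI : f ∉ I) :
    insert g I ∈ vtxSet (wedge A f g) (insert g S) ∧
      insert f I ∈ vtxSet (wedge A f g) (insert g S) := by
  have hfg : f ≠ g := by rintro rfl; exact hg hf
  obtain ⟨hIS, hc, y, hy⟩ := hI
  have hgI : g ∉ I := fun h => hg (hIS h)
  have hfin : finrank ℝ (E × ℝ) = finrank ℝ E + 1 := by simp
  have hneg : ∀ l ∈ S, l ≠ g := fun l hl => by rintro rfl; exact hg hl
  have hnef : ∀ l ∈ I, l ≠ f := fun l hl => by rintro rfl; exact hfI hl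
  refine ⟨⟨Finset.insert_subset_insert _ hIS, by rw [Finset.card_insert_of_notMem hgI]; omega,
    (y, 0), fun l hl => ?_, fun l hl hlI => ?_⟩,
    ⟨Finset.insert_subset (Finset.mem_insert_of_mem hf) (hIS.trans (Finset.subset_insert _ _)),
    by rw [Finset.card_insert_of_notMem hfI]; omega, (y, A f y), fun l hl => ?_,
    fun l hl hlI => ?_⟩⟩
  · rcases Finset.mem_insert.1 hl with rfl | hl
    · simp [wedge_new]
    · rw [wedge_of_ne (hnef l hl) (hneg l (hIS hl))]; exact hy.1 l hl
  · rw [Finset.mem_insert, not_or] at hlI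
    have hl := (Finset.mem_insert.1 hl).resolve_left hlI.1
    by_cases hlf : l = f
    · subst hlf; simpa [wedge_self hfg] using hy.2 l hl hfI
    · rw [wedge_of_ne hlf hlI.1]; exact hy.2 l hl hlI.2
  · rcases Finset.mem_insert.1 hl with rfl | hl
    · simp [wedge_self hfg]
    · rw [wedge_of_ne (hnef l hl) (hneg l (hIS hl))]; exact hy.1 l hl
  · rw [Finset.mem_insert, not_or] at hlI
    rcases Finset.mem_insert.1 hl with rfl | hl
    · rw [wedge_new]; exact hy.2 f hf hfI
    · rw [wedge_of_ne hlI.1 (hneg l hl)]; exact hy.2 l hl hlI.2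

/-- The number of tight constraints exceeds that at the base point by at most one, so simplicity
forces the base point to be a vertex. -/
theorem exists_of_mem_vtxSet_wedge (hA : SimpleConfig A S) (hS : finrank ℝ E ≤ S.card)
    {K : Finset ι} (hK : K ∈ vtxSet (wedge A f g) (insert g S)) :
    ∃ T ∈ vtxSet A S, K = insert g T ∨ f ∉ T ∧ K = insert f T := by
  have hfin : finrank ℝ (E × ℝ) = finrank ℝ E + 1 := by simp
  have hSc := Finset.card_insert_of_notMem hg
  obtain ⟨hKS, hc, v, hv⟩ := id hK
  have hv0 := hv.ne_zero (by omega) hK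
  have hnn : ∀ l ∈ insert g S, 0 ≤ wedge A f g l v := fun l hl => hv.nonneg hl
  obtain ⟨h1, h2⟩ := wedge_base hf hg hnn hv0
  have htc := hA.card_tight v.1 h1 h2
  set T := S.filter (fun l => A l v.1 = 0) with hT
  have hgT : g ∉ T := fun h => hg (Finset.mem_filter.1 h).1
  have hmem : T.card + 1 = finrank ℝ E → T ∈ vtxSet A S := fun h =>
    ⟨Finset.filter_subset _ _, h, v.1, wit_filter h2⟩
  rw [← hv.filter_eq hKS] at hc ⊢
  rcases wedge_tight hf hg hnn with ⟨hf0, heq⟩ | ⟨hf0, e, he, -, hsub⟩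
  · rw [heq] at hc ⊢
    rw [Finset.card_insert_of_notMem hgT] at hc
    exact ⟨T, hmem (by omega), Or.inl rfl⟩
  · rw [← hT] at hsub
    have h3 := Finset.card_insert_le e T
    have h5 := Finset.eq_of_subset_of_card_le hsub (by omega)
    rw [h5] at hc ⊢
    refine ⟨T, hmem (by omega), ?_⟩
    rcases he with rfl | rfl
    · exact Or.inr ⟨by simp [hT, hf0], rfl⟩
    · exact Or.inl rfl

/-- Removing `g`, or `f` if `g` is absent, projects a vertex to the base, and adjacent vertices
project to equal or adjacent ones. -/
theorem StepReach.of_wedge (hA : SimpleConfig A S) (hS : finrank ℝ E ≤ S.card) {k : ℕ}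
    {K K' : Finset ι} (h : StepReach (VRel (vtxSet (wedge A f g) (insert g S))) k K K') :
    StepReach (VRel (vtxSet A S)) k (if g ∈ K then K.erase g else K.erase f)
      (if g ∈ K' then K'.erase g else K'.erase f) := by
  have hfg : f ≠ g := by rintro rfl; exact hg hf
  refine h.map (f := fun K => if g ∈ K then K.erase g else K.erase f) ?_
  rintro K K' ⟨hK, hK', h1, h2⟩
  obtain ⟨T, hT, hKT⟩ := exists_of_mem_vtxSet_wedge hf hg hA hS hK
  obtain ⟨T', hT', hKT'⟩ := exists_of_mem_vtxSet_wedge hf hg hA hS hK'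
  have proj : ∀ {K T : Finset ι}, T ∈ vtxSet A S → (K = insert g T ∨ f ∉ T ∧ K = insert f T) →
      (if g ∈ K then K.erase g else K.erase f) = T := by
    intro K T hT h
    have hgT : g ∉ T := fun h => hg (hT.1 h)
    rcases h with rfl | ⟨hfT, rfl⟩
    · simp [hgT]
    · simp [hgT, hfT, hfg.symm]
  have key : ∀ {K K' T T' : Finset ι}, T ∈ vtxSet A S → T' ∈ vtxSet A S →
      (K = insert g T ∨ f ∉ T ∧ K = insert f T) → (K' = insert g T' ∨ f ∉ T' ∧ K' = insert f T') →
      (K \ K').card = 1 → (T \ T').card ≤ 1 := by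
    intro K K' T T' hT hT' h h' hc
    have hgT : g ∉ T := fun h => hg (hT.1 h)
    have hgT' : g ∉ T' := fun h => hg (hT'.1 h)
    have hTK : T ⊆ K := by rcases h with rfl | ⟨-, rfl⟩ <;> exact Finset.subset_insert _ _
    by_cases hgK : g ∈ K \ K'
    · have hK'T : K' = insert f T' := by
        rcases h' with rfl | ⟨-, rfl⟩
        · simp at hgK
        · rfl
      obtain ⟨x, hx⟩ := Finset.card_eq_one.1 hc
      obtain rfl : g = x := by rw [hx] at hgK; simpa using hgK
      refine (Finset.card_le_card (t := {f}) fun l hl => ?_).trans (by simp)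
      rw [Finset.mem_sdiff] at hl
      have hlK' : l ∈ K' := by
        by_contra hlK'
        have : l ∈ K \ K' := Finset.mem_sdiff.2 ⟨hTK hl.1, hlK'⟩
        rw [hx, Finset.mem_singleton] at this
        exact hgT (this ▸ hl.1)
      rw [hK'T] at hlK'
      simpa using (Finset.mem_insert.1 hlK').resolve_right hl.2
    · refine (Finset.card_le_card (t := K \ K') fun l hl => ?_).trans hc.le
      rw [Finset.mem_sdiff] at hl ⊢
      refine ⟨hTK hl.1, fun hlK' => ?_⟩
      rcases h' with rfl | ⟨-, rfl⟩
      · exact hgT ((Finset.mem_insert.1 hlK').resolve_right hl.2 ▸ hl.1)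
      · obtain rfl := (Finset.mem_insert.1 hlK').resolve_right hl.2
        rcases h with rfl | ⟨h, -⟩
        · exact hgK (by simp [hfg.symm, hgT'])
        · exact h hl.1
  simp only [proj hT hKT, proj hT' hKT']
  have h3 := key hT hT' hKT hKT' h1
  have h4 : (T \ T').card = (T' \ T).card := Finset.card_sdiff_comm (by
    have := hT.2.1; have := hT'.2.1; omega)
  by_cases h0 : (T \ T').card = 0
  · left
    rw [Finset.card_eq_zero, Finset.sdiff_eq_empty_iff_subset] at h0
    exact Finset.eq_of_subset_of_card_le h0 (by have := hT.2.1; have := hT'.2.1; omega)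
  · exact Or.inr ⟨hT, hT', by omega, by omega⟩

theorem exists_config_of_wedge (hA : SimpleConfig A S) (hI : Irred A S)
    (hS : finrank ℝ E ≤ S.card) (hS2 : 2 ≤ S.card) {k : ℕ} {I J : Finset ι}
    (hIV : I ∈ vtxSet A S) (hJV : J ∈ vtxSet A S) (hfI : f ∉ I) (hfJ : f ∉ J)
    (hIJ : ¬ StepReach (VRel (vtxSet A S)) k I J) :
    ∃ B : ι → E × ℝ →L[ℝ] ℝ, Gen B (insert g S) ∧ Irred B (insert g S) ∧
      ∀ e, (e = f ∨ e = g) → ∀ e', (e' = f ∨ e' = g) →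
        insert e I ∈ vtxSet B (insert g S) ∧ insert e' J ∈ vtxSet B (insert g S) ∧
        ¬ StepReach (VRel (vtxSet B (insert g S))) k (insert e I) (insert e' J) := by
  have hfin : finrank ℝ (E × ℝ) = finrank ℝ E + 1 := by simp
  have hSc := Finset.card_insert_of_notMem hg
  have hfg : f ≠ g := by rintro rfl; exact hg hf
  obtain ⟨B, hB1, hB2, hB3⟩ := (hA.wedge hf hg).exists_gen (hI.wedge hf hg hS2) (by omega)
    (by omega)
  refine ⟨B, hB1, hB2, fun e he e' he' => ?_⟩
  rw [hB3]
  have mem : ∀ {I : Finset ι}, I ∈ vtxSet A S → f ∉ I → ∀ e, (e = f ∨ e = g) →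
      insert e I ∈ vtxSet (_root_.wedge A f g) (insert g S) ∧
      (if g ∈ insert e I then (insert e I).erase g else (insert e I).erase f) = I := by
    intro I hI hfI e he
    have hgI : g ∉ I := fun h => hg (hI.1 h)
    obtain ⟨h1, h2⟩ := wedge_insert_mem hf hg hI hfI
    rcases he with rfl | rfl
    · exact ⟨h2, by simp [hgI, hfI, hfg.symm]⟩
    · exact ⟨h1, by simp [hgI]⟩
  refine ⟨(mem hIV hfI e he).1, (mem hJV hfJ e' he').1, fun h => hIJ ?_⟩
  have := h.of_wedge hf hg hA hS
  rwa [(mem hIV hfI e he).2, (mem hJV hfJ e' he').2] at this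

end Wedge

/-! ### Wedge, truncations and correction of the diameter combined -/

section Families

variable {ι : Type*} [DecidableEq ι] [Infinite ι] {E : Type*} [NormedAddCommGroup E]
  [NormedSpace ℝ E] [FiniteDimensional ℝ E] {A : ι → E →L[ℝ] ℝ} {S : Finset ι}

/-- The configurations of a wedge and of its truncations at one or both ends of a long path. -/
theorem exists_configs_of_simple (hA : SimpleConfig A S) (hI : Irred A S)
    (hfin : 2 ≤ finrank ℝ E) (hS : 2 * finrank ℝ E < S.card + 2) {k : ℕ}
    (hd : ¬ FDiamLE (vtxSet A S) k) {j : ℕ} (hj : j ≤ 2) :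
    ∃ (B : ι → E × ℝ →L[ℝ] ℝ) (S' : Finset ι), S'.card = S.card + 1 + j ∧ Gen B S' ∧
      Irred B S' ∧ ¬ FDiamLE (vtxSet B S') (k + j) := by
  have hfin' : finrank ℝ (E × ℝ) = finrank ℝ E + 1 := by simp
  simp only [FDiamLE, not_forall] at hd
  obtain ⟨I, hIV, J, hJV, hIJ⟩ := hd
  have hIJ' : I ≠ J := by rintro rfl; exact hIJ (StepReach.refl _ _)
  -- The two vertices use at most `2 * (finrank ℝ E - 1)` constraints, fewer than `S.card` by `hS`.
  obtain ⟨f, hf, hfU⟩ : ∃ f ∈ S, f ∉ I ∪ J := Finset.exists_mem_notMem_of_card_lt_card (by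
    have := Finset.card_union_le I J
    have := hIV.2.1
    have := hJV.2.1
    omega)
  rw [Finset.mem_union, not_or] at hfU
  obtain ⟨hfI, hfJ⟩ := hfU
  obtain ⟨g, hg⟩ := Infinite.exists_notMem_finset S
  obtain ⟨i, hi⟩ := Infinite.exists_notMem_finset (insert g S)
  obtain ⟨i', hi'⟩ := Infinite.exists_notMem_finset (insert i (insert g S))
  have hgI : g ∉ I := fun h => hg (hIV.1 h)
  have hgJ : g ∉ J := fun h => hg (hJV.1 h)
  have hfg : f ≠ g := by rintro rfl; exact hg hf
  have c1 := Finset.card_insert_of_notMem hg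
  have c2 := Finset.card_insert_of_notMem hi
  have c3 := Finset.card_insert_of_notMem hi'
  obtain ⟨B, hBg, hBi, hB⟩ := exists_config_of_wedge hf hg hA hI (by omega) (by omega) hIV hJV
    hfI hfJ hIJ
  have hIe : ∀ {e e' : ι}, (e = f ∨ e = g) → (e' = f ∨ e' = g) → insert e I ≠ insert e' J := by
    intro e e' he he' heq
    have := (hB e he e' he').2.2
    rw [heq] at this
    exact this (StepReach.refl _ _)
  have hgg := hB g (Or.inr rfl) g (Or.inr rfl)
  have hgf := hB g (Or.inr rfl) f (Or.inl rfl)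
  have hfg' := hB f (Or.inl rfl) g (Or.inr rfl)
  have hff := hB f (Or.inl rfl) f (Or.inl rfl)
  obtain ⟨B', hB'V, hB'g, hB'i, hT⟩ := exists_truncAt (by omega) (by omega) hBg hBi hi hgg.1
  rw [← hB'V] at hgg hgf hfg' hff
  -- `insert i I` is the vertex cut on the edge between the two copies of `I`. Its distance to both
  -- copies of `J` is needed for the second truncation.
  have far : ∀ e', (e' = f ∨ e' = g) →
      ¬ StepReach (VRel (vtxSet B' (insert i (insert g S)))) (k + 1) (insert i I)
        (insert e' J) ∧ insert e' J ∈ vtxSet B' (insert i (insert g S)) := by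
    intro e' he'
    have h1 := hB g (Or.inr rfl) e' he'
    have h2 := hB f (Or.inl rfl) e' he'
    rw [← hB'V] at h1 h2
    have hne : insert e' J ≠ insert g I := (hIe (Or.inr rfl) he').symm
    refine ⟨?_, hT.mem_of_ne hi hB'g (by omega) h1.2.1 hne⟩
    have := hT.not_stepReach hi hB'g (by omega) (j := g) (l := f) (by simp) (by simp [hfg, hfI])
      (by rw [Finset.erase_insert hgI]; exact h2.1) h1.2.1 hne h1.2.2
      (by rw [Finset.erase_insert hgI]; exact h2.2.2)
    rwa [Finset.erase_insert hgI] at this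
  have hu : insert i I ∈ vtxSet B' (insert i (insert g S)) := by
    have := hT.insert_erase_mem hi hB'g (by omega) (j := g) (by simp)
    rwa [Finset.erase_insert hgI] at this
  obtain ⟨B'', hB''V, hB''g, hB''i, hT'⟩ := exists_truncAt (by omega) (by omega) hB'g hB'i hi'
    (far g (Or.inr rfl)).2
  have sym : ∀ {k X Y}, ¬ StepReach (VRel (vtxSet B' (insert i (insert g S)))) k X Y →
      ¬ StepReach (VRel (vtxSet B' (insert i (insert g S)))) k Y X := fun h h' =>
    h (h'.symm (VRel.symm _))
  interval_cases j
  · refine ⟨B, insert g S, by omega, hBg, hBi, fun h => ?_⟩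
    rw [hB'V] at hgg
    exact hgg.2.2 (h _ hgg.1 _ hgg.2.1)
  · exact ⟨B', insert i (insert g S), by omega, hB'g, hB'i, fun h =>
      (far g (Or.inr rfl)).1 (h _ hu _ (far g (Or.inr rfl)).2)⟩
  · refine ⟨B'', insert i' (insert i (insert g S)), by omega, hB''g, hB''i, fun h => ?_⟩
    have hne : insert i I ≠ insert g J := by
      intro heq
      have := (far g (Or.inr rfl)).1
      rw [heq] at this
      exact this (StepReach.refl _ _)
    have h1 := far g (Or.inr rfl)
    have h2 := far f (Or.inl rfl)
    rw [← hB''V] at h1 h2 hu sym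
    -- Both copies of `J` are more than `k + 1` steps from `insert i I`, so the vertex cut on the
    -- edge between them is more than `k + 2` steps away.
    have := hT'.not_stepReach hi' hB''g (by omega) (j := g) (l := f) (by simp)
      (by simp [hfg, hfJ]) (by rw [Finset.erase_insert hgJ]; exact h2.2) hu hne (sym h1.1)
      (by rw [Finset.erase_insert hgJ]; exact sym h2.1)
    refine this (h _ ?_ _ (hT'.mem_of_ne hi' hB''g (by omega) hu hne))
    exact hT'.insert_erase_mem hi' hB''g (by omega) (by simp)

/-- A simple configuration of large diameter yields, one dimension higher and with one to three
more constraints, a generic one whose diameter is the number of constraints minus the dimension of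
the polytope. -/
theorem exists_sharp_configs (hA : SimpleConfig A S) (hI : Irred A S) (hfin : 2 ≤ finrank ℝ E)
    (hS : 2 * finrank ℝ E < S.card + 2) {k : ℕ} (hk : k + finrank ℝ E = S.card)
    (hd : ¬ FDiamLE (vtxSet A S) k) {j : ℕ} (hj : j ≤ 2) :
    ∃ (B : ι → E × ℝ →L[ℝ] ℝ) (S' : Finset ι), S'.card = S.card + 1 + j ∧ Gen B S' ∧
      Irred B S' ∧ FDiamLE (vtxSet B S') (k + j + 1) ∧ ¬ FDiamLE (vtxSet B S') (k + j) := by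
  have hfin' : finrank ℝ (E × ℝ) = finrank ℝ E + 1 := by simp
  obtain ⟨B, S', hc, hB, hBI, hd'⟩ := exists_configs_of_simple hA hI hfin hS hd hj
  obtain ⟨B', h1, h2, h3, h4⟩ := exists_diam_eq (by omega) (by omega) hB hBI hd'
  exact ⟨B', S', hc, h1, h2, h3, h4⟩

end Families

/-! ### Faces of polyhedra in terms of tight inequalities -/

section FaceLattice

variable {ι : Type*} [DecidableEq ι] {V : Type*} [NormedAddCommGroup V] [NormedSpace ℝ V]

/-- The polyhedron cut out of the affine subspace `x₀ + W` by the inequalities `a i x ≤ b i`. -/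
def polySet (W : Submodule ℝ V) (x₀ : V) (a : ι → V →L[ℝ] ℝ) (b : ι → ℝ) (S : Finset ι) : Set V :=
  {x | x - x₀ ∈ W ∧ ∀ i ∈ S, a i x ≤ b i}

/-- The inequalities that are tight at `x`. -/
noncomputable def tight (a : ι → V →L[ℝ] ℝ) (b : ι → ℝ) (S : Finset ι) (x : V) : Finset ι :=
  S.filter fun i => a i x = b i

/-- The directions in `W` along which the inequalities in `J` stay tight. -/
def tightDir (W : Submodule ℝ V) (a : ι → V →L[ℝ] ℝ) (J : Finset ι) : Submodule ℝ V where
  carrier := {w | w ∈ W ∧ ∀ i ∈ J, a i w = 0}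
  add_mem' h h' := ⟨W.add_mem h.1 h'.1, fun i hi => by rw [map_add, h.2 i hi, h'.2 i hi, add_zero]⟩
  zero_mem' := ⟨W.zero_mem, fun i _ => map_zero _⟩
  smul_mem' c _ h := ⟨W.smul_mem c h.1, fun i hi => by rw [map_smul, h.2 i hi, smul_zero]⟩

/-- The points of `P` where the inequalities in `J` are tight. -/
def tightFace (P : Set V) (a : ι → V →L[ℝ] ℝ) (b : ι → ℝ) (J : Finset ι) : Set V :=
  {x | x ∈ P ∧ ∀ i ∈ J, a i x = b i}

variable {W : Submodule ℝ V} {x₀ : V} {a : ι → V →L[ℝ] ℝ} {b : ι → ℝ} {S : Finset ι}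

theorem mem_tight {x : V} {i : ι} : i ∈ tight a b S x ↔ i ∈ S ∧ a i x = b i := Finset.mem_filter

theorem mem_tightDir {J : Finset ι} {w : V} : w ∈ tightDir W a J ↔ w ∈ W ∧ ∀ i ∈ J, a i w = 0 :=
  Iff.rfl

theorem tightDir_mono {J J' : Finset ι} (h : J ⊆ J') : tightDir W a J' ≤ tightDir W a J :=
  fun _ hw => ⟨hw.1, fun i hi => hw.2 i (h hi)⟩

theorem sub_mem_of_mem {x y : V} (hx : x ∈ polySet W x₀ a b S) (hy : y ∈ polySet W x₀ a b S) :
    x - y ∈ W := by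
  simpa using W.sub_mem hx.1 hy.1

theorem exists_small {x w : V} (hx : x ∈ polySet W x₀ a b S) (hw : w ∈ W)
    (h : ∀ i ∈ tight a b S x, a i w ≤ 0) : ∃ ε : ℝ, 0 < ε ∧ x + ε • w ∈ polySet W x₀ a b S := by
  have key : ∀ᶠ ε : ℝ in 𝓝[>] 0, ∀ i ∈ S, a i (x + ε • w) ≤ b i := by
    refine (S.eventually_all).2 fun i hi => ?_
    by_cases hit : a i x = b i
    · filter_upwards [self_mem_nhdsWithin] with ε hε
      have := h i (mem_tight.2 ⟨hi, hit⟩)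
      rw [map_add, map_smul, smul_eq_mul, hit]
      nlinarith [Set.mem_Ioi.1 hε]
    · have hc : Continuous fun ε : ℝ => a i (x + ε • w) := by fun_prop
      have h1 : a i (x + (0 : ℝ) • w) < b i := by
        simpa using (hx.2 i hi).lt_of_ne hit
      filter_upwards [(hc.continuousAt.eventually (gt_mem_nhds h1)).filter_mono
        nhdsWithin_le_nhds] with ε hε
      exact hε.le
  obtain ⟨ε, h1, h2⟩ := (key.and self_mem_nhdsWithin).exists
  refine ⟨ε, h2, ?_, h1⟩
  rw [add_sub_right_comm]
  exact W.add_mem hx.1 (W.smul_mem _ hw)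

theorem vectorSpan_tightFace {x : V} (hx : x ∈ polySet W x₀ a b S) :
    vectorSpan ℝ (tightFace (polySet W x₀ a b S) a b (tight a b S x)) =
      tightDir W a (tight a b S x) := by
  refine le_antisymm (Submodule.span_le.2 ?_) fun w hw => ?_
  · rintro _ ⟨y, hy, z, hz, rfl⟩
    refine ⟨sub_mem_of_mem hy.1 hz.1, fun i hi => ?_⟩
    change a i (y - z) = 0
    rw [map_sub, hy.2 i hi, hz.2 i hi, sub_self]
  · obtain ⟨ε, hε, h⟩ := exists_small hx hw.1 fun i hi => (hw.2 i hi).le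
    have hxF : x ∈ tightFace (polySet W x₀ a b S) a b (tight a b S x) :=
      ⟨hx, fun i hi => (mem_tight.1 hi).2⟩
    have hyF : x + ε • w ∈ tightFace (polySet W x₀ a b S) a b (tight a b S x) :=
      ⟨h, fun i hi => by rw [map_add, map_smul, hw.2 i hi, (mem_tight.1 hi).2]; simp⟩
    have := vsub_mem_vectorSpan ℝ hyF hxF
    rw [vsub_eq_sub, add_sub_cancel_left] at this
    simpa [smul_smul, hε.ne'] using Submodule.smul_mem _ ε⁻¹ this

theorem isExposed_tightFace {J : Finset ι} (hJ : J ⊆ S) :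
    IsExposed ℝ (polySet W x₀ a b S) (tightFace (polySet W x₀ a b S) a b J) := by
  rintro ⟨z, hz, hzJ⟩
  refine ⟨∑ i ∈ J, a i, ?_⟩
  have hle : ∀ y ∈ polySet W x₀ a b S, (∑ i ∈ J, a i) y ≤ ∑ i ∈ J, b i := fun y hy => by
    rw [sum_apply]
    exact Finset.sum_le_sum fun i hi => hy.2 i (hJ hi)
  ext x
  refine and_congr_right fun hx => ⟨fun h y hy => ?_, fun h => ?_⟩
  · refine (hle y hy).trans_eq ?_
    rw [sum_apply]
    exact (Finset.sum_congr rfl h).symm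
  · have h1 := h z hz
    have h2 : (∑ i ∈ J, a i) z = ∑ i ∈ J, b i := by
      rw [sum_apply]
      exact Finset.sum_congr rfl hzJ
    have h3 := (hle x hx).antisymm (h2 ▸ h1)
    rw [sum_apply] at h3
    exact (Finset.sum_eq_sum_iff_of_le fun i hi => hx.2 i (hJ hi)).1 h3

theorem midpoint_mem {x y : V} (hx : x ∈ polySet W x₀ a b S) (hy : y ∈ polySet W x₀ a b S) :
    (2⁻¹ : ℝ) • (x + y) ∈ polySet W x₀ a b S ∧
      tight a b S ((2⁻¹ : ℝ) • (x + y)) = tight a b S x ∩ tight a b S y := by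
  refine ⟨⟨?_, fun i hi => ?_⟩, ?_⟩
  · have : (2⁻¹ : ℝ) • (x + y) - x₀ = (2⁻¹ : ℝ) • ((x - x₀) + (y - x₀)) := by module
    rw [this]
    exact W.smul_mem _ (W.add_mem hx.1 hy.1)
  · have := hx.2 i hi
    have := hy.2 i hi
    simp only [map_smul, map_add, smul_eq_mul]
    linarith
  · ext i
    simp only [mem_tight, Finset.mem_inter, map_smul, map_add, smul_eq_mul]
    constructor
    · rintro ⟨hi, h⟩
      have := hx.2 i hi
      have := hy.2 i hi
      exact ⟨⟨hi, by linarith⟩, hi, by linarith⟩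
    · rintro ⟨⟨hi, h⟩, -, h'⟩
      exact ⟨hi, by linarith⟩

/-- Take `x` in `F` with fewest tight inequalities. A midpoint has as tight set the intersection of
those of its ends, so all of `F` is tight where `x` is. Conversely, from `x` one can move slightly
away from any `y` of the tight face, so the exposing functional cannot be smaller at `y`. -/
theorem exists_eq_tightFace {F : Set V} (hF : IsExposed ℝ (polySet W x₀ a b S) F)
    (hne : F.Nonempty) : ∃ x ∈ polySet W x₀ a b S,
      F = tightFace (polySet W x₀ a b S) a b (tight a b S x) := by
  obtain ⟨l, hl⟩ := hF hne
  obtain ⟨x, hxF, hmin⟩ := WellFounded.has_min (measure fun x => (tight a b S x).card).wf F hne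
  have hx := hl ▸ hxF
  refine ⟨x, hx.1, Set.Subset.antisymm (fun y hyF => ?_) fun y hy => ?_⟩
  · have hy := hl ▸ hyF
    obtain ⟨h1, h2⟩ := midpoint_mem hx.1 hy.1
    have hm : (2⁻¹ : ℝ) • (x + y) ∈ F := by
      rw [hl]
      refine ⟨h1, fun z hz => ?_⟩
      have := hx.2 z hz
      have := hy.2 z hz
      simp only [map_smul, map_add, smul_eq_mul]
      linarith
    have h3 := hmin _ hm
    change ¬ (tight a b S ((2⁻¹ : ℝ) • (x + y))).card < (tight a b S x).card at h3
    rw [h2, not_lt] at h3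
    have h4 := Finset.eq_of_subset_of_card_le Finset.inter_subset_left h3
    refine ⟨hy.1, fun i hi => ?_⟩
    rw [← h4, Finset.mem_inter] at hi
    exact (mem_tight.1 hi.2).2
  · obtain ⟨ε, hε, h⟩ := exists_small hx.1 (sub_mem_of_mem hx.1 hy.1) fun i hi => by
      rw [map_sub, (mem_tight.1 hi).2, hy.2 i hi, sub_self]
    have h1 := hx.2 _ h
    simp only [map_add, map_smul, map_sub, smul_eq_mul] at h1
    rw [hl]
    refine ⟨hy.1, fun z hz => (hx.2 z hz).trans ?_⟩
    by_contra hlt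
    nlinarith

theorem tight_subset_of_mem {J : Finset ι} (hJ : J ⊆ S) {y : V}
    (hy : y ∈ tightFace (polySet W x₀ a b S) a b J) : J ⊆ tight a b S y :=
  fun i hi => mem_tight.2 ⟨hJ hi, hy.2 i hi⟩

theorem tight_subset {x : V} : tight a b S x ⊆ S := Finset.filter_subset _ _

theorem mem_tightFace_self {x : V} (hx : x ∈ polySet W x₀ a b S) :
    x ∈ tightFace (polySet W x₀ a b S) a b (tight a b S x) :=
  ⟨hx, fun _ hi => (mem_tight.1 hi).2⟩

theorem tightDir_empty : tightDir W a ∅ = W := by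
  ext w
  simp [mem_tightDir]

theorem vectorSpan_polySet (hx : ∀ i ∈ S, a i x₀ < b i) : vectorSpan ℝ (polySet W x₀ a b S) = W := by
  have h0 : tight a b S x₀ = ∅ := Finset.filter_eq_empty_iff.2 fun {i} hi => (hx i hi).ne
  have := vectorSpan_tightFace (W := W) (x₀ := x₀) (a := a) (b := b) (S := S) (x := x₀)
    ⟨by simp, fun i hi => (hx i hi).le⟩
  rw [h0, tightDir_empty] at this
  refine Eq.trans ?_ this
  congr 1
  ext x
  simp [tightFace]

theorem finrank_tightDir_singleton [FiniteDimensional ℝ V] {i : ι} {w : V} (hw : w ∈ W)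
    (hwi : a i w ≠ 0) :
    finrank ℝ (tightDir W a {i}) + 1 = finrank ℝ W := by
  let f : W →ₗ[ℝ] ℝ := (a i).toLinearMap.domRestrict W
  have hf : Function.Surjective f := by
    refine LinearMap.surjective_of_ne_zero fun h => hwi ?_
    exact LinearMap.congr_fun h ⟨w, hw⟩
  have h1 := f.finrank_range_add_finrank_ker
  rw [LinearMap.range_eq_top.2 hf, finrank_top, finrank_self] at h1
  have h2 : tightDir W a {i} = f.ker.map W.subtype := by
    ext v
    simp [mem_tightDir, f, and_comm]
  rw [h2, Submodule.finrank_map_subtype_eq]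
  omega

end FaceLattice

/-! ### Vertices, edges and facets of polyhedra -/

section Polytopes

variable {ι : Type*} [DecidableEq ι] {m : ℕ} {W : Submodule ℝ (EuclideanSpace ℝ (Fin m))}
  {x₀ : EuclideanSpace ℝ (Fin m)} {a : ι → EuclideanSpace ℝ (Fin m) →L[ℝ] ℝ} {b : ι → ℝ}
  {S : Finset ι}

theorem isFaceOfDim_iff {F : Set (EuclideanSpace ℝ (Fin m))} {i : ℕ} :
    IsFaceOfDim (polySet W x₀ a b S) F i ↔ ∃ x ∈ polySet W x₀ a b S,
      F = tightFace (polySet W x₀ a b S) a b (tight a b S x) ∧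
        finrank ℝ (tightDir W a (tight a b S x)) = i := by
  constructor
  · rintro ⟨h1, h2, h3⟩
    obtain ⟨x, hx, rfl⟩ := exists_eq_tightFace h1 h2
    exact ⟨x, hx, rfl, by rwa [vectorSpan_tightFace hx] at h3⟩
  · rintro ⟨x, hx, rfl, h⟩
    exact ⟨isExposed_tightFace tight_subset, ⟨x, mem_tightFace_self hx⟩,
      by rwa [vectorSpan_tightFace hx]⟩

theorem mem_polytopeVertices_iff {x : EuclideanSpace ℝ (Fin m)} :
    x ∈ polytopeVertices (polySet W x₀ a b S) ↔
      x ∈ polySet W x₀ a b S ∧ tightDir W a (tight a b S x) = ⊥ := by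
  change IsFaceOfDim _ _ _ ↔ _
  rw [isFaceOfDim_iff]
  constructor
  · rintro ⟨y, hy, h1, h2⟩
    obtain rfl : y = x := by
      have := mem_tightFace_self hy
      rwa [← h1] at this
    exact ⟨hy, Submodule.finrank_eq_zero.1 h2⟩
  · rintro ⟨hx, h⟩
    refine ⟨x, hx, Set.Subset.antisymm ?_ fun z hz => ?_, by rw [h, finrank_bot]⟩
    · rintro _ rfl
      exact mem_tightFace_self hx
    · have : z - x ∈ tightDir W a (tight a b S x) :=
        ⟨sub_mem_of_mem hz.1 hx, fun i hi => by
          rw [map_sub, hz.2 i hi, (mem_tight.1 hi).2, sub_self]⟩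
      rw [h, Submodule.mem_bot, sub_eq_zero] at this
      exact this

/-- The midpoint of `u` and `v` generates the smallest face containing both, with tight set the
intersection. The direction `u - v` gives dimension at least one. -/
theorem polytopeGraph_adj_iff {u v : polytopeVertices (polySet W x₀ a b S)} :
    (polytopeGraph (polySet W x₀ a b S)).Adj u v ↔
      u ≠ v ∧ finrank ℝ (tightDir W a (tight a b S u ∩ tight a b S v)) = 1 := by
  have hu := (mem_polytopeVertices_iff.1 u.2).1
  have hv := (mem_polytopeVertices_iff.1 v.2).1
  refine and_congr_right fun huv => ⟨?_, fun h => ?_⟩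
  · rintro ⟨F, hF, huF, hvF⟩
    obtain ⟨x, hx, rfl, h⟩ := isFaceOfDim_iff.1 hF
    have h1 : tightDir W a (tight a b S u ∩ tight a b S v) ≤ tightDir W a (tight a b S x) :=
      tightDir_mono (Finset.subset_inter (tight_subset_of_mem tight_subset huF)
        (tight_subset_of_mem tight_subset hvF))
    refine le_antisymm (h ▸ Submodule.finrank_mono h1) ?_
    refine finrank_pos_iff_exists_ne_zero.2 ⟨⟨(u : EuclideanSpace ℝ (Fin m)) - v,
      sub_mem_of_mem hu hv, fun i hi => ?_⟩, fun h0 => huv ?_⟩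
    · rw [Finset.mem_inter, mem_tight, mem_tight] at hi
      rw [map_sub, hi.1.2, hi.2.2, sub_self]
    · exact Subtype.ext (sub_eq_zero.1 (congrArg Subtype.val h0))
  · obtain ⟨h1, h2⟩ := midpoint_mem hu hv
    refine ⟨_, isFaceOfDim_iff.2 ⟨_, h1, rfl, by rw [h2, h]⟩, ⟨hu, fun i hi => ?_⟩,
      hv, fun i hi => ?_⟩ <;> rw [h2, Finset.mem_inter] at hi
    · exact (mem_tight.1 hi.1).2
    · exact (mem_tight.1 hi.2).2

/-- The facets of a polyhedron given by an irredundant system of inequalities. -/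
theorem encard_polytopeFacets (hx₀ : ∀ i ∈ S, a i x₀ < b i)
    (hI : ∀ i ∈ S, ∃ z ∈ polySet W x₀ a b S, tight a b S z = {i}) :
    (polytopeFacets (polySet W x₀ a b S) (finrank ℝ W)).encard = S.card := by
  choose! z hz hzi using hI
  have hrank : ∀ i ∈ S, finrank ℝ (tightDir W a {i}) + 1 = finrank ℝ W := fun i hi => by
    have h1 : a i (z i) = b i := (mem_tight.1 (hzi i hi ▸ Finset.mem_singleton_self i)).2
    refine finrank_tightDir_singleton (hz i hi).1 ?_
    rw [map_sub, h1]
    exact (sub_pos.2 (hx₀ i hi)).ne'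
  have heq : polytopeFacets (polySet W x₀ a b S) (finrank ℝ W) =
      (fun i => tightFace (polySet W x₀ a b S) a b {i}) '' S := by
    ext F
    constructor
    · rintro ⟨k, hk, hF⟩
      obtain ⟨x, hx, rfl, h⟩ := isFaceOfDim_iff.1 hF
      obtain ⟨i, hi⟩ : (tight a b S x).Nonempty := by
        rw [Finset.nonempty_iff_ne_empty]
        intro h0
        rw [h0, tightDir_empty] at h
        omega
      have hiS := tight_subset hi
      have h1 : tightDir W a (tight a b S x) ≤ tightDir W a {i} :=
        tightDir_mono (Finset.singleton_subset_iff.2 hi)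
      have h2 := Submodule.eq_of_le_of_finrank_eq h1 (by have := hrank i hiS; omega)
      -- The vector `z i - x` is a direction of the face of `x`, so any constraint tight at `x` is
      -- also tight at `z i`, where only `i` is.
      have h3 : tight a b S x = {i} := by
        refine Finset.Subset.antisymm (fun j hj => ?_) (Finset.singleton_subset_iff.2 hi)
        have h4 : a i (z i) = b i := (mem_tight.1 (hzi i hiS ▸ Finset.mem_singleton_self i)).2
        have h5 : z i - x ∈ tightDir W a {i} := ⟨sub_mem_of_mem (hz i hiS) hx, fun l hl => by
          rw [Finset.mem_singleton.1 hl, map_sub, h4, (mem_tight.1 hi).2, sub_self]⟩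
        rw [← h2] at h5
        have h6 := h5.2 j hj
        rw [map_sub, (mem_tight.1 hj).2, sub_eq_zero] at h6
        rw [← hzi i hiS]
        exact mem_tight.2 ⟨tight_subset hj, h6⟩
      exact ⟨i, hiS, by rw [h3]⟩
    · rintro ⟨i, hi, rfl⟩
      exact ⟨_, hrank i hi, isFaceOfDim_iff.2 ⟨z i, hz i hi, by rw [hzi i hi], by rw [hzi i hi]⟩⟩
  rw [heq, Set.InjOn.encard_image, Set.encard_coe_eq_coe_finsetCard]
  intro i hi j hj hij
  have h1 : z i ∈ tightFace (polySet W x₀ a b S) a b {i} := by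
    have := mem_tightFace_self (hz i hi)
    rwa [hzi i hi] at this
  simp only at hij
  rw [hij] at h1
  have h2 := tight_subset_of_mem (Finset.singleton_subset_iff.2 hj) h1
  rw [hzi i hi] at h2
  exact (Finset.mem_singleton.1 (Finset.singleton_subset_iff.1 h2)).symm

end Polytopes

/-! ### Bounded walks and graph distance -/

theorem stepReach_iff_edist_le {α : Type*} {G : SimpleGraph α} {k : ℕ} {u v : α} :
    StepReach G.Adj k u v ↔ G.edist u v ≤ k := by
  constructor
  · intro h
    induction k generalizing u with
    | zero =>
      obtain rfl : u = v := h
      simp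
    | succ k ih =>
      obtain ⟨x, hx, hxv⟩ := h
      refine (G.edist_triangle (v := x)).trans ?_
      rw [Nat.cast_succ, add_comm (k : ℕ∞)]
      refine add_le_add ?_ (ih hxv)
      rw [SimpleGraph.edist_le_one_iff_adj_or_eq]
      exact hx.symm
  · intro h
    obtain ⟨p, hp⟩ := SimpleGraph.exists_walk_of_edist_ne_top
      (ne_top_of_le_ne_top (ENat.natCast_ne_top k) h)
    have hw : ∀ {u v : α} (p : G.Walk u v), StepReach G.Adj p.length u v := by
      intro u v p
      induction p with
      | nil => rfl
      | cons hadj _ ih => exact ⟨_, Or.inr hadj, ih⟩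
    refine (hw p).mono ?_
    rw [← hp] at h
    exact_mod_cast h

/-! ### Dimension estimates for tight directions -/

section TightRank

variable {ι : Type*} [DecidableEq ι] {V : Type*} [NormedAddCommGroup V] [NormedSpace ℝ V]
  [FiniteDimensional ℝ V] {W : Submodule ℝ V} {a : ι → V →L[ℝ] ℝ}

theorem finrank_tightDir_le {I : Finset ι} (J : Finset ι) (hI : tightDir W a I = ⊥) :
    finrank ℝ (tightDir W a J) ≤ (I \ J).card := by
  let f : tightDir W a J →ₗ[ℝ] ((I \ J : Finset ι) → ℝ) :=
    (LinearMap.pi fun i : (I \ J : Finset ι) => (a i).toLinearMap).comp (tightDir W a J).subtype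
  have hf : Function.Injective f := by
    refine (injective_iff_map_eq_zero f).2 fun w hw => ?_
    have : (w : V) ∈ tightDir W a I := ⟨w.2.1, fun i hi => by
      by_cases hiJ : i ∈ J
      · exact w.2.2 i hiJ
      · exact congrFun hw ⟨i, Finset.mem_sdiff.2 ⟨hi, hiJ⟩⟩⟩
    rw [hI, Submodule.mem_bot] at this
    exact Subtype.ext this
  simpa using LinearMap.finrank_le_finrank_of_injective hf

theorem le_finrank_tightDir (J : Finset ι) :
    finrank ℝ W ≤ finrank ℝ (tightDir W a J) + J.card := by
  let f : W →ₗ[ℝ] (J → ℝ) :=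
    (LinearMap.pi fun i : J => (a i).toLinearMap).comp W.subtype
  have h1 := f.finrank_range_add_finrank_ker
  have h2 : tightDir W a J = f.ker.map W.subtype := by
    ext v
    simp [mem_tightDir, f, funext_iff, and_comm]
  rw [h2, Submodule.finrank_map_subtype_eq]
  have h3 := Submodule.finrank_le f.range
  rw [Module.finrank_fintype_fun_eq_card, Fintype.card_coe] at h3
  omega

end TightRank

/-! ### Polytopes as slices of cones -/

section Slice

variable {ι : Type*} [DecidableEq ι] {E : Type*} [NormedAddCommGroup E] [NormedSpace ℝ E]
  [FiniteDimensional ℝ E] {A : ι → E →L[ℝ] ℝ} {S : Finset ι} {D : ℕ}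

/-- `x ↦ z₀ + L x` parametrizes the hyperplane where the functionals `A l`, `l ∈ S`, sum up to `1`. -/
structure IsSlice (A : ι → E →L[ℝ] ℝ) (S : Finset ι) (z₀ : E)
    (L : EuclideanSpace ℝ (Fin D) →L[ℝ] E) : Prop where
  sum_base : ∑ l ∈ S, A l z₀ = 1
  pos : ∀ l ∈ S, 0 < A l z₀
  injective : ∀ x, L x = 0 → x = 0
  sum_dir : ∀ x, ∑ l ∈ S, A l (L x) = 0
  exists_eq : ∀ y, ∑ l ∈ S, A l y = 1 → ∃ x, z₀ + L x = y

theorem exists_isSlice (hD : finrank ℝ E = D + 1) (hS : S.Nonempty)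
    (hp : ∃ p, ∀ l ∈ S, 0 < A l p) :
    ∃ (z₀ : E) (L : EuclideanSpace ℝ (Fin D) →L[ℝ] E), IsSlice A S z₀ L := by
  obtain ⟨p, hp⟩ := hp
  let φ : E →ₗ[ℝ] ℝ := ∑ l ∈ S, (A l).toLinearMap
  have hφ : ∀ y, φ y = ∑ l ∈ S, A l y := fun y => by simp [φ, LinearMap.sum_apply]
  have hφp : 0 < φ p := by rw [hφ]; exact Finset.sum_pos hp hS
  have hsurj : Function.Surjective φ :=
    LinearMap.surjective_of_ne_zero fun h => by simp [h] at hφp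
  have h1 := φ.finrank_range_add_finrank_ker
  rw [LinearMap.range_eq_top.2 hsurj, finrank_top, finrank_self] at h1
  let e : EuclideanSpace ℝ (Fin D) ≃ₗ[ℝ] φ.ker := LinearEquiv.ofFinrankEq _ _ (by simp; omega)
  refine ⟨(φ p)⁻¹ • p, LinearMap.toContinuousLinearMap (φ.ker.subtype.comp e.toLinearMap),
    ?_, fun l hl => ?_, fun x hx => ?_, fun x => ?_, fun y hy => ?_⟩
  · rw [← hφ, map_smul, smul_eq_mul, inv_mul_cancel₀ hφp.ne']
  · rw [map_smul, smul_eq_mul]; exact mul_pos (inv_pos.2 hφp) (hp l hl)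
  · have : e x = 0 := Subtype.ext hx
    simpa using this
  · rw [← hφ]; exact (e x).2
  · refine ⟨e.symm ⟨y - (φ p)⁻¹ • p, ?_⟩, ?_⟩
    · rw [LinearMap.mem_ker, map_sub, map_smul, smul_eq_mul, inv_mul_cancel₀ hφp.ne', hφ, hy,
        sub_self]
    · simp

variable {z₀ : E} {L : EuclideanSpace ℝ (Fin D) →L[ℝ] E}

/-- The polytope cut out of a slice by the inequalities `A l ≥ 0`. -/
def sliceSet (A : ι → E →L[ℝ] ℝ) (S : Finset ι) (z₀ : E)
    (L : EuclideanSpace ℝ (Fin D) →L[ℝ] E) : Set (EuclideanSpace ℝ (Fin D)) :=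
  polySet ⊤ 0 (fun l => -(A l).comp L) (fun l => A l z₀) S

theorem mem_sliceSet {x : EuclideanSpace ℝ (Fin D)} :
    x ∈ sliceSet A S z₀ L ↔ ∀ l ∈ S, 0 ≤ A l (z₀ + L x) := by
  simp only [sliceSet, polySet, Set.mem_ofPred_eq, Submodule.mem_top, true_and]
  refine forall₂_congr fun l _ => ?_
  simp [neg_le_iff_add_nonneg]

theorem tight_slice (x : EuclideanSpace ℝ (Fin D)) :
    tight (fun l => -(A l).comp L) (fun l => A l z₀) S x =
      S.filter fun l => A l (z₀ + L x) = 0 := by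
  ext l
  rw [mem_tight, Finset.mem_filter]
  refine and_congr_right fun _ => ?_
  simp [neg_eq_iff_add_eq_zero, add_comm]

namespace IsSlice

variable (h : IsSlice A S z₀ L)
include h

theorem sum_eq (x : EuclideanSpace ℝ (Fin D)) : ∑ l ∈ S, A l (z₀ + L x) = 1 := by
  simp [Finset.sum_add_distrib, h.sum_base, h.sum_dir]

theorem ne_zero (x : EuclideanSpace ℝ (Fin D)) : z₀ + L x ≠ 0 := fun h0 => by
  have := h.sum_eq x
  simp [h0] at this

/-- A non-zero point of the cone is a positive multiple of a point of the slice. -/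
theorem exists_of_pos {y : E} (hy : ∀ l ∈ S, 0 ≤ A l y) (hpos : ∃ l ∈ S, 0 < A l y) :
    ∃ x, ∃ c : ℝ, 0 < c ∧ z₀ + L x = c • y := by
  have hs : 0 < ∑ l ∈ S, A l y := Finset.sum_pos' hy hpos
  obtain ⟨x, hx⟩ := h.exists_eq ((∑ l ∈ S, A l y)⁻¹ • y) (by
    simp only [map_smul, smul_eq_mul]
    rw [← Finset.mul_sum, inv_mul_cancel₀ hs.ne'])
  exact ⟨x, _, inv_pos.2 hs, hx⟩

theorem exists_of_wit {I : Finset ι} (hI : I ⊆ S) (hne : ∃ l ∈ S, l ∉ I) {y : E}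
    (hy : Wit A S I y) : ∃ x ∈ sliceSet A S z₀ L,
      tight (fun l => -(A l).comp L) (fun l => A l z₀) S x = I := by
  obtain ⟨l, hl, hlI⟩ := hne
  obtain ⟨x, c, hc, hx⟩ := h.exists_of_pos (fun l hl => hy.nonneg hl) ⟨l, hl, hy.2 l hl hlI⟩
  refine ⟨x, mem_sliceSet.2 fun l hl => ?_, ?_⟩
  · rw [hx, map_smul, smul_eq_mul]
    exact mul_nonneg hc.le (hy.nonneg hl)
  · rw [tight_slice, ← hy.filter_eq hI, hx]
    simp [hc.ne']

theorem tight_mem_vtxSet (hA : Gen A S) (hD : finrank ℝ E = D + 1)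
    {x : EuclideanSpace ℝ (Fin D)} (hx : x ∈ polytopeVertices (sliceSet A S z₀ L)) :
    tight (fun l => -(A l).comp L) (fun l => A l z₀) S x ∈ vtxSet A S := by
  obtain ⟨h1, h2⟩ := mem_polytopeVertices_iff.1 hx
  have h3 := le_finrank_tightDir (W := ⊤) (a := fun l => -(A l).comp L)
    (tight (fun l => -(A l).comp L) (fun l => A l z₀) S x)
  rw [h2, finrank_bot, finrank_top, finrank_euclideanSpace, Fintype.card_fin] at h3
  rw [tight_slice] at h3 ⊢
  have h4 := hA.card_tight (h.ne_zero x)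
  exact ⟨Finset.filter_subset _ _, by omega, _, wit_filter (mem_sliceSet.1 h1)⟩

theorem exists_vertex_of_mem (hA : Gen A S) (hS : finrank ℝ E ≤ S.card) {I : Finset ι}
    (hI : I ∈ vtxSet A S) : ∃ x ∈ polytopeVertices (sliceSet A S z₀ L),
      tight (fun l => -(A l).comp L) (fun l => A l z₀) S x = I := by
  obtain ⟨hIS, hc, y, hy⟩ := id hI
  obtain ⟨l, hl, hlI⟩ := vtxSet_exists_notMem hS hI
  obtain ⟨x, hx, hxI⟩ := h.exists_of_wit hIS ⟨l, hl, hlI⟩ hy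
  refine ⟨x, mem_polytopeVertices_iff.2 ⟨hx, ?_⟩, hxI⟩
  rw [Submodule.eq_bot_iff]
  rw [hxI]
  rintro w ⟨-, hw⟩
  refine h.injective w ?_
  have hxw : Wit A S I (z₀ + L x) := by
    rw [← hxI, tight_slice]
    exact wit_filter (mem_sliceSet.1 hx)
  -- `L w` is on the line through `z₀ + L x`. Summing the functionals over `S`, which gives `0` at
  -- the former and `1` at the latter, shows that it vanishes.
  have h1 := hA.proportional hIS hc hl hlI hxw.1 (y' := L w) fun i hi => by simpa using hw i hi
  have h2 : A l (L w) = 0 := by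
    have h3 := congrArg (fun v => ∑ l ∈ S, A l v) h1
    simp only [map_smul, smul_eq_mul, ← Finset.mul_sum, h.sum_eq, h.sum_dir] at h3
    simpa using h3
  rw [h2, zero_smul] at h1
  exact (smul_eq_zero.1 h1.symm).resolve_left (hxw.2 l hl hlI).ne'

/-- Vertex sets have `D` elements, so the dimension of the directions tight on `I ∩ J` is squeezed
between the equal numbers `D - |I ∩ J|` and `|I \ J|`. -/
theorem adj_iff (hA : Gen A S) (hD : finrank ℝ E = D + 1)
    {u v : polytopeVertices (sliceSet A S z₀ L)} :
    (polytopeGraph (sliceSet A S z₀ L)).Adj u v ↔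
      FAdj (tight (fun l => -(A l).comp L) (fun l => A l z₀) S u)
        (tight (fun l => -(A l).comp L) (fun l => A l z₀) S v) := by
  have hu := h.tight_mem_vtxSet hA hD u.2
  have hv := h.tight_mem_vtxSet hA hD v.2
  have hu' := (mem_polytopeVertices_iff.1 u.2).2
  refine polytopeGraph_adj_iff.trans ?_
  set I := tight (fun l => -(A l).comp L) (fun l => A l z₀) S u
  set J := tight (fun l => -(A l).comp L) (fun l => A l z₀) S v
  have h1 := hu.2.1
  have h2 := hv.2.1
  have h3 := finrank_tightDir_le (I ∩ J) hu'
  have h4 := le_finrank_tightDir (W := ⊤) (a := fun l => -(A l).comp L) (I ∩ J)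
  rw [finrank_top, finrank_euclideanSpace, Fintype.card_fin] at h4
  rw [Finset.sdiff_inter_self_left] at h3
  have h5 := Finset.card_sdiff_add_card_inter I J
  have h6 := Finset.card_sdiff_comm (show I.card = J.card by omega)
  constructor
  · rintro ⟨-, h7⟩
    exact ⟨by omega, by omega⟩
  · rintro ⟨h7, h8⟩
    refine ⟨fun huv => ?_, by omega⟩
    have : I = J := by simp only [I, J, huv]
    simp [this] at h7

/-- On the slice the values `A l` are non-negative with sum `1`, hence at most `1`; general position
makes the point recoverable from them by an injective linear map. -/
theorem isBounded (hA : Gen A S) (hS : finrank ℝ E ≤ S.card) :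
    Bornology.IsBounded (sliceSet A S z₀ L) := by
  let T : EuclideanSpace ℝ (Fin D) →ₗ[ℝ] (S → ℝ) :=
    (LinearMap.pi fun l : S => (A l).toLinearMap).comp L.toLinearMap
  have hT : T.ker = ⊥ := by
    rw [LinearMap.ker_eq_bot']
    intro x hx
    obtain ⟨R, hR, hc⟩ := Finset.exists_subset_card_eq hS
    exact h.injective x (hA R hR hc _ fun i hi => congrFun hx ⟨i, hR hi⟩)
  obtain ⟨K, -, hK⟩ := T.exists_antilipschitzWith hT
  refine (hK.isBounded_preimage (s := Set.pi Set.univ fun l : S => Set.Icc (-A l z₀) 1)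
    (Bornology.IsBounded.pi fun _ => Metric.isBounded_Icc _ _)).subset fun x hx => ?_
  rw [mem_sliceSet] at hx
  rintro ⟨l, hl⟩ -
  have h1 := hx l hl
  have h2 := Finset.single_le_sum hx hl
  rw [h.sum_eq] at h2
  rw [map_add] at h1 h2
  have h3 := h.pos l hl
  change -A l z₀ ≤ A l (L x) ∧ A l (L x) ≤ 1
  constructor <;> linarith

theorem exists_facet_point (hI : Irred A S) (hS : 2 ≤ S.card) {i : ι} (hi : i ∈ S) :
    ∃ z ∈ sliceSet A S z₀ L, tight (fun l => -(A l).comp L) (fun l => A l z₀) S z = {i} := by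
  obtain ⟨z, hz, hz'⟩ := hI i hi
  obtain ⟨m, hm, hmi⟩ := Finset.exists_mem_ne (show 1 < S.card by omega) i
  refine h.exists_of_wit (Finset.singleton_subset_iff.2 hi) ⟨m, hm, by simpa using hmi⟩
    ⟨fun l hl => ?_, fun l hl hli => hz' l hl (by simpa using hli)⟩ (y := z)
  rw [Finset.mem_singleton.1 hl, hz]

theorem isPolytopeOfDim (hA : Gen A S) (hI : Irred A S) (hS : finrank ℝ E ≤ S.card)
    (hS2 : 2 ≤ S.card) : IsPolytopeOfDim (sliceSet A S z₀ L) D := by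
  refine ⟨⟨S.image fun l => ((InnerProductSpace.toDual ℝ _).symm (-(A l).comp L), A l z₀),
    fun p hp => ?_, ?_⟩, h.isBounded hA hS, ⟨0, ?_⟩, ?_⟩
  · obtain ⟨i, hi, rfl⟩ := Finset.mem_image.1 hp
    obtain ⟨z, hz, hzi⟩ := h.exists_facet_point hI hS2 hi
    have h1 := (mem_tight.1 (hzi ▸ Finset.mem_singleton_self i)).2
    have h2 := h.pos i hi
    intro h0
    have h3 : -(A i).comp L = 0 := by simpa using h0
    rw [h3] at h1
    simp at h1
    linarith
  · ext x
    simp [sliceSet, polySet, -neg_add_le_iff_le_add]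
  · exact mem_sliceSet.2 fun l hl => by simpa using (h.pos l hl).le
  · rw [sliceSet, vectorSpan_polySet fun i hi => by simpa using h.pos i hi]
    simp

theorem encard_facets (hI : Irred A S) (hS2 : 2 ≤ S.card) :
    (polytopeFacets (sliceSet A S z₀ L) D).encard = S.card := by
  have := encard_polytopeFacets (W := ⊤) (x₀ := 0) (a := fun l => -(A l).comp L)
    (b := fun l => A l z₀) (S := S) (fun i hi => by simpa using h.pos i hi)
    fun i hi => h.exists_facet_point hI hS2 hi
  rwa [finrank_top, finrank_euclideanSpace, Fintype.card_fin] at this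

theorem ediam_eq (hA : Gen A S) (hD : finrank ℝ E = D + 1) (hS : finrank ℝ E ≤ S.card) {k : ℕ}
    (h1 : FDiamLE (vtxSet A S) (k + 1)) (h2 : ¬ FDiamLE (vtxSet A S) k) :
    (polytopeGraph (sliceSet A S z₀ L)).ediam = (k + 1 : ℕ) := by
  have hV : ∀ I ∈ vtxSet A S, ∃ u : polytopeVertices (sliceSet A S z₀ L),
      tight (fun l => -(A l).comp L) (fun l => A l z₀) S u = I := fun I hI => by
    obtain ⟨x, hx, hxI⟩ := h.exists_vertex_of_mem hA hS hI
    exact ⟨⟨x, hx⟩, hxI⟩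
  simp only [FDiamLE, not_forall] at h2
  obtain ⟨I, hI, J, hJ, hIJ⟩ := h2
  obtain ⟨u₀, hu₀⟩ := hV I hI
  obtain ⟨v₀, hv₀⟩ := hV J hJ
  have : Nonempty (polytopeVertices (sliceSet A S z₀ L)) := ⟨u₀⟩
  choose! g hg using hV
  have hinj : ∀ u v : polytopeVertices (sliceSet A S z₀ L),
      tight (fun l => -(A l).comp L) (fun l => A l z₀) S u =
        tight (fun l => -(A l).comp L) (fun l => A l z₀) S v → u = v := by
    intro u v huv
    obtain ⟨hu, hu'⟩ := mem_polytopeVertices_iff.1 u.2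
    have hv := (mem_polytopeVertices_iff.1 v.2).1
    have : (u : EuclideanSpace ℝ (Fin D)) - v ∈
        tightDir ⊤ (fun l => -(A l).comp L) (tight (fun l => -(A l).comp L) (fun l => A l z₀) S u) :=
      ⟨trivial, fun i hi => by
        have hi' := hi
        rw [huv] at hi'
        rw [map_sub, (mem_tight.1 hi).2, (mem_tight.1 hi').2, sub_self]⟩
    rw [hu', Submodule.mem_bot, sub_eq_zero] at this
    exact Subtype.ext this
  refine le_antisymm (SimpleGraph.ediam_le_iff.2 fun u v => ?_) ?_
  · have hr := h1 _ (h.tight_mem_vtxSet hA hD u.2) _ (h.tight_mem_vtxSet hA hD v.2)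
    have := hr.map (f := g) (R' := (polytopeGraph (sliceSet A S z₀ L)).Adj) (by
      rintro I J ⟨hI, hJ, hIJ⟩
      right
      rw [h.adj_iff hA hD, hg I hI, hg J hJ]
      exact hIJ)
    rw [hinj _ u (hg _ (h.tight_mem_vtxSet hA hD u.2)),
      hinj _ v (hg _ (h.tight_mem_vtxSet hA hD v.2))] at this
    exact stepReach_iff_edist_le.1 this
  · rw [Nat.cast_succ]
    refine (ENat.add_one_le_iff (ENat.natCast_ne_top k)).2 ?_
    refine lt_of_lt_of_le (not_le.1 fun hle => hIJ ?_) (SimpleGraph.edist_le_ediam (u := u₀) (v := v₀))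
    have := (stepReach_iff_edist_le.2 hle).map (R' := VRel (vtxSet A S))
      (f := fun u : polytopeVertices (sliceSet A S z₀ L) =>
        tight (fun l => -(A l).comp L) (fun l => A l z₀) S u)
      fun u v huv => Or.inr ⟨h.tight_mem_vtxSet hA hD u.2, h.tight_mem_vtxSet hA hD v.2,
        (h.adj_iff hA hD).1 huv⟩
    simpa only [hu₀, hv₀] using this

end IsSlice

/-- A generic irredundant configuration is realized by a polytope. -/
theorem exists_isHirschSharp (hD : finrank ℝ E = D + 1) (hS2 : 2 ≤ S.card) (hA : Gen A S)
    (hI : Irred A S) {k : ℕ} (hk : k + finrank ℝ E = S.card)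
    (h1 : FDiamLE (vtxSet A S) (k + 1)) (h2 : ¬ FDiamLE (vtxSet A S) k) :
    ∃ Q : Set (EuclideanSpace ℝ (Fin D)), IsHirschSharp Q D S.card := by
  obtain ⟨z₀, L, h⟩ := exists_isSlice hD (Finset.card_pos.1 (by omega)) (hI.exists_pos hS2)
  refine ⟨sliceSet A S z₀ L, h.isPolytopeOfDim hA hI (by omega) hS2, h.encard_facets hI hS2, ?_⟩
  rw [h.ediam_eq hA hD (by omega) h1 h2]
  exact_mod_cast (by omega : k + 1 + D = S.card)

end Slice

/-! ### Perturbing right-hand sides to reach a simple polytope -/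

section Homogenization

variable {ι : Type*} {F : Type*} [NormedAddCommGroup F] [NormedSpace ℝ F]
  {c : ι → F →L[ℝ] ℝ} {β : ι → ℝ} {S : Finset ι}

/-- The functionals on `F × ℝ` whose cone is the homogenization of `{w | ∀ i, c i w ≤ β i}`. -/
def homConfig (c : ι → F →L[ℝ] ℝ) (β : ι → ℝ) : ι → F × ℝ →L[ℝ] ℝ :=
  fun i => β i • .snd ℝ F ℝ - (c i).comp (.fst ℝ F ℝ)

theorem homConfig_apply (i : ι) (y : F × ℝ) : homConfig c β i y = β i * y.2 - c i y.1 := by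
  simp [homConfig]

/-- Only linearly independent inequalities `c i w ≤ β i`, `i ∈ S`, are tight simultaneously. -/
def GenRHS (c : ι → F →L[ℝ] ℝ) (S : Finset ι) (β : ι → ℝ) : Prop :=
  ∀ J ⊆ S, ∀ w, (∀ l ∈ J, c l w = β l) → DInd c J

theorem exists_relation [DecidableEq ι] {J : Finset ι} (h : ¬ DInd c J) :
    ∃ f : (J → ℝ) →ₗ[ℝ] ℝ, f ≠ 0 ∧ ∀ w, f (fun l => c l w) = 0 := by
  let T : F →ₗ[ℝ] (J → ℝ) := LinearMap.pi fun l => (c l).toLinearMap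
  have hT : T.range < ⊤ := by
    refine lt_top_iff_ne_top.2 fun htop => h fun l hl => ?_
    obtain ⟨w, hw⟩ := LinearMap.range_eq_top.1 htop (Pi.single ⟨l, hl⟩ 1)
    refine ⟨w, ?_, fun m hm hml => ?_⟩
    · have := congrFun hw ⟨l, hl⟩
      simp only [Pi.single_eq_same] at this
      change c l w = 1 at this
      simp [this]
    · have := congrFun hw ⟨m, hm⟩
      rw [Pi.single_eq_of_ne fun h => hml (congrArg Subtype.val h)] at this
      exact this
  obtain ⟨f, hf, hle⟩ := T.range.exists_le_ker_of_lt_top hT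
  exact ⟨f, hf, fun w => LinearMap.mem_ker.1 (hle ⟨w, rfl⟩)⟩

/-- For each dependent `J` the right-hand sides solvable on `J` lie in a hyperplane, and finitely
many hyperplanes are avoided. Only the coordinates in `S` move: `S → ℝ` is a normed space even when
`ι` is infinite. -/
theorem exists_genRHS [DecidableEq ι] {P : (ι → ℝ) → Prop} (hP : ∀ᶠ x in 𝓝 β, P x) :
    ∃ x, P x ∧ GenRHS c S x := by
  have key : ∀ J : Finset ι, J ⊆ S ∧ ¬ DInd c J → ∃ f : (S → ℝ) →L[ℝ] ℝ, f ≠ 0 ∧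
      ∀ x : S → ℝ, (∃ w, ∀ l : S, l.1 ∈ J → c l w = x l) → f x = 0 := by
    rintro J ⟨hJ, hD⟩
    obtain ⟨f, hf, hfw⟩ := exists_relation hD
    let r := LinearMap.funLeft ℝ ℝ (fun j : J => (⟨j.1, hJ j.2⟩ : S))
    have hr : Function.Surjective r := LinearMap.funLeft_surjective_of_injective _ _ _
      fun i j hij => Subtype.ext (congrArg (fun x : S => x.1) hij)
    refine ⟨LinearMap.toContinuousLinearMap (f.comp r), fun h0 => hf ?_, fun x hx => ?_⟩
    · ext1 i
      obtain ⟨x, hx⟩ := hr (LinearMap.single ℝ (fun _ => ℝ) i 1)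
      have := DFunLike.congr_fun h0 x
      ext
      simpa [hx] using this
    · obtain ⟨w, hw⟩ := hx
      change f (r x) = 0
      rw [← hfw w]
      congr 1
      ext j
      exact (hw ⟨j.1, hJ j.2⟩ j.2).symm
  choose! f hf0 hf using key
  let ext : (S → ℝ) → ι → ℝ := fun x i => if h : i ∈ S then x ⟨i, h⟩ else β i
  have hext : Continuous ext := by
    refine continuous_pi fun i => ?_
    by_cases hi : i ∈ S
    · simp only [ext, hi, dite_true]; fun_prop
    · simp only [ext, hi, dite_false]; fun_prop
  have hβ : ext (fun i => β i) = β := by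
    ext i
    simp [ext]
  obtain ⟨x, hx, hxf⟩ := exists_forall_ne_zero (x := fun i : S => β i)
    (Q := f '' {J | J ⊆ S ∧ ¬ DInd c J})
    ((S.powerset.finite_toSet.subset fun J hJ =>
      Finset.mem_coe.2 (Finset.mem_powerset.2 hJ.1)).image _)
    (by rintro _ ⟨J, hJ, rfl⟩; exact hf0 J hJ)
    (hext.continuousAt.eventually (hβ.symm ▸ hP))
  refine ⟨ext x, hx, fun J hJ w hw => by_contra fun hD => hxf _ ⟨J, ⟨hJ, hD⟩, rfl⟩
    (hf J ⟨hJ, hD⟩ x ⟨w, fun l hl => ?_⟩)⟩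
  rw [hw l hl]
  simp [ext]

theorem DInd.exists_solution {J : Finset ι} (h : DInd c J) :
    ∃ v : (ι → ℝ) → F, Continuous v ∧ ∀ x, ∀ l ∈ J, c l (v x) = x l := by
  choose! w hw hw' using h
  refine ⟨fun x => ∑ l ∈ J, (x l / c l (w l)) • w l, ?_, fun x l hl => ?_⟩
  · exact continuous_finsetSum _ fun l _ => by fun_prop
  · rw [map_sum, Finset.sum_eq_single_of_mem l hl]
    · rw [map_smul, smul_eq_mul, div_mul_cancel₀ _ (hw l hl)]
    · intro m hm hml
      rw [map_smul, hw' m hm l hl hml.symm, smul_zero]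

theorem DInd.eq_of_eq [FiniteDimensional ℝ F] {J : Finset ι} (h : DInd c J)
    (hc : J.card = finrank ℝ F) {v w : F} (hvw : ∀ l ∈ J, c l v = c l w) : v = w := by
  rw [← sub_eq_zero]
  by_contra hne
  have := h.card_lt hne fun l hl => by rw [map_sub, hvw l hl, sub_self]
  omega

theorem homConfig_pos (hS : S.Nonempty) (hrec : ∀ w, (∀ i ∈ S, c i w ≤ 0) → w = 0)
    (hβ : ∀ i ∈ S, 0 < β i) {y : F × ℝ} (hy : ∀ l ∈ S, 0 ≤ homConfig c β l y) (hy0 : y ≠ 0) :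
    0 < y.2 := by
  simp only [homConfig_apply] at hy
  by_contra hle
  rw [not_lt] at hle
  have h1 := hrec y.1 fun i hi => by nlinarith [hy i hi, hβ i hi]
  obtain ⟨i, hi⟩ := hS
  have h2 := hy i hi
  rw [h1, map_zero, sub_zero] at h2
  exact hy0 (Prod.ext h1 (le_antisymm hle (nonneg_of_mul_nonneg_right h2 (hβ i hi))))

theorem simpleConfig_homConfig (hS : S.Nonempty) (hrec : ∀ w, (∀ i ∈ S, c i w ≤ 0) → w = 0)
    (hβ : ∀ i ∈ S, 0 < β i) (hG : GenRHS c S β) : SimpleConfig (homConfig c β) S := by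
  intro y hy0 hy
  have h2 := homConfig_pos hS hrec hβ hy hy0
  have hD := hG _ (Finset.filter_subset (fun l => homConfig c β l y = 0) S) (y.2⁻¹ • y.1)
    fun l hl => by
      have := (Finset.mem_filter.1 hl).2
      rw [homConfig_apply] at this
      rw [map_smul, smul_eq_mul, inv_mul_eq_iff_eq_mul₀ h2.ne']
      linarith
  intro l hl
  obtain ⟨w, hw, hw'⟩ := hD l hl
  exact ⟨(w, 0), by simpa [homConfig_apply] using hw, fun m hm hml => by
    simpa [homConfig_apply] using hw' m hm hml⟩

theorem eventually_irred_homConfig (hβ : ∀ i ∈ S, 0 < β i)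
    (hI : ∀ i ∈ S, ∃ z, c i z = β i ∧ ∀ j ∈ S, j ≠ i → c j z < β j) :
    ∀ᶠ x in 𝓝 β, Irred (homConfig c x) S := by
  refine (S.eventually_all).2 fun i hi => ?_
  obtain ⟨z, hz, hz'⟩ := hI i hi
  have key : ∀ᶠ x : ι → ℝ in 𝓝 β, ∀ j ∈ S, j ≠ i → x i / β i * c j z < x j := by
    refine (S.eventually_all).2 fun j hj => ?_
    by_cases hji : j = i
    · exact Eventually.of_forall fun _ h => absurd hji h
    · have h1 : Continuous fun x : ι → ℝ => x j - x i / β i * c j z := by fun_prop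
      have h2 : 0 < β j - β i / β i * c j z := by
        rw [div_self (hβ i hi).ne', one_mul]
        exact sub_pos.2 (hz' j hj hji)
      filter_upwards [h1.continuousAt.eventually (lt_mem_nhds h2)] with x hx _
      exact sub_pos.1 hx
  filter_upwards [key] with x hx
  refine ⟨((x i / β i) • z, 1), ?_, fun j hj hji => ?_⟩
  · simp [homConfig_apply, hz, (hβ i hi).ne']
  · have := hx j hj hji
    simpa [homConfig_apply] using this

variable [FiniteDimensional ℝ F] [DecidableEq ι]

/-- A vertex of the cone gives a vertex of the polytope. -/
theorem exists_of_wit_homConfig (hS : finrank ℝ F + 1 ≤ S.card)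
    (hrec : ∀ w, (∀ i ∈ S, c i w ≤ 0) → w = 0) (hβ : ∀ i ∈ S, 0 < β i) {I : Finset ι}
    (hI : I ∈ vtxSet (homConfig c β) S) {z : F × ℝ} (hz : Wit (homConfig c β) S I z) :
    I.card = finrank ℝ F ∧ 0 < z.2 ∧ (∀ l ∈ I, c l (z.2⁻¹ • z.1) = β l) ∧
      ∀ l ∈ S, c l (z.2⁻¹ • z.1) ≤ β l := by
  have hfin : finrank ℝ (F × ℝ) = finrank ℝ F + 1 := by simp
  have hc := hI.2.1
  have h1 := homConfig_pos (Finset.card_pos.1 (by omega)) hrec hβ (fun l hl => hz.nonneg hl)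
    (hz.ne_zero (by omega) hI)
  refine ⟨by omega, h1, fun l hl => ?_, fun l hl => ?_⟩
  · have := hz.1 l hl
    rw [homConfig_apply] at this
    rw [map_smul, smul_eq_mul, inv_mul_eq_iff_eq_mul₀ h1.ne']
    linarith
  · have := hz.nonneg hl
    rw [homConfig_apply] at this
    rw [map_smul, smul_eq_mul, inv_mul_le_iff₀ h1]
    linarith

/-- There are finitely many bases `I`, and one whose solution violates an inequality at `β` still
violates it nearby. So every vertex for `x` near `β` comes back to a feasible point for `β`. -/
theorem eventually_exists_vertex (hS : finrank ℝ F + 1 ≤ S.card)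
    (hrec : ∀ w, (∀ i ∈ S, c i w ≤ 0) → w = 0) (hβ : ∀ i ∈ S, 0 < β i)
    {v : Finset ι → (ι → ℝ) → F} (hv : ∀ J, DInd c J → Continuous (v J))
    (hvJ : ∀ J, DInd c J → ∀ x, ∀ l ∈ J, c l (v J x) = x l) :
    ∀ᶠ x in 𝓝 β, (∀ i ∈ S, 0 < x i) ∧ (GenRHS c S x → ∀ I ∈ vtxSet (homConfig c x) S,
      DInd c I ∧ I.card = finrank ℝ F ∧ ∀ l ∈ S, c l (v I β) ≤ β l) := by
  have h1 : ∀ᶠ x : ι → ℝ in 𝓝 β, ∀ i ∈ S, 0 < x i := (S.eventually_all).2 fun i hi =>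
    (continuous_apply i).continuousAt.eventually (lt_mem_nhds (hβ i hi))
  have h2 : ∀ᶠ x : ι → ℝ in 𝓝 β, ∀ I ∈ S.powerset, DInd c I →
      (∀ l ∈ S, c l (v I x) ≤ x l) → ∀ l ∈ S, c l (v I β) ≤ β l := by
    refine (S.powerset.eventually_all).2 fun I _ => ?_
    by_cases hD : DInd c I
    · by_cases hf : ∀ l ∈ S, c l (v I β) ≤ β l
      · exact Eventually.of_forall fun _ _ _ => hf
      · push Not at hf
        obtain ⟨l, hl, hlt⟩ := hf
        have hc : Continuous fun x : ι → ℝ => c l (v I x) - x l :=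
          ((c l).continuous.comp (hv I hD)).sub (continuous_apply l)
        filter_upwards [hc.continuousAt.eventually (lt_mem_nhds (sub_pos.2 hlt))] with x hx _ h
        exact absurd (h l hl) (not_le.2 (sub_pos.1 hx))
    · exact Eventually.of_forall fun _ h => absurd h hD
  filter_upwards [h1, h2] with x hx1 hx2
  refine ⟨hx1, fun hG I hI => ?_⟩
  obtain ⟨hIS, -, z, hz⟩ := id hI
  obtain ⟨hc, hz2, h3, h4⟩ := exists_of_wit_homConfig hS hrec hx1 hI hz
  have hD := hG I hIS _ h3
  refine ⟨hD, hc, hx2 I (Finset.mem_powerset.2 hIS) hD ?_⟩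
  rwa [hD.eq_of_eq hc (v := v I x) fun l hl => (hvJ I hD x l hl).trans (h3 l hl).symm]

/-- The sum `ℓ` of the functionals tight at `u` has `u` as its unique maximizer, and `γ` separates
its value there from those at the other points `v I β`. A shrunken `s • u` stays feasible with `ℓ`
above `γ`, so the perturbed polytope has a vertex above `γ`, and that vertex must come from `u`. -/
theorem eventually_vertex_eq (hS : finrank ℝ F + 1 ≤ S.card)
    (hrec : ∀ w, (∀ i ∈ S, c i w ≤ 0) → w = 0) (hβ : ∀ i ∈ S, 0 < β i)
    {v : Finset ι → (ι → ℝ) → F} (hv : ∀ J, DInd c J → Continuous (v J))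
    (hvJ : ∀ J, DInd c J → ∀ x, ∀ l ∈ J, c l (v J x) = x l) {u : F} (hu : ∀ l ∈ S, c l u ≤ β l)
    (hu' : ∀ w, (∀ l ∈ S, c l u = β l → c l w = 0) → w = 0) :
    ∀ᶠ x in 𝓝 β, GenRHS c S x → ∃ I ∈ vtxSet (homConfig c x) S, v I β = u := by
  set ℓ : F →L[ℝ] ℝ := ∑ l ∈ S.filter (fun l => c l u = β l), c l with hℓ
  have hlt : ∀ w, (∀ l ∈ S, c l w ≤ β l) → w ≠ u → ℓ w < ℓ u := by
    intro w hw hwu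
    have hle : ∀ l ∈ S.filter (fun l => c l u = β l), c l w ≤ c l u := fun l hl => by
      rw [(Finset.mem_filter.1 hl).2]
      exact hw l (Finset.mem_filter.1 hl).1
    rw [hℓ, sum_apply, sum_apply]
    refine (Finset.sum_le_sum hle).lt_of_ne fun heq => hwu (sub_eq_zero.1 (hu' _ fun l hl hlu => ?_))
    rw [map_sub, (Finset.sum_eq_sum_iff_of_le hle).1 heq l (Finset.mem_filter.2 ⟨hl, hlu⟩), sub_self]
  obtain ⟨γ, hγ, hγu⟩ : ∃ γ, (∀ I ∈ S.powerset, (∀ l ∈ S, c l (v I β) ≤ β l) → v I β ≠ u →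
      ℓ (v I β) < γ) ∧ γ < ℓ u := by
    have : ∀ᶠ γ in 𝓝[<] (ℓ u), ∀ I ∈ S.powerset, (∀ l ∈ S, c l (v I β) ≤ β l) → v I β ≠ u →
        ℓ (v I β) < γ := by
      refine (S.powerset.eventually_all).2 fun I _ => ?_
      by_cases h : (∀ l ∈ S, c l (v I β) ≤ β l) ∧ v I β ≠ u
      · filter_upwards [nhdsWithin_le_nhds (lt_mem_nhds (hlt _ h.1 h.2))] with γ hγ _ _
        exact hγ
      · exact Eventually.of_forall fun γ h1 h2 => absurd ⟨h1, h2⟩ h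
    exact (this.and self_mem_nhdsWithin).exists
  obtain ⟨s, hs0, hs1, hsγ⟩ : ∃ s : ℝ, 0 < s ∧ s < 1 ∧ γ < s * ℓ u := by
    have hc : Continuous fun s : ℝ => s * ℓ u := by fun_prop
    have h1 : ∀ᶠ s : ℝ in 𝓝[<] 1, γ < s * ℓ u :=
      nhdsWithin_le_nhds (hc.continuousAt.eventually (lt_mem_nhds (by simpa using hγu)))
    have h2 : ∀ᶠ s : ℝ in 𝓝[<] 1, 0 < s := nhdsWithin_le_nhds (lt_mem_nhds one_pos)
    obtain ⟨s, h1, h2, h3⟩ := (h1.and (h2.and self_mem_nhdsWithin)).exists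
    exact ⟨s, h2, h3, h1⟩
  have e1 : ∀ᶠ x : ι → ℝ in 𝓝 β, ∀ l ∈ S, c l (s • u) < x l := (S.eventually_all).2 fun l hl =>
    (continuous_apply l).continuousAt.eventually (lt_mem_nhds (by
      rw [map_smul, smul_eq_mul]
      nlinarith [hu l hl, hβ l hl]))
  have e2 : ∀ᶠ x : ι → ℝ in 𝓝 β, ∀ I ∈ S.powerset, DInd c I → (∀ l ∈ S, c l (v I β) ≤ β l) →
      v I β ≠ u → ℓ (v I x) < γ := by
    refine (S.powerset.eventually_all).2 fun I hI => ?_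
    by_cases h : DInd c I ∧ (∀ l ∈ S, c l (v I β) ≤ β l) ∧ v I β ≠ u
    · filter_upwards [(ℓ.continuous.comp (hv I h.1)).continuousAt.eventually
        (gt_mem_nhds (hγ I hI h.2.1 h.2.2))] with x hx _ _ _
      exact hx
    · exact Eventually.of_forall fun x h1 h2 h3 => absurd ⟨h1, h2, h3⟩ h
  filter_upwards [e1, e2, eventually_exists_vertex hS hrec hβ hv hvJ] with x hx1 hx2 hx3 hG
  have hfin : finrank ℝ (F × ℝ) = finrank ℝ F + 1 := by simp
  have hsimple := simpleConfig_homConfig (Finset.card_pos.1 (by omega)) hrec hx3.1 hG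
  obtain ⟨I, hI, -, z, hz, hza⟩ := exists_vertex (A := homConfig c x) (S := S) (by omega)
    hsimple.card_tight (a := γ • .snd ℝ F ℝ - ℓ.comp (.fst ℝ F ℝ)) (y := (s • u, 1))
    (fun l hl => by
      rw [homConfig_apply, mul_one]
      exact sub_nonneg.2 (hx1 l hl).le)
    (by simpa using hsγ)
  refine ⟨I, hI, by_contra fun hne => ?_⟩
  obtain ⟨hD, hc, hf⟩ := hx3.2 hG I hI
  obtain ⟨-, hz2, h3, -⟩ := exists_of_wit_homConfig hS hrec hx3.1 hI hz
  have h4 := hx2 I (Finset.mem_powerset.2 hI.1) hD hf hne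
  rw [hD.eq_of_eq hc (v := v I x) fun l hl => (hvJ I hD x l hl).trans (h3 l hl).symm,
    map_smul, smul_eq_mul, inv_mul_lt_iff₀ hz2] at h4
  have h5 : γ * z.2 - ℓ z.1 < 0 := by simpa using hza
  linarith

/-- Perturbing the right-hand sides makes a polytope simple; the new vertices are near old ones,
and any two given vertices have new vertices near them. -/
theorem exists_simpleConfig (hS : finrank ℝ F + 1 ≤ S.card)
    (hrec : ∀ w, (∀ i ∈ S, c i w ≤ 0) → w = 0) (hβ : ∀ i ∈ S, 0 < β i)
    (hI : ∀ i ∈ S, ∃ z, c i z = β i ∧ ∀ j ∈ S, j ≠ i → c j z < β j) {u u' : F}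
    (hu : ∀ l ∈ S, c l u ≤ β l) (hu₀ : ∀ w, (∀ l ∈ S, c l u = β l → c l w = 0) → w = 0)
    (hu' : ∀ l ∈ S, c l u' ≤ β l) (hu₀' : ∀ w, (∀ l ∈ S, c l u' = β l → c l w = 0) → w = 0) :
    ∃ (A : ι → F × ℝ →L[ℝ] ℝ) (v : Finset ι → F), SimpleConfig A S ∧ Irred A S ∧
      (∀ I ∈ vtxSet A S, (∀ l ∈ I, c l (v I) = β l) ∧ (∀ l ∈ S, c l (v I) ≤ β l) ∧
        ∀ w, (∀ l ∈ I, c l w = 0) → w = 0) ∧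
      (∃ I ∈ vtxSet A S, v I = u) ∧ ∃ I ∈ vtxSet A S, v I = u' := by
  choose! v hv hvJ using fun (J : Finset ι) (hJ : DInd c J) => hJ.exists_solution
  obtain ⟨x, ⟨⟨⟨h1, h2⟩, h3, h4⟩, h5⟩, hG⟩ := exists_genRHS (c := c) (S := S)
    (((eventually_vertex_eq hS hrec hβ hv hvJ hu hu₀).and
      (eventually_vertex_eq hS hrec hβ hv hvJ hu' hu₀')).and
      (eventually_exists_vertex hS hrec hβ hv hvJ) |>.and (eventually_irred_homConfig hβ hI))
  refine ⟨homConfig c x, fun I => v I β, ?_, h5, fun I hI => ?_, h1 hG, h2 hG⟩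
  · exact simpleConfig_homConfig (Finset.card_pos.1 (by omega)) hrec h3 hG
  · obtain ⟨hD, hc, hf⟩ := h4 hG I hI
    exact ⟨hvJ I hD β, hf, fun w hw => hD.eq_of_eq hc fun l hl => by rw [hw l hl, map_zero]⟩

end Homogenization

/-! ### Irredundant presentation in the affine hull -/

section Presentation

variable {ι : Type*} [DecidableEq ι] {V : Type*} [NormedAddCommGroup V] [NormedSpace ℝ V]
  {W : Submodule ℝ V} {x₀ : V} {a : ι → V →L[ℝ] ℝ} {b : ι → ℝ} {S : Finset ι}

/-- Passing to the affine hull, all remaining inequalities are strict somewhere. -/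
theorem exists_strict (hne : (polySet W x₀ a b S).Nonempty) :
    ∃ x₁, ∃ S' ⊆ S, polySet W x₀ a b S =
      polySet (vectorSpan ℝ (polySet W x₀ a b S)) x₁ a b S' ∧ ∀ i ∈ S', a i x₁ < b i := by
  obtain ⟨x, hx, hP⟩ := exists_eq_tightFace (IsExposed.refl (polySet W x₀ a b S)) hne
  have hspan := vectorSpan_tightFace hx
  rw [← hP] at hspan
  refine ⟨x, S \ tight a b S x, Finset.sdiff_subset, ?_, fun i hi => ?_⟩
  · rw [hspan]
    ext y
    constructor
    · intro hy
      refine ⟨⟨sub_mem_of_mem hy hx, fun i hi => ?_⟩, fun i hi => hy.2 i (Finset.sdiff_subset hi)⟩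
      rw [hP] at hy
      rw [map_sub, hy.2 i hi, (mem_tight.1 hi).2, sub_self]
    · rintro ⟨⟨h1, h2⟩, h3⟩
      refine ⟨by simpa using W.add_mem h1 hx.1, fun i hi => ?_⟩
      by_cases hit : i ∈ tight a b S x
      · have := h2 i hit
        rw [map_sub, sub_eq_zero] at this
        rw [this]
        exact hx.2 i hi
      · exact h3 i (Finset.mem_sdiff.2 ⟨hi, hit⟩)
  · rw [Finset.mem_sdiff] at hi
    exact (hx.2 i hi.1).lt_of_ne fun h => hi.2 (mem_tight.2 ⟨hi.1, h⟩)

/-- Superfluous inequalities can be dropped. -/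
theorem exists_irredundant (hx₀ : ∀ i ∈ S, a i x₀ < b i) :
    ∃ S' ⊆ S, polySet W x₀ a b S = polySet W x₀ a b S' ∧
      ∀ i ∈ S', ∃ z ∈ polySet W x₀ a b S', tight a b S' z = {i} := by
  obtain ⟨S', ⟨hS', heq⟩, hmin⟩ := WellFounded.has_min (measure fun T : Finset ι => T.card).wf
    {T | T ⊆ S ∧ polySet W x₀ a b S = polySet W x₀ a b T} ⟨S, subset_rfl, rfl⟩
  refine ⟨S', hS', heq, fun i hi => ?_⟩
  obtain ⟨x, hx, hxi⟩ : ∃ x ∈ polySet W x₀ a b (S'.erase i), b i < a i x := by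
    by_contra hcon
    push Not at hcon
    refine hmin (S'.erase i) ⟨(Finset.erase_subset _ _).trans hS', ?_⟩
      (Finset.card_erase_lt_of_mem hi)
    rw [heq]
    ext y
    refine ⟨fun hy => ⟨hy.1, fun j hj => hy.2 j (Finset.mem_of_mem_erase hj)⟩,
      fun hy => ⟨hy.1, fun j hj => ?_⟩⟩
    by_cases hji : j = i
    · exact hji ▸ hcon y hy
    · exact hy.2 j (Finset.mem_erase.2 ⟨hji, hj⟩)
  have h0 := hx₀ i (hS' hi)
  -- At this parameter the segment from the strictly feasible `x₀` to `x`, which violates only `i`,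
  -- crosses the hyperplane of `i`.
  set t : ℝ := (b i - a i x₀) / (a i x - a i x₀) with ht
  have hpos : 0 < a i x - a i x₀ := by linarith
  have ht0 : 0 < t := div_pos (by linarith) hpos
  have ht1 : t < 1 := (div_lt_one hpos).2 (by linarith)
  have hti : a i (x₀ + t • (x - x₀)) = b i := by
    rw [map_add, map_smul, smul_eq_mul, map_sub, ht, div_mul_cancel₀ _ hpos.ne']
    ring
  have htj : ∀ j ∈ S', j ≠ i → a j (x₀ + t • (x - x₀)) < b j := fun j hj hji => by
    have h1 := hx₀ j (hS' hj)
    have h2 := hx.2 j (Finset.mem_erase.2 ⟨hji, hj⟩)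
    rw [map_add, map_smul, smul_eq_mul, map_sub]
    nlinarith
  refine ⟨x₀ + t • (x - x₀), ⟨?_, fun j hj => ?_⟩, ?_⟩
  · rw [add_sub_cancel_left]
    exact W.smul_mem _ hx.1
  · by_cases hji : j = i
    · rw [hji, hti]
    · exact (htj j hj hji).le
  · ext j
    rw [mem_tight, Finset.mem_singleton]
    constructor
    · rintro ⟨hj, h⟩
      by_contra hji
      exact (htj j hj hji).ne h
    · rintro rfl
      exact ⟨hi, hti⟩

/-- A bounded polyhedron has no recession directions. -/
theorem eq_zero_of_isBounded (hb : Bornology.IsBounded (polySet W x₀ a b S))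
    (hx₀ : ∀ i ∈ S, a i x₀ < b i) {w : V} (hw : w ∈ W) (h : ∀ i ∈ S, a i w ≤ 0) : w = 0 := by
  obtain ⟨R, hR⟩ := hb.exists_norm_le
  by_contra hw0
  have hn : 0 < ‖w‖ := norm_pos_iff.2 hw0
  set t : ℝ := (|R| + ‖x₀‖ + 1) / ‖w‖ with ht
  have ht0 : 0 ≤ t := by positivity
  have hmem : x₀ + t • w ∈ polySet W x₀ a b S := by
    refine ⟨by rw [add_sub_cancel_left]; exact W.smul_mem _ hw, fun i hi => ?_⟩
    rw [map_add, map_smul, smul_eq_mul]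
    nlinarith [hx₀ i hi, h i hi]
  have h1 := hR _ hmem
  have h2 : ‖t • w‖ = |R| + ‖x₀‖ + 1 := by
    rw [norm_smul, Real.norm_of_nonneg ht0, ht, div_mul_cancel₀ _ hn.ne']
  have h3 := norm_le_add_norm_add x₀ (t • w)
  have h4 := norm_sub_le (x₀ + t • w) x₀
  rw [add_sub_cancel_left] at h4
  linarith [le_abs_self R]

end Presentation

/-! ### From a polytope to a simple configuration -/

section Polytope

variable {m : ℕ} {P : Set (EuclideanSpace ℝ (Fin m))} {d n : ℕ}

/-- The facet-defining inequalities of a polytope in its affine hull. -/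
theorem IsPolytopeOfDim.exists_polySet (hP : IsPolytopeOfDim P d) :
    ∃ (W : Submodule ℝ (EuclideanSpace ℝ (Fin m))) (x₀ : EuclideanSpace ℝ (Fin m))
      (a : EuclideanSpace ℝ (Fin m) × ℝ → EuclideanSpace ℝ (Fin m) →L[ℝ] ℝ)
      (b : EuclideanSpace ℝ (Fin m) × ℝ → ℝ) (S : Finset (EuclideanSpace ℝ (Fin m) × ℝ)),
      P = polySet W x₀ a b S ∧ finrank ℝ W = d ∧ (∀ i ∈ S, a i x₀ < b i) ∧
      ∀ i ∈ S, ∃ z ∈ polySet W x₀ a b S, tight a b S z = {i} := by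
  classical
  obtain ⟨⟨S, -, hPS⟩, -, hne, hd⟩ := hP
  have h0 : P = polySet ⊤ 0 (fun h => innerSL ℝ h.1) (fun h => h.2) S := by
    rw [hPS]
    ext x
    simp [polySet]
  rw [h0] at hne
  obtain ⟨x₁, S₁, -, h1, h2⟩ := exists_strict hne
  obtain ⟨S₂, h3, h4, h5⟩ := exists_irredundant h2
    (W := vectorSpan ℝ (polySet ⊤ 0 (fun h => innerSL ℝ h.1) (fun h => h.2) S))
  refine ⟨_, x₁, _, _, S₂, h0.trans (h1.trans h4), ?_, fun i hi => h2 i (h3 hi), h5⟩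
  rw [← h0, hd]

/-- The graph of a polytope whose diameter exceeds `k` comes from a simple configuration with the
same property. -/
theorem IsPolytopeOfDim.exists_simpleConfig (hP : IsPolytopeOfDim P d)
    (hn : (polytopeFacets P d).encard = n) (hdn : d + 1 ≤ n) {k : ℕ}
    (hk : ¬ (polytopeGraph P).ediam ≤ k) :
    ∃ (W : Submodule ℝ (EuclideanSpace ℝ (Fin m)))
      (A : EuclideanSpace ℝ (Fin m) × ℝ → W × ℝ →L[ℝ] ℝ)
      (S : Finset (EuclideanSpace ℝ (Fin m) × ℝ)),
      finrank ℝ W = d ∧ S.card = n ∧ SimpleConfig A S ∧ Irred A S ∧ ¬ FDiamLE (vtxSet A S) k := by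
  classical
  obtain ⟨W, x₀, a, b, S, rfl, rfl, hx₀, hI⟩ := hP.exists_polySet
  rw [encard_polytopeFacets hx₀ hI] at hn
  have hc : S.card = n := by exact_mod_cast hn
  rw [SimpleGraph.ediam_le_iff] at hk
  push Not at hk
  obtain ⟨u, v, huv⟩ := hk
  let c : EuclideanSpace ℝ (Fin m) × ℝ → W →L[ℝ] ℝ := fun i => (a i).comp W.subtypeL
  have hcw : ∀ i (w : W), c i w = a i w := fun _ _ => rfl
  have pt : ∀ x ∈ polySet W x₀ a b S, ∃ w : W, x₀ + (w : EuclideanSpace ℝ (Fin m)) = x :=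
    fun x hx => ⟨⟨x - x₀, hx.1⟩, by simp⟩
  have mem : ∀ w : W, x₀ + (w : EuclideanSpace ℝ (Fin m)) ∈ polySet W x₀ a b S ↔
      ∀ l ∈ S, c l w ≤ b l - a l x₀ := fun w => by
    simp only [polySet, Set.mem_ofPred_eq, add_sub_cancel_left, w.2, true_and, map_add, hcw]
    exact forall₂_congr fun l _ => (le_sub_iff_add_le').symm
  have teq : ∀ (w : W) l, a l (x₀ + w) = b l ↔ c l w = b l - a l x₀ := fun w l => by
    rw [map_add, hcw, eq_sub_iff_add_eq']
  have vert : ∀ w : W, x₀ + (w : EuclideanSpace ℝ (Fin m)) ∈ polytopeVertices (polySet W x₀ a b S) →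
      (∀ l ∈ S, c l w ≤ b l - a l x₀) ∧
        ∀ w' : W, (∀ l ∈ S, c l w = b l - a l x₀ → c l w' = 0) → w' = 0 := fun w hw => by
    obtain ⟨h1, h2⟩ := mem_polytopeVertices_iff.1 hw
    refine ⟨(mem w).1 h1, fun w' hw' => ?_⟩
    have : (w' : EuclideanSpace ℝ (Fin m)) ∈
        tightDir W a (tight a b S (x₀ + (w : EuclideanSpace ℝ (Fin m)))) :=
      ⟨w'.2, fun i hi => hw' i (tight_subset hi) ((teq w i).1 (mem_tight.1 hi).2)⟩
    rw [h2, Submodule.mem_bot] at this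
    exact Subtype.ext this
  obtain ⟨u₁, hu₁⟩ := pt u (mem_polytopeVertices_iff.1 u.2).1
  obtain ⟨v₁, hv₁⟩ := pt v (mem_polytopeVertices_iff.1 v.2).1
  have hu₂ := vert u₁ (hu₁ ▸ u.2)
  have hv₂ := vert v₁ (hv₁ ▸ v.2)
  obtain ⟨A, g, hA, hAI, hg, ⟨I, hI', hIu⟩, J, hJ', hJv⟩ := _root_.exists_simpleConfig
    (c := c) (β := fun i => b i - a i x₀) (S := S) (by omega)
    (fun w hw => Subtype.ext (eq_zero_of_isBounded hP.isBounded hx₀ w.2 hw))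
    (fun i hi => sub_pos.2 (hx₀ i hi)) (fun i hi => by
      obtain ⟨z, hz, hzi⟩ := hI i hi
      obtain ⟨w, rfl⟩ := pt z hz
      refine ⟨w, (teq w i).1 (mem_tight.1 (hzi ▸ Finset.mem_singleton_self i)).2,
        fun j hj hji => ((mem w).1 hz j hj).lt_of_ne fun h => hji ?_⟩
      rw [← Finset.mem_singleton, ← hzi]
      exact mem_tight.2 ⟨hj, (teq w j).2 h⟩) hu₂.1 hu₂.2 hv₂.1 hv₂.2
  refine ⟨W, A, S, rfl, hc, hA, hAI, fun hle => huv.not_ge ?_⟩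
  have hbot : ∀ I ∈ vtxSet A S, tightDir W a I = ⊥ := fun I hI => by
    rw [Submodule.eq_bot_iff]
    intro w hw
    exact congrArg Subtype.val ((hg I hI).2.2 ⟨w, hw.1⟩ hw.2)
  -- Only an inclusion: an old vertex may lie on more facets than those of the new vertex sent to
  -- it.
  have htight : ∀ I ∈ vtxSet A S, I ⊆ tight a b S (x₀ + (g I : EuclideanSpace ℝ (Fin m))) :=
    fun I hI l hl => mem_tight.2 ⟨hI.1 hl, (teq _ l).2 ((hg I hI).1 l hl)⟩
  have hV : ∀ I ∈ vtxSet A S, ∃ p : polytopeVertices (polySet W x₀ a b S),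
      (p : EuclideanSpace ℝ (Fin m)) = x₀ + g I := fun I hI =>
    ⟨⟨_, mem_polytopeVertices_iff.2 ⟨(mem _).2 (hg I hI).2.1,
      eq_bot_iff.2 ((tightDir_mono (htight I hI)).trans_eq (hbot I hI))⟩⟩, rfl⟩
  have : Nonempty (polytopeVertices (polySet W x₀ a b S)) := ⟨u⟩
  choose! p hp using hV
  have hpu : p I = u := Subtype.ext (by rw [hp I hI', hIu, hu₁])
  have hpv : p J = v := Subtype.ext (by rw [hp J hJ', hJv, hv₁])
  rw [← hpu, ← hpv, ← stepReach_iff_edist_le]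
  refine (hle I hI' J hJ').map ?_
  rintro K L ⟨hK, hL, hKL, -⟩
  by_cases hne : p K = p L
  · exact Or.inl hne
  -- Both images are tight on `K ∩ L`, whose tight directions have dimension at most `|K \ L| = 1`;
  -- the difference of the images supplies the other inequality.
  · refine Or.inr (polytopeGraph_adj_iff.2 ⟨hne, le_antisymm ?_ ?_⟩)
    · have h1 := finrank_tightDir_le (K ∩ L) (hbot K hK)
      rw [Finset.sdiff_inter_self_left, hKL] at h1
      refine (Submodule.finrank_mono (tightDir_mono ?_)).trans h1
      rw [hp K hK, hp L hL]
      exact Finset.inter_subset_inter (htight K hK) (htight L hL)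
    · refine finrank_pos_iff_exists_ne_zero.2 ⟨⟨(p K : EuclideanSpace ℝ (Fin m)) - p L,
        sub_mem_of_mem (mem_polytopeVertices_iff.1 (p K).2).1 (mem_polytopeVertices_iff.1 (p L).2).1,
        fun i hi => ?_⟩, fun h0 => hne (Subtype.ext (sub_eq_zero.1 (congrArg Subtype.val h0)))⟩
      rw [Finset.mem_inter, mem_tight, mem_tight] at hi
      rw [map_sub, hi.1.2, hi.2.2, sub_self]

end Polytope

/-! ### Conclusion -/

theorem lemma3p9 (d n : ℕ) (hn : 2 * d < n)
    (h : ∃ (m : ℕ) (P : Set (EuclideanSpace ℝ (Fin m))), IsHirschSharp P d n) :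
    (∃ (m : ℕ) (Q : Set (EuclideanSpace ℝ (Fin m))), IsHirschSharp Q (d + 1) (n + 1)) ∧
    (∃ (m : ℕ) (Q : Set (EuclideanSpace ℝ (Fin m))), IsHirschSharp Q (d + 1) (n + 2)) ∧
    (∃ (m : ℕ) (Q : Set (EuclideanSpace ℝ (Fin m))), IsHirschSharp Q (d + 1) (n + 3)) := by
  classical
  obtain ⟨m, P, hP, hF, hD⟩ := h
  have hd : 1 ≤ d := by
    -- For `d = 0` there are no facets, contradicting `n > 0`. Positive `d` makes the cone over the
    -- wedge at least three-dimensional.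
    rcases Nat.eq_zero_or_pos d with rfl | hd
    · have : polytopeFacets P 0 = ∅ := by
        ext F
        simp [polytopeFacets]
      rw [this, Set.encard_empty] at hF
      have : 0 = n := by exact_mod_cast hF
      omega
    · exact hd
  -- No truncation occurs in `n - d - 1`, as `d < n`; the cone over the base has dimension `d + 1`,
  -- so this is the number of constraints minus that dimension.
  obtain ⟨W, A, S, hW, hS, hA, hI, hk⟩ := hP.exists_simpleConfig hF (by omega) (k := n - d - 1)
    fun hle => by
      have h1 : (n : ℕ∞) ≤ (n - d - 1 : ℕ) + d := hD ▸ add_le_add_left hle _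
      have h2 : n ≤ n - d - 1 + d := by exact_mod_cast h1
      omega
  have hE : finrank ℝ (W × ℝ) = d + 1 := by simp [hW]
  have main : ∀ j ≤ 2, ∃ (m : ℕ) (Q : Set (EuclideanSpace ℝ (Fin m))),
      IsHirschSharp Q (d + 1) (n + 1 + j) := by
    intro j hj
    obtain ⟨B, S', hc, hB, hBI, h1, h2⟩ := exists_sharp_configs hA hI (by omega) (by omega)
      (by omega) hk hj
    have hE' : finrank ℝ ((W × ℝ) × ℝ) = d + 1 + 1 := by
      rw [finrank_prod, hE, finrank_self]
    obtain ⟨Q, hQ⟩ := exists_isHirschSharp hE' (by omega) hB hBI (by omega) h1 h2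
    rw [hc, hS] at hQ
    exact ⟨d + 1, Q, hQ⟩
  exact ⟨main 0 (by omega), main 1 (by omega), main 2 (by omega)⟩
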